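/- **Setting.** Let $N\ge 1$ be an integer and let $V$ be the space of rational $2\times 2$ matrices of trace $0$, with $Q(X)=-N\det X$ and $(X,Y)=N\,\mathrm{tr}(XY)$ (signature $(2,1)$). $\mathrm{SL}_2(\mathbb Z)$ acts on $V$ by $g.X=gXg^{-1}$. Let $L\subset V$ be an even lattice of full rank, $L'$ its dual lattice, $(\mathfrak e_h)_{h\in L'/L}$ the standard basis of $\mathbb C[L'/L]$, and let $\Gamma\subset \mathrm{SL}_2(\mathbb Z)$ be a congruence subgroup that takes $L$ to itself and acts trivially on $L'/L$. Write $e(w)=e^{2\pi i w}$. *Automorphic forms.* Let $\mathrm{Mp}_2(\mathbb Z)$ be the group of pairs $(\gamma,\phi)$ with $\gamma=\left(\begin{smallmatrix}a&b\\c&d\end{smallmatrix}\right)\in \mathrm{SL}_2(\mathbb Z)$ and $\phi$ holomorphic on $\mathbb H$, $\phi(\tau)^2=c\tau+d$. Let $\rho_L$ be its Weil representation on $\mathbb C[L'/L]$, given on the generators $T=\left(\left(\begin{smallmatrix}1&1\\0&1\end{smallmatrix}\right),1\right)$ and $S=\left(\left(\begin{smallmatrix}0&-1\\1&0\end{smallmatrix}\right),\sqrt\tau\right)$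 by $\rho_L(T)\mathfrak e_h=e(Q(h))\mathfrak e_h$ and $\rho_L(S)\mathfrak e_h=e(-\tfrac18)|L'/L|^{-1/2}\sum_{h'}e(-(h,h'))\mathfrak e_{h'}$. Let $A_{1/2,L}$ be the space of $C^\infty$ functions $F:\mathbb H\to\mathbb C[L'/L]$ with $F(\gamma\tau)=\phi(\tau)\rho_L(\gamma,\phi)F(\tau)$ for all $(\gamma,\phi)\in \mathrm{Mp}_2(\mathbb Z)$. A *weak Maass form* of weight $0$ for $\Gamma$ with eigenvalue $\lambda$ is a $\Gamma$-invariant $C^\infty$ function $f:\mathbb H\to\mathbb C$ with $-y^2(\partial_x^2+\partial_y^2)f=\lambda f$ for which there is $C>0$ such that $f(\delta z)=O(e^{Cy})$ as $y\to\infty$, uniformly in $x$, for every $\delta\in \mathrm{SL}_2(\mathbb Z)$. *Cusps.* Let $\mathrm{Iso}(V)$ be the set of isotropic lines of $V$ and $\ell_0$ the line spanned by $u_0=\left(\begin{smallmatrix}0&1\\0&0\end{smallmatrix}\right)$. For each class in $\Gamma\backslash\mathrm{Iso}(V)$ choose a representative $\ell$ and $\sigma_\ell\in \mathrm{SL}_2(\mathbb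 Z)$ with $\sigma_\ell\ell_0=\ell$. Let $\alpha_\ell$ be the width of the cusp $\ell$ (the least integer $k\ge1$ with $\pm\sigma_\ell\left(\begin{smallmatrix}1&k\\0&1\end{smallmatrix}\right)\sigma_\ell^{-1}\in\Gamma$ for some sign), let $\beta_\ell>0$ be the rational number such that $\beta_\ell\,\sigma_\ell.u_0$ is a primitive element of $\ell\cap L$, and put $\varepsilon_\ell=\alpha_\ell/\beta_\ell$. The constant term of the Fourier expansion of $f$ at $\ell$ is the function $a_\ell(0,y)=\frac1{\alpha_\ell}\int_0^{\alpha_\ell}f(\sigma_\ell(x+iy))\,dx$ of $y>0$. *Theta functions.* For $z=x+iy\in\mathbb H$ put $X(z)=\frac1{\sqrt N y}\left(\begin{smallmatrix}-x&z\bar z\\-1&x\end{smallmatrix}\right)$ and $(X,X)_z=(X,X)+(X,X(z))^2$. For $\tau=u+iv\in\mathbb H$ put $\varphi_0(X,\tau,z)=\sqrt v\,e^{\pi i (u(X,X)+iv(X,X)_z)}$ and $\Theta_L(\tau,z,\varphi_0)=\sum_{h\in L'/L}\sum_{X\in h+L}\varphi_0(X,\tau,z)\,\mathfrak e_h$. For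 $\ell\in\mathrm{Iso}(V)$ let $K_\ell=(L\cap\ell^\perp)/(L\cap\ell)$, a lattice in $\ell^\perp/\ell$ with the quadratic form $Q(\bar X)=Q(X)$. Put $\tilde\Theta_{K_\ell}(\tau)=\sum_h\sum_{\lambda\in\bar h+K_\ell}e(Q(\lambda)\tau)\,\mathfrak e_h$, where $h$ runs over the classes in $L'/L$ that have a representative in $L'\cap\ell^\perp$ and $\bar h$ is the image of such a representative in $\ell^\perp/\ell$. *Regularized lift.* Let $\mathcal F=\{|x|\le\frac12,\ |z|\ge1\}$, $\mathcal F^a=\bigcup_{j=0}^{a-1}\left(\begin{smallmatrix}1&j\\0&1\end{smallmatrix}\right)\mathcal F$, $\mathcal F^a_T=\{z\in\mathcal F^a:\ y\le T\}$, $d\mu=dx\,dy/y^2$, and $$I^{reg}(\tau,s,f)=\sum_{\ell\in\Gamma\backslash\mathrm{Iso}(V)}\lim_{T\to\infty}\int_{\mathcal F_T^{\alpha_\ell}}f(\sigma_\ell z)\,\Theta_L(\tau,\sigma_\ell z,\varphi_0)\,y^{-s}\,d\mu(z).$$ Let $I^{reg}(\tau,f)$ be the constant term at $s=0$ of the Laurent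 expansion of the meromorphic continuation of $I^{reg}(\tau,s,f)$ in $s$. **Proposition.** Let $s'\in\mathbb C$ and let $f$ be a weak Maass form of weight $0$ for $\Gamma$ with eigenvalue $s'(1-s')$. If $s'\ne\frac12$, then the constant terms of $f$ have the form $a_\ell(0,y)=A_\ell y^{s'}+B_\ell y^{1-s'}$ with constants $A_\ell,B_\ell\in\mathbb C$; if $s'=\frac12$, suppose that they have this form. Then, for any such constants: 1. For each cusp $\ell$ and each $\tau\in\mathbb H$ the limit in $I^{reg}(\tau,s,f)$ converges locally uniformly in $s$ for $\mathrm{Re}(s)>\max(\mathrm{Re}\,s',1-\mathrm{Re}\,s')$, and for each such $s$ the function $\tau\mapsto I^{reg}(\tau,s,f)$ belongs to $A_{1/2,L}$. 2. $I^{reg}(\tau,s,f)$ has a meromorphic continuation to all $s\in\mathbb C$, which is holomorphic except for at most first order poles at $s=s'$ and $s=1-s'$. 3. The function $$I^{reg}(\tau,s,f)-\frac1{\sqrt N}\sum_{\ell\in\Gamma\backslash\mathrm{Iso}(V)}\varepsilon_\ell\,\tilde\Theta_{K_\ell}(\tau)\left(\frac{A_\ell}{s-s'}+\frac{B_\ell}{s+s'-1}\right)$$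 has a holomorphic continuation to all $s\in\mathbb C$. 4. The regularized theta lift $I^{reg}(\tau,f)$ belongs to $A_{1/2,L}$. -/

import Mathlib

open UpperHalfPlane Filter Topology MeasureTheory
open scoped MatrixGroups Modular ContDiff Manifold

noncomputable section

namespace RegTheta

/-- `e(w) = exp (2 π i w)`. -/
def e (w : ℂ) : ℂ := Complex.exp (2 * Real.pi * Complex.I * w)

/-! ### The quadratic space of trace zero matrices -/

/-- The space `V` of rational `2 × 2` matrices of trace zero. -/
def V : Type := LinearMap.ker (Matrix.traceLinearMap (Fin 2) ℚ ℚ)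

instance : AddCommGroup V :=
  inferInstanceAs (AddCommGroup (LinearMap.ker (Matrix.traceLinearMap (Fin 2) ℚ ℚ)))

instance : Module ℚ V :=
  inferInstanceAs (Module ℚ (LinearMap.ker (Matrix.traceLinearMap (Fin 2) ℚ ℚ)))

@[simp] lemma V.coe_add (X Y : V) : (X + Y).1 = X.1 + Y.1 := rfl
@[simp] lemma V.coe_smul (c : ℚ) (X : V) : (c • X).1 = c • X.1 := rfl
@[simp] lemma V.coe_zero : (0 : V).1 = 0 := rfl

/-- The bilinear form `(X, Y) = N tr (X Y)` on `V`. -/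
def form (N : ℕ) : LinearMap.BilinForm ℚ V :=
  LinearMap.mk₂ ℚ (fun X Y => (N : ℚ) * Matrix.trace (X.1 * Y.1))
    (by intro X Y Z; simp [add_mul, mul_add])
    (by intro c X Y; simp; ring)
    (by intro X Y Z; simp [mul_add])
    (by intro c X Y; simp; ring)

/-- The quadratic form `Q(X) = - N det X` on `V`. -/
def quad (N : ℕ) (X : V) : ℚ := -(N : ℚ) * X.1.det

/-- The rational matrix underlying an element of `SL₂(ℤ)`. -/
def ratMat (g : SL(2, ℤ)) : Matrix (Fin 2) (Fin 2) ℚ := (g.1).map (Int.cast : ℤ → ℚ)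

lemma ratMat_one : ratMat 1 = 1 := by
  ext i j
  fin_cases i <;> fin_cases j <;> simp [ratMat]

lemma ratMat_mul (g h : SL(2, ℤ)) : ratMat (g * h) = ratMat g * ratMat h := by
  ext i j
  simp [ratMat, Matrix.mul_apply]

lemma det_ratMat (g : SL(2, ℤ)) : (ratMat g).det = 1 := by
  have h := g.2
  rw [Matrix.det_fin_two] at h ⊢
  simp only [ratMat, Matrix.map_apply]
  exact_mod_cast h

lemma ratMat_inv_mul (g : SL(2, ℤ)) : ratMat g⁻¹ * ratMat g = 1 := by
  rw [← ratMat_mul, inv_mul_cancel, ratMat_one]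

lemma trace_conj (g : SL(2, ℤ)) (X : V) : Matrix.trace (ratMat g * X.1 * ratMat g⁻¹) = 0 := by
  have h : Matrix.trace X.1 = 0 := X.2
  rw [Matrix.trace_mul_comm, ← mul_assoc, ratMat_inv_mul, one_mul, h]

/-- The action `g.X = g X g⁻¹` of `SL₂(ℤ)` on `V`. -/
def conj (g : SL(2, ℤ)) : V →ₗ[ℚ] V where
  toFun X := ⟨ratMat g * X.1 * ratMat g⁻¹, trace_conj g X⟩
  map_add' X Y := Subtype.ext (by
    change ratMat g * (X.1 + Y.1) * ratMat g⁻¹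
      = ratMat g * X.1 * ratMat g⁻¹ + ratMat g * Y.1 * ratMat g⁻¹
    rw [mul_add, add_mul])
  map_smul' c X := Subtype.ext (by
    change ratMat g * (c • X.1) * ratMat g⁻¹ = c • (ratMat g * X.1 * ratMat g⁻¹)
    rw [mul_smul_comm, smul_mul_assoc])

lemma coe_conj (g : SL(2, ℤ)) (X : V) : (conj g X).1 = ratMat g * X.1 * ratMat g⁻¹ := rfl

lemma conj_one : conj 1 = LinearMap.id := by
  ext1 X
  apply Subtype.ext
  rw [coe_conj, inv_one, ratMat_one, one_mul, mul_one, LinearMap.id_apply]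

lemma conj_mul (g h : SL(2, ℤ)) : conj (g * h) = conj g ∘ₗ conj h := by
  ext1 X
  apply Subtype.ext
  rw [LinearMap.comp_apply, coe_conj, coe_conj, coe_conj, mul_inv_rev, ratMat_mul, ratMat_mul]
  simp only [mul_assoc]

lemma quad_conj (N : ℕ) (g : SL(2, ℤ)) (X : V) : quad N (conj g X) = quad N X := by
  simp [quad, coe_conj, det_ratMat]

lemma conj_ne_zero (g : SL(2, ℤ)) {X : V} (hX : X ≠ 0) : conj g X ≠ 0 := by
  intro h
  apply hX
  have h2 := congrArg (conj g⁻¹) h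
  rwa [map_zero, ← LinearMap.comp_apply, ← conj_mul, inv_mul_cancel, conj_one] at h2

/-- `Iso(V)`: the isotropic lines of `V`. -/
def IsoLine (N : ℕ) : Type :=
  {ℓ : Submodule ℚ V // ∃ X : V, X ≠ 0 ∧ quad N X = 0 ∧ ℓ = Submodule.span ℚ {X}}

instance (N : ℕ) : MulAction SL(2, ℤ) (IsoLine N) where
  smul g ℓ := ⟨ℓ.1.map (conj g), by
    obtain ⟨X, hX, hq, hl⟩ := ℓ.2
    refine ⟨conj g X, conj_ne_zero g hX, by rw [quad_conj, hq], ?_⟩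
    rw [hl, Submodule.map_span, Set.image_singleton]⟩
  one_smul ℓ := Subtype.ext (by
    change ℓ.1.map (conj 1) = ℓ.1
    rw [conj_one, Submodule.map_id])
  mul_smul g h ℓ := Subtype.ext (by
    change ℓ.1.map (conj (g * h)) = (ℓ.1.map (conj h)).map (conj g)
    rw [conj_mul, Submodule.map_comp])

/-- The isotropic vector `u₀`. -/
def u0 : V := ⟨!![0, 1; 0, 0], by simp [Matrix.trace]⟩

/-- The isotropic line `ℓ₀` spanned by `u₀`; it corresponds to the cusp `∞`. -/
def ell0 (N : ℕ) : IsoLine N :=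
  ⟨Submodule.span ℚ {u0}, u0, by
    intro h
    have h2 := congrArg (fun X : V => X.1 0 1) h
    simp [u0] at h2, by simp [quad, u0, Matrix.det_fin_two], rfl⟩

/-- The set `Γ \ Iso(V)` of cusps. -/
abbrev Cusps (N : ℕ) (Γ : Subgroup SL(2, ℤ)) : Type :=
  MulAction.orbitRel.Quotient Γ (IsoLine N)

/-- The cusp represented by an isotropic line. -/
def toCusp {N : ℕ} (Γ : Subgroup SL(2, ℤ)) (ℓ : IsoLine N) : Cusps N Γ :=
  Quotient.mk _ ℓ

/-! ### Lattices and discriminant groups -/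

/-- `L` is an even lattice of full rank in `V`. -/
structure IsEvenLattice (N : ℕ) (L : Submodule ℤ V) : Prop where
  isLattice : Submodule.IsLattice ℚ L
  even : ∀ X ∈ L, ∃ n : ℤ, quad N X = n

/-- The dual lattice `L' = {X ∈ V : (X, Y) ∈ ℤ for all Y ∈ L}`. -/
abbrev dual (N : ℕ) (L : Submodule ℤ V) : Submodule ℤ V := (form N).dualSubmodule L

/-- The discriminant group `L'/L`. -/
abbrev Disc (N : ℕ) (L : Submodule ℤ V) : Type :=
  dual N L ⧸ L.submoduleOf (dual N L)

/-- The class in `L'/L` of a vector of `L'`. -/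
def toDisc (N : ℕ) (L : Submodule ℤ V) (X : dual N L) : Disc N L :=
  Submodule.Quotient.mk X

/-- A representative in `L'` of a class in `L'/L`. -/
def rep {N : ℕ} {L : Submodule ℤ V} (h : Disc N L) : V := ((Quotient.out h : dual N L) : V)

/-- `Γ` is a congruence subgroup that takes `L` to itself and acts trivially on `L'/L`. -/
structure IsAdmissible (N : ℕ) (L : Submodule ℤ V) (Γ : Subgroup SL(2, ℤ)) : Prop where
  congruence : CongruenceSubgroup.IsCongruenceSubgroup Γ
  stable : ∀ γ ∈ Γ, ∀ X ∈ L, conj γ X ∈ L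
  trivial : ∀ γ ∈ Γ, ∀ X ∈ dual N L, conj γ X - X ∈ L

/-! ### The metaplectic group, the Weil representation, automorphic forms -/

/-- The automorphy factor `j(g, τ) = c τ + d`. -/
def jfac (g : SL(2, ℤ)) (τ : ℍ) : ℂ := (g.1 1 0 : ℂ) * τ + (g.1 1 1 : ℂ)

lemma coe_smul_mul_jfac (g : SL(2, ℤ)) (τ : ℍ) :
    ((g • τ : ℍ) : ℂ) * jfac g τ = (g.1 0 0 : ℂ) * τ + (g.1 0 1 : ℂ) := by
  have h := UpperHalfPlane.denom_ne_zero ((g : SL(2, ℤ)) : GL (Fin 2) ℝ) τ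
  have h2 : jfac g τ ≠ 0 := by simpa [jfac, UpperHalfPlane.denom] using h
  have h3 := UpperHalfPlane.coe_specialLinearGroup_apply g τ
  rw [h3]
  simp only [jfac] at h2 ⊢
  simp only [algebraMap_int_eq, eq_intCast, Complex.ofReal_intCast]
  exact div_mul_cancel₀ _ h2

lemma jfac_ne_zero (g : SL(2, ℤ)) (τ : ℍ) : jfac g τ ≠ 0 := by
  have h := UpperHalfPlane.denom_ne_zero ((g : SL(2, ℤ)) : GL (Fin 2) ℝ) τ
  simpa [jfac, UpperHalfPlane.denom] using h

lemma jfac_mul (g h : SL(2, ℤ)) (τ : ℍ) : jfac (g * h) τ = jfac g (h • τ) * jfac h τ := by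
  have h1 := coe_smul_mul_jfac h τ
  have e1 : jfac g (h • τ) * jfac h τ
      = (g.1 1 0 : ℂ) * (((h • τ : ℍ) : ℂ) * jfac h τ) + (g.1 1 1 : ℂ) * jfac h τ := by
    rw [jfac]; ring
  rw [e1, h1]
  simp only [jfac, Matrix.SpecialLinearGroup.coe_mul, Matrix.mul_apply, Fin.sum_univ_two]
  push_cast
  ring

lemma mdifferentiable_smul_SL (g : SL(2, ℤ)) :
    MDifferentiable 𝓘(ℂ) 𝓘(ℂ) (fun τ : ℍ => g • τ) :=
  UpperHalfPlane.mdifferentiable_smul (g := ((g : SL(2, ℤ)) : GL (Fin 2) ℝ)) (by simp)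

/-- The group `Mp₂(ℤ)`: pairs `(γ, φ)` of `γ ∈ SL₂(ℤ)` and a holomorphic square root `φ`
of `τ ↦ c τ + d`. -/
@[ext]
structure Mp where
  mat : SL(2, ℤ)
  root : ℍ → ℂ
  holo : MDifferentiable 𝓘(ℂ) 𝓘(ℂ) root
  sq : ∀ τ : ℍ, root τ ^ 2 = jfac mat τ

lemma Mp.root_ne_zero (g : Mp) (τ : ℍ) : g.root τ ≠ 0 := by
  intro h
  apply jfac_ne_zero g.mat τ
  rw [← g.sq, h]
  simp

/-- The product is `(γ, φ(τ)) (γ', φ'(τ)) = (γ γ', φ(γ' τ) φ'(τ))`. -/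
instance : Mul Mp where
  mul g h :=
    { mat := g.mat * h.mat
      root := fun τ => g.root (h.mat • τ) * h.root τ
      holo := (g.holo.comp (mdifferentiable_smul_SL h.mat)).mul h.holo
      sq := fun τ => by rw [mul_pow, g.sq, h.sq, jfac_mul] }

instance : One Mp where
  one :=
    { mat := 1
      root := fun _ => 1
      holo := mdifferentiable_const
      sq := fun τ => by simp [jfac] }

instance : Inv Mp where
  inv g :=
    { mat := g.mat⁻¹
      root := fun τ => (g.root (g.mat⁻¹ • τ))⁻¹
      holo := by
        have h1 := g.holo.comp (mdifferentiable_smul_SL g.mat⁻¹)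
        rw [UpperHalfPlane.mdifferentiable_iff] at h1 ⊢
        exact h1.inv (fun z _ => g.root_ne_zero _)
      sq := fun τ => by
        have h := jfac_mul g.mat g.mat⁻¹ τ
        have h1 : jfac 1 τ = 1 := by simp [jfac]
        rw [mul_inv_cancel, h1] at h
        rw [inv_pow, g.sq]
        exact inv_eq_of_mul_eq_one_right h.symm }

@[simp] lemma Mp.mul_mat (g h : Mp) : (g * h).mat = g.mat * h.mat := rfl
@[simp] lemma Mp.mul_root (g h : Mp) (τ : ℍ) :
    (g * h).root τ = g.root (h.mat • τ) * h.root τ := rfl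
@[simp] lemma Mp.one_mat : (1 : Mp).mat = 1 := rfl
@[simp] lemma Mp.one_root (τ : ℍ) : (1 : Mp).root τ = 1 := rfl
@[simp] lemma Mp.inv_mat (g : Mp) : (g⁻¹).mat = g.mat⁻¹ := rfl
@[simp] lemma Mp.inv_root (g : Mp) (τ : ℍ) : (g⁻¹).root τ = (g.root (g.mat⁻¹ • τ))⁻¹ := rfl

instance : Group Mp where
  mul_assoc a b c := by
    apply Mp.ext
    · simp [mul_assoc]
    · funext τ
      simp [mul_assoc, mul_smul]
  one_mul a := by
    apply Mp.ext
    · simp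
    · funext τ
      simp
  mul_one a := by
    apply Mp.ext
    · simp
    · funext τ
      simp
  inv_mul_cancel a := by
    apply Mp.ext
    · simp
    · funext τ
      simp [a.root_ne_zero]

/-- The generator `T = ((1 1; 0 1), 1)`. -/
def mpT : Mp where
  mat := ModularGroup.T
  root := fun _ => 1
  holo := mdifferentiable_const
  sq τ := by simp [jfac, ModularGroup.T]

/-- The generator `S = ((0 -1; 1 0), √τ)`, with the principal branch of the square root. -/
def mpS : Mp where
  mat := ModularGroup.S
  root := fun τ => (τ : ℂ) ^ (1 / 2 : ℂ)
  holo := by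
    rw [UpperHalfPlane.mdifferentiable_iff]
    have h : DifferentiableOn ℂ (fun z : ℂ => z ^ (1 / 2 : ℂ)) {z | 0 < z.im} := by
      intro z hz
      have hz' : z ∈ Complex.slitPlane := Or.inr (ne_of_gt hz)
      exact (differentiableAt_id.cpow_const hz').differentiableWithinAt
    refine h.congr fun z hz => ?_
    simp [UpperHalfPlane.ofComplex_apply_of_im_pos hz]
  sq τ := by
    rw [← Complex.cpow_nat_mul]
    simp [jfac, ModularGroup.S]

/-- `ρ_L(T)`: `𝔢_h ↦ e(Q(h)) 𝔢_h`. An element `∑ F(h) 𝔢_h` of the group algebra `ℂ[L'/L]` is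
written as the function `F : L'/L → ℂ`. -/
def weilT (N : ℕ) (L : Submodule ℤ V) : Function.End (Disc N L → ℂ) :=
  fun F h => e (quad N (rep h) : ℂ) * F h

/-- `ρ_L(S)`: `𝔢_h ↦ √i ^ (b⁻ - b⁺) |L'/L| ^ (-1/2) ∑_{h'} e(-(h, h')) 𝔢_{h'}`, with
`(b⁺, b⁻) = (2, 1)`. -/
def weilS (N : ℕ) (L : Submodule ℤ V) : Function.End (Disc N L → ℂ) :=
  fun F h' => e (-1 / 8) / (Real.sqrt (Nat.card (Disc N L)) : ℂ) *
    ∑ᶠ h : Disc N L, e (-(form N (rep h) (rep h') : ℂ)) * F h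

/-- The graph `{(g, ρ_L(g))}` of the Weil representation `ρ_L` of `Mp₂(ℤ)` on `ℂ[L'/L]`, which is
determined by its values on the generators `S` and `T`. These generate `Mp₂(ℤ)` as a monoid,
because `S⁸ = 1` and `(S T)³ = S²`. -/
def weilGraph (N : ℕ) (L : Submodule ℤ V) : Submonoid (Mp × Function.End (Disc N L → ℂ)) :=
  Submonoid.closure {(mpT, weilT N L), (mpS, weilS N L)}

/-- A function on `ℍ` is `C^∞` (in the real sense). -/
def SmoothOnH (f : ℍ → ℂ) : Prop :=
  ContDiffOn ℝ ∞ (fun z : ℂ => f (ofComplex z)) {z : ℂ | 0 < z.im}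

/-- The space `A_{k,L}` with `k = κ / 2`: the `C^∞` functions `f : ℍ → ℂ[L'/L]` such that
`f(γ τ) = φ(τ) ^ (2 k) ρ_L(γ, φ) f(τ)` for all `(γ, φ) ∈ Mp₂(ℤ)`. -/
structure IsAutomorphicForm (N : ℕ) (L : Submodule ℤ V) (κ : ℤ)
    (f : ℍ → Disc N L → ℂ) : Prop where
  smooth : ∀ h, SmoothOnH fun τ => f τ h
  transform : ∀ (g : Mp) (R : Function.End (Disc N L → ℂ)), (g, R) ∈ weilGraph N L →
    ∀ τ : ℍ, f (g.mat • τ) = (g.root τ) ^ κ • (R (f τ) : Disc N L → ℂ)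

/-- `f` is a weak Maass form of weight `0` for `Γ` with eigenvalue `lam` under
`Δ = - y² (∂²/∂x² + ∂²/∂y²)`. -/
structure IsWeakMaassForm (Γ : Subgroup SL(2, ℤ)) (lam : ℂ) (f : ℍ → ℂ) : Prop where
  smooth : SmoothOnH f
  invariant : ∀ γ ∈ Γ, ∀ z : ℍ, f (γ • z) = f z
  eigen : ∀ z : ℍ, -((z.im : ℂ) ^ 2) *
    Laplacian.laplacian (fun w : ℂ => f (ofComplex w)) (z : ℂ) = lam * f z
  growth : ∃ C : ℝ, 0 < C ∧ ∀ δ : SL(2, ℤ),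
    (fun z : ℍ => f (δ • z)) =O[atImInfty] fun z : ℍ => Real.exp (C * z.im)

/-! ### Theta functions -/

/-- The real matrix `X(z) = (√N y)⁻¹ (-x, z z̄; -1, x)`. -/
def Xz (N : ℕ) (z : ℍ) : Matrix (Fin 2) (Fin 2) ℝ :=
  (Real.sqrt N * z.im)⁻¹ • !![-z.re, z.re ^ 2 + z.im ^ 2; -1, z.re]

/-- The pairing `(X, X(z)) = N tr (X X(z))`. -/
def pairXz (N : ℕ) (X : V) (z : ℍ) : ℝ :=
  N * Matrix.trace (X.1.map (Rat.cast : ℚ → ℝ) * Xz N z)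

/-- The majorant `(X, X)_z = (X, X) + (X, X(z))²`. -/
def majorant (N : ℕ) (X : V) (z : ℍ) : ℝ := (form N X X : ℝ) + pairXz N X z ^ 2

/-- `φ₀(X, τ, z) = √v exp (π i (u (X, X) + i v (X, X)_z))`. -/
def phi0 (N : ℕ) (X : V) (τ z : ℍ) : ℂ :=
  (Real.sqrt τ.im : ℂ) * Complex.exp (Real.pi * Complex.I *
    ((τ.re : ℂ) * (form N X X : ℂ) + Complex.I * (τ.im : ℂ) * (majorant N X z : ℂ)))

/-- The components `θ_h(τ, z, φ₀) = ∑_{X ∈ h + L} φ₀(X, τ, z)` of `Θ_L(τ, z, φ₀)`. -/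
def theta (N : ℕ) (L : Submodule ℤ V) (τ z : ℍ) (h : Disc N L) : ℂ :=
  ∑' X : {X : dual N L // toDisc N L X = h}, phi0 N (X.1 : V) τ z

/-- The orthogonal complement `ℓ^⊥` of a line. -/
abbrev perp (N : ℕ) (ℓ : IsoLine N) : Submodule ℚ V := (form N).orthogonal ℓ.1

/-- The space `W_ℓ = ℓ^⊥ / ℓ`. -/
abbrev Wspace (N : ℕ) (ℓ : IsoLine N) : Type := perp N ℓ ⧸ ℓ.1.submoduleOf (perp N ℓ)

/-- The class in `W_ℓ` of a vector of `ℓ^⊥`. -/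
def toW {N : ℕ} (ℓ : IsoLine N) (X : perp N ℓ) : Wspace N ℓ := Submodule.Quotient.mk X

/-- The quadratic form of `W_ℓ`: `Q(X̄) = Q(X)`, which does not depend on the representative. -/
def quadW {N : ℕ} (ℓ : IsoLine N) (w : Wspace N ℓ) : ℚ :=
  quad N ((Quotient.out w : perp N ℓ) : V)

/-- The lattice `K_ℓ = (L ∩ ℓ^⊥) / (L ∩ ℓ)` in `W_ℓ`, as the image of `L ∩ ℓ^⊥`. -/
def latK {N : ℕ} (L : Submodule ℤ V) (ℓ : IsoLine N) : Submodule ℤ (Wspace N ℓ) :=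
  (L.comap ((perp N ℓ).subtype.restrictScalars ℤ)).map
    ((Submodule.mkQ (ℓ.1.submoduleOf (perp N ℓ))).restrictScalars ℤ)

/-- The component `θ_{K_ℓ}(τ) = ∑_{w ∈ w₀ + K_ℓ} e(Q(w) τ)` of the theta function of `K_ℓ` at the
class of `w₀`. -/
def thetaK {N : ℕ} (L : Submodule ℤ V) (ℓ : IsoLine N) (τ : ℍ) (w₀ : Wspace N ℓ) : ℂ :=
  ∑' w : {w : Wspace N ℓ // w - w₀ ∈ latK L ℓ}, e ((quadW ℓ w.1 : ℂ) * τ)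

open Classical in
/-- The component at `h` of `Θ̃_{K_ℓ}(τ) = ∑_{h ⊥ ℓ} θ_{K_ℓ, h̄}(τ) 𝔢_h`, where the sum is over the
classes `h ∈ L'/L` that have a representative `X ∈ ℓ^⊥`, and `h̄` is the class of `X`. -/
def thetaTilde {N : ℕ} (L : Submodule ℤ V) (ℓ : IsoLine N) (τ : ℍ) (h : Disc N L) : ℂ :=
  if H : ∃ X : perp N ℓ, ∃ hX : (X : V) ∈ dual N L, toDisc N L ⟨X, hX⟩ = h then
    thetaK L ℓ τ (toW ℓ H.choose)
  else 0

/-! ### Cusp data -/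

/-- The width `α_ℓ` of the cusp `ℓ = σ ℓ₀`: the image of `σ⁻¹ Γ_ℓ σ` in `PSL₂(ℤ)` is generated by
the translation by `α_ℓ`. -/
def cuspWidth (Γ : Subgroup SL(2, ℤ)) (σ : SL(2, ℤ)) : ℕ :=
  sInf {k : ℕ | 0 < k ∧ (σ * ModularGroup.T ^ k * σ⁻¹ ∈ Γ ∨ -(σ * ModularGroup.T ^ k * σ⁻¹) ∈ Γ)}

/-- The number `β_ℓ > 0`, for `ℓ = σ ℓ₀` and `u_ℓ = σ.u₀`, such that `β_ℓ u_ℓ` is a primitive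
element of `ℓ ∩ L`. -/
def cuspBeta (L : Submodule ℤ V) (σ : SL(2, ℤ)) : ℝ :=
  sInf {t : ℝ | 0 < t ∧ ∃ q : ℚ, (q : ℝ) = t ∧ q • conj σ u0 ∈ L}

/-- `ε_ℓ = α_ℓ / β_ℓ`. -/
def cuspEps (L : Submodule ℤ V) (Γ : Subgroup SL(2, ℤ)) (σ : SL(2, ℤ)) : ℝ :=
  cuspWidth Γ σ / cuspBeta L σ

/-- The point `x + i y` of `ℍ` (used for `y > 0` only). -/
def pt (x y : ℝ) : ℍ := ofComplex (x + y * Complex.I)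

/-- The constant term (as a function of `y`) of the Fourier expansion of `f` at the cusp
`ℓ = σ ℓ₀`, where `f(σ z) = ∑ a_ℓ(n, y) e(n x / α_ℓ)`. -/
def fourierConst (Γ : Subgroup SL(2, ℤ)) (σ : SL(2, ℤ)) (f : ℍ → ℂ) (y : ℝ) : ℂ :=
  (cuspWidth Γ σ : ℂ)⁻¹ * ∫ x in (0 : ℝ)..(cuspWidth Γ σ : ℝ), f (σ • pt x y)

/-! ### The regularized theta lift -/

/-- `𝓕^a_T`: the points of height at most `T` in the union of the translates by `0, …, a - 1` of
the standard fundamental domain `𝒟` of `SL₂(ℤ)`. -/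
def truncDomain (a : ℕ) (T : ℝ) : Set ℍ :=
  {z : ℍ | (∃ j < a, ∃ w ∈ 𝒟, z = ModularGroup.T ^ j • w) ∧ z.im ≤ T}

/-- The component at `h` of `∫_{𝓕^{α_ℓ}_T} f(σ z) Θ_L(τ, σ z, φ₀) y^{-s} dμ(z)`, for `ℓ = σ ℓ₀`. The
measure `volume` on `ℍ` is `dμ = dx dy / y²`. -/
def truncIntegral (N : ℕ) (L : Submodule ℤ V) (Γ : Subgroup SL(2, ℤ)) (σ : SL(2, ℤ))
    (f : ℍ → ℂ) (τ : ℍ) (h : Disc N L) (T : ℝ) (s : ℂ) : ℂ :=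
  ∫ z in truncDomain (cuspWidth Γ σ) T,
    f (σ • z) * theta N L τ (σ • z) h * (z.im : ℂ) ^ (-s)

/-- The limit of `truncIntegral` as `T → ∞`. -/
def cuspIntegral (N : ℕ) (L : Submodule ℤ V) (Γ : Subgroup SL(2, ℤ)) (σ : SL(2, ℤ))
    (f : ℍ → ℂ) (τ : ℍ) (h : Disc N L) (s : ℂ) : ℂ :=
  limUnder atTop fun T : ℝ => truncIntegral N L Γ σ f τ h T s

/-- `I^reg(τ, s, f)`, the sum of the limits over the (finitely many) cusps; `σ` chooses for every
cusp an element of `SL₂(ℤ)` with `σ ℓ₀` in that cusp. -/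
def regIntegral (N : ℕ) (L : Submodule ℤ V) (Γ : Subgroup SL(2, ℤ))
    (σ : Cusps N Γ → SL(2, ℤ)) (f : ℍ → ℂ) (s : ℂ) (τ : ℍ) (h : Disc N L) : ℂ :=
  ∑ᶠ c : Cusps N Γ, cuspIntegral N L Γ (σ c) f τ h s

/-- `G` is the meromorphic continuation to `ℂ` of `F`, which is given on some right half plane:
`G` is meromorphic on `ℂ`, agrees with `F` on a right half plane, and its values are normalized at
removable singularities (by continuity) and at poles (to `0`), which makes `G` unique. -/
def IsMeromorphicContinuation (F G : ℂ → ℂ) : Prop :=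
  MeromorphicNFOn G Set.univ ∧ ∃ b : ℝ, ∀ s : ℂ, b < s.re → G s = F s

/-- The meromorphic continuation of `F`, if there is one. -/
def meroCont (F : ℂ → ℂ) : ℂ → ℂ := Classical.epsilon (IsMeromorphicContinuation F)

/-- `c` is the constant term of the Laurent expansion of `G` at `s₀`: for some polynomial `P`
without constant term, `G(s) - P((s - s₀)⁻¹) → c` as `s → s₀`. -/
def IsConstTerm (G : ℂ → ℂ) (s₀ c : ℂ) : Prop :=
  ∃ P : Polynomial ℂ, P.coeff 0 = 0 ∧
    Tendsto (fun s => G s - P.eval (s - s₀)⁻¹) (𝓝[≠] s₀) (𝓝 c)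

/-- `CT_{s = s₀} G`, the constant term of the Laurent expansion of `G` at `s₀`. -/
def constTerm (G : ℂ → ℂ) (s₀ : ℂ) : ℂ := Classical.epsilon (IsConstTerm G s₀)

/-- The meromorphic continuation of `s ↦ I^reg(τ, s, f)_h`. -/
def regCont (N : ℕ) (L : Submodule ℤ V) (Γ : Subgroup SL(2, ℤ))
    (σ : Cusps N Γ → SL(2, ℤ)) (f : ℍ → ℂ) (τ : ℍ) (h : Disc N L) : ℂ → ℂ :=
  meroCont fun s => regIntegral N L Γ σ f s τ h

/-- The regularized theta lift `I^reg(τ, f) = CT_{s = 0} I^reg(τ, s, f)`. -/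
def regLift (N : ℕ) (L : Submodule ℤ V) (Γ : Subgroup SL(2, ℤ))
    (σ : Cusps N Γ → SL(2, ℤ)) (f : ℍ → ℂ) (τ : ℍ) (h : Disc N L) : ℂ :=
  constTerm (regCont N L Γ σ f τ h) 0

end RegTheta

end

open RegTheta

/-! Fix a cusp and move it to infinity. Since `phi0` is equivariant, the kernel at `σ • z` is a
theta series over a coset of `σ⁻¹.L`. In a Hermite basis adapted to the flag `ℓ₀ ⊂ ℓ₀^⊥ ⊂ V`,
Poisson summation over the multiples of `u₀` alone gives (`theta_smul_eq`) that the kernel is `y /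
(β √N)` times the sum of `mainPart`, which does not depend on `z`, and `decayPart`, which is `O(exp
(-c y²))`. The main part is the theta function of `K_ℓ` (`thetaTilde_eq_mainPart`): its terms are
those with vanishing lower left entry and frequency `0`.

The Gaussian decay beats the growth `exp (C y)` of `f` and every power `y^{-s}`, so the decaying
part, together with the main part below height `1`, integrates to an entire function of `s`
(`cuspPart`). Above height `1` the domain is a rectangle whose width is one period of `f ∘ σ`; the
integral over `x` leaves `α (A y^{s'} + B y^{1-s'})`, and the integral over `1 < y ≤ T` is
elementary. It produces the two polar terms and powers `T^{s'-s}`, `T^{1-s'-s}`, which vanish in the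
limit exactly for `Re s` beyond the stated bound. This yields convergence, continuation and singular
part at once (`truncIntegral_eq`, `tendstoLocallyUniformlyOn_truncIntegral`, `regIntegral_eq`). The
continuation is the explicit function `regPolar`, by the identity theorem (`meroCont_spec`).

Smoothness in `τ = u + iv` comes from letting `u` and `v` be complex. All series and integrals are
locally dominated and holomorphic on an open set `paramDomain` of `ℂ × ℂ` containing the real pairs
with `v > 0`; holomorphic functions of several variables are smooth, and one restricts to real
pairs.

The transformation law is that of the theta kernel. For `T` it is a congruence for `Q`, for `S` it
is Poisson summation in three variables (`theta_T_smul`, `theta_S_smul`). A linear relation between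
the kernels at two points `τ`, `τ'` passes to the truncated integrals, to their limits, to the
continuations and to the constant terms, and the generators of `Mp₂(ℤ)` suffice.

The form of the constant term of `f` for `s' ≠ 1/2` follows by integrating the Laplace equation over
a period: the constant term solves an Euler equation. -/

noncomputable section

namespace RegTheta

/-! ### Holomorphic dependence on parameters in several variables. -/

section ParametricHolomorphic

variable {E : Type*} [NormedAddCommGroup E] [NormedSpace ℂ E]

/-- Cauchy's estimate for the derivative of a bounded holomorphic function on a ball. -/
lemma norm_fderiv_le_of_norm_le_ball {f : E → ℂ} {p : E} {r C : ℝ} (hr : 0 < r)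
    (hd : DifferentiableOn ℂ f (Metric.ball p r)) (hC : ∀ q ∈ Metric.ball p r, ‖f q‖ ≤ C) :
    ‖fderiv ℂ f p‖ ≤ 2 * C / r := by
  have hC0 : 0 ≤ C := (norm_nonneg _).trans (hC p (Metric.mem_ball_self hr))
  refine Complex.norm_fderiv_le_div_of_mapsTo_ball hd (fun q hq => ?_) hr
  rw [Metric.mem_closedBall, dist_eq_norm]
  have h1 := norm_sub_le (f q) (f p)
  have h2 := hC q hq
  have h3 := hC p (Metric.mem_ball_self hr)
  linarith

/-- Cauchy's formula on the complex line through `q` in direction `v`. It turns a derivative into an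
integral of values of `f`, which can then be differentiated in `q`. -/
lemma fderiv_apply_eq_circleIntegral {U : Set E} (hU : IsOpen U) {f : E → ℂ}
    (hf : DifferentiableOn ℂ f U) {q v : E} {R : ℝ} (hR : 0 < R)
    (hq : ∀ z ∈ Metric.closedBall (0 : ℂ) R, q + z • v ∈ U) :
    fderiv ℂ f q v = (2 * Real.pi * Complex.I)⁻¹ •
      ∮ z in C(0, R), ((z - 0) ^ 2)⁻¹ • f (q + z • v) := by
  have hcont : Continuous fun z : ℂ => q + z • v := by fun_prop
  have h1 := Complex.two_pi_I_inv_smul_circleIntegral_sub_sq_inv_smul_of_differentiable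
    (U := (fun z : ℂ => q + z • v) ⁻¹' U) (hU.preimage hcont) (c := 0) (R := R) (w₀ := 0)
    (f := fun z : ℂ => f (q + z • v)) hq ?_ (Metric.mem_ball_self hR)
  · rw [h1]
    have hq0 : q + (0 : ℂ) • v ∈ U := hq 0 (Metric.mem_closedBall_self hR.le)
    have hd := (hf.differentiableAt (hU.mem_nhds hq0)).hasFDerivAt
    have hl : HasDerivAt (fun z : ℂ => q + z • v) v 0 := by
      simpa using ((hasDerivAt_id (0 : ℂ)).smul_const v).const_add q
    have h2 := (hd.comp_hasDerivAt (0 : ℂ) hl).deriv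
    rw [zero_smul, add_zero] at h2
    exact h2.symm
  · exact hf.comp (by fun_prop) fun z hz => hz

variable [FiniteDimensional ℂ E] {α : Type*} [MeasurableSpace α] {μ : Measure α}

/-- Each directional derivative is a limit of the measurable difference quotients with step `1/n`;
finitely many directions determine the derivative. -/
lemma aestronglyMeasurable_fderiv_of_param {U : Set E} (hU : IsOpen U) {g : E → α → ℂ} {p : E}
    (hp : p ∈ U) (hmeas : ∀ q ∈ U, AEStronglyMeasurable (g q) μ)
    (hdiff : ∀ᵐ a ∂μ, DifferentiableAt ℂ (fun q => g q a) p) :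
    AEStronglyMeasurable (fun a => fderiv ℂ (fun q => g q a) p) μ := by
  have key : ∀ v : E, AEStronglyMeasurable (fun a => fderiv ℂ (fun q => g q a) p v) μ := by
    intro v
    have h0 : Tendsto (fun n : ℕ => p + ((n : ℂ))⁻¹ • v) atTop (𝓝 p) := by
      have : Tendsto (fun n : ℕ => ((n : ℂ))⁻¹ • v) atTop (𝓝 ((0 : ℂ) • v)) :=
        (tendsto_inv_atTop_nhds_zero_nat (𝕜 := ℂ)).smul_const v
      simpa using this.const_add p
    -- Measurability is known only on `U`, so the sequence of steps starts at an index from which `p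
    -- + v/n` stays in `U`.
    obtain ⟨n₀, hn₀⟩ := eventually_atTop.1 (h0.eventually (hU.mem_nhds hp))
    refine aestronglyMeasurable_of_tendsto_ae atTop
      (f := fun (n : ℕ) a => ((n + n₀ : ℕ) : ℂ) •
        (g (p + (((n + n₀ : ℕ) : ℂ))⁻¹ • v) a - g p a)) ?_ ?_
    · intro n
      simp only [smul_eq_mul]
      exact ((hmeas _ (hn₀ (n + n₀) (by omega))).sub (hmeas p hp)).const_mul _
    · filter_upwards [hdiff] with a ha
      refine ha.hasFDerivAt.lim v (c := fun n : ℕ => ((n + n₀ : ℕ) : ℂ)) ?_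
      simp only [Complex.norm_natCast]
      exact tendsto_natCast_atTop_atTop.comp (tendsto_add_atTop_nat n₀)
  let b := Module.finBasis ℂ E
  have : (fun a => fderiv ℂ (fun q => g q a) p) = fun a => ∑ i,
      fderiv ℂ (fun q => g q a) p (b i) • LinearMap.toContinuousLinearMap (b.coord i) := by
    funext a
    ext v
    conv_lhs => rw [← b.sum_repr v, map_sum]
    simp [mul_comm]
  rw [this]
  exact Finset.aestronglyMeasurable_fun_sum _ fun i _ => (key (b i)).smul_const _

/-- A locally dominated integral of holomorphic functions is holomorphic. -/
theorem differentiableOn_integral_of_locally_dominated {U : Set E} (hU : IsOpen U)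
    {g : E → α → ℂ} (hmeas : ∀ q ∈ U, AEStronglyMeasurable (g q) μ)
    (hdiff : ∀ᵐ a ∂μ, DifferentiableOn ℂ (fun q => g q a) U)
    (hb : ∀ p ∈ U, ∃ bound : α → ℝ, ∃ s ∈ 𝓝 p, Integrable bound μ ∧
      ∀ᵐ a ∂μ, ∀ q ∈ s, ‖g q a‖ ≤ bound a) :
    DifferentiableOn ℂ (fun q => ∫ a, g q a ∂μ) U := by
  intro p hp
  obtain ⟨bound, s, hs, hint, hbd⟩ := hb p hp
  obtain ⟨r, hr, hrs⟩ := Metric.mem_nhds_iff.1 (inter_mem hs (hU.mem_nhds hp))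
  have hrs1 : Metric.ball p r ⊆ s := fun q hq => (hrs hq).1
  have hrU : Metric.ball p r ⊆ U := fun q hq => (hrs hq).2
  have hsub : ∀ q ∈ Metric.ball p (r / 2), Metric.ball q (r / 2) ⊆ Metric.ball p r := by
    intro q hq
    refine Metric.ball_subset_ball' ?_
    rw [Metric.mem_ball] at hq
    linarith
  -- No bound on derivatives is assumed: Cauchy's estimate on balls of radius `r / 2` around points
  -- of `ball p (r / 2)` turns the majorant of `g` into one of its derivative.
  refine (hasFDerivAt_integral_of_dominated_of_fderiv_le
    (F' := fun q a => fderiv ℂ (fun q => g q a) q) (bound := fun a => 2 * bound a / (r / 2))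
    (Metric.ball_mem_nhds p (half_pos hr)) ?_ ?_ ?_ ?_ ?_ ?_).differentiableAt.differentiableWithinAt
  · filter_upwards [hU.mem_nhds hp] with q hq using hmeas q hq
  · refine hint.mono' (hmeas p hp) ?_
    filter_upwards [hbd] with a ha using ha p (hrs1 (Metric.mem_ball_self hr))
  · refine aestronglyMeasurable_fderiv_of_param hU hp hmeas ?_
    filter_upwards [hdiff] with a ha using ha.differentiableAt (hU.mem_nhds hp)
  · filter_upwards [hbd, hdiff] with a ha hd q hq
    exact norm_fderiv_le_of_norm_le_ball (half_pos hr) (hd.mono ((hsub q hq).trans hrU))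
      fun w hw => ha w (hrs1 (hsub q hq hw))
  · exact (hint.const_mul 2).div_const _
  · filter_upwards [hdiff] with a hd q hq
    exact (hd.differentiableAt (hU.mem_nhds (hrU
      (hsub q hq (Metric.mem_ball_self (half_pos hr)))))).hasFDerivAt

/-- By Cauchy's formula the derivative is a circle integral whose integrand is holomorphic in `q`
and locally bounded. Iteration gives smoothness. -/
lemma differentiableOn_fderiv_apply {U : Set E} (hU : IsOpen U) {f : E → ℂ}
    (hf : DifferentiableOn ℂ f U) (v : E) : DifferentiableOn ℂ (fun q => fderiv ℂ f q v) U := by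
  intro p hp
  have : ProperSpace E := FiniteDimensional.proper ℂ E
  obtain ⟨r, hr, hrU⟩ := Metric.isOpen_iff.1 hU p hp
  -- Small enough that the circle of radius `R` in direction `v` moves points by at most `r / 4`;
  -- the `+ 1` covers `v = 0`.
  set R := r / 4 / (‖v‖ + 1) with hRdef
  have hv : 0 < ‖v‖ + 1 := by positivity
  have hR : 0 < R := by positivity
  have hRv : R * ‖v‖ ≤ r / 4 := by
    rw [hRdef, div_mul_eq_mul_div, div_le_iff₀ hv]
    nlinarith [norm_nonneg v]
  have hmem : ∀ q ∈ Metric.ball p (r / 4), ∀ z ∈ Metric.closedBall (0 : ℂ) R,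
      q + z • v ∈ Metric.closedBall p (r / 2) := by
    intro q hq z hz
    rw [Metric.mem_ball, dist_eq_norm] at hq
    rw [mem_closedBall_zero_iff] at hz
    rw [Metric.mem_closedBall, dist_eq_norm]
    calc ‖q + z • v - p‖ = ‖(q - p) + z • v‖ := by congr 1; abel
      _ ≤ ‖q - p‖ + ‖z‖ * ‖v‖ := (norm_add_le _ _).trans (by rw [norm_smul])
      _ ≤ r / 4 + R * ‖v‖ := by gcongr
      _ ≤ r / 2 := by linarith
  have hsubU : Metric.closedBall p (r / 2) ⊆ U :=
    (Metric.closedBall_subset_ball (by linarith)).trans hrU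
  obtain ⟨C, hC⟩ := (isCompact_closedBall p (r / 2)).exists_bound_of_continuousOn
    (hf.continuousOn.mono hsubU)
  have hpi : (0 : ℝ) ≤ 2 * Real.pi := by positivity
  have hmem' : ∀ q ∈ Metric.ball p (r / 4), ∀ θ : ℝ,
      q + circleMap 0 R θ • v ∈ Metric.closedBall p (r / 2) := fun q hq θ =>
    hmem q hq _ (Metric.sphere_subset_closedBall (circleMap_mem_sphere 0 hR.le θ))
  have key : DifferentiableOn ℂ (fun q => ∫ θ in Set.Ioc 0 (2 * Real.pi),
      deriv (circleMap 0 R) θ • (((circleMap 0 R θ - 0) ^ 2)⁻¹ • f (q + circleMap 0 R θ • v)))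
      (Metric.ball p (r / 4)) := by
    refine differentiableOn_integral_of_locally_dominated Metric.isOpen_ball ?_ ?_ ?_
    · intro q hq
      have hc : Continuous fun θ : ℝ => f (q + circleMap 0 R θ • v) :=
        (hf.continuousOn.mono hsubU).comp_continuous (by fun_prop) (hmem' q hq)
      have hc2 : Continuous fun θ : ℝ => ((circleMap 0 R θ - 0) ^ 2)⁻¹ := by
        refine Continuous.inv₀ (by fun_prop) fun θ => ?_
        simpa using hR.ne'
      have hc3 : Continuous fun θ : ℝ => deriv (circleMap 0 R) θ := by
        simp only [deriv_circleMap]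
        fun_prop
      exact (hc3.smul (hc2.smul hc)).aestronglyMeasurable
    · refine Eventually.of_forall fun θ => ?_
      simp only [smul_eq_mul]
      refine DifferentiableOn.const_mul (DifferentiableOn.const_mul ?_ _) _
      exact hf.comp (by fun_prop) fun q hq => hsubU (hmem' q hq θ)
    · intro q hq
      refine ⟨fun _ => R * ((R ^ 2)⁻¹ * C), _, Metric.isOpen_ball.mem_nhds hq, integrable_const _, ?_⟩
      refine Eventually.of_forall fun θ w hw => ?_
      rw [norm_smul, norm_smul]
      have := hC _ (hmem' w hw θ)
      simp only [deriv_circleMap, norm_mul, norm_circleMap_zero, Complex.norm_I, mul_one, sub_zero,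
        norm_inv, norm_pow, abs_of_pos hR]
      gcongr
  have hnear : (fun q => fderiv ℂ f q v) =ᶠ[𝓝 p] fun q => (2 * Real.pi * Complex.I : ℂ)⁻¹ •
      ∫ θ in Set.Ioc 0 (2 * Real.pi),
      deriv (circleMap 0 R) θ • (((circleMap 0 R θ - 0) ^ 2)⁻¹ • f (q + circleMap 0 R θ • v)) := by
    filter_upwards [Metric.ball_mem_nhds p (show 0 < r / 4 by positivity)] with q hq
    rw [fderiv_apply_eq_circleIntegral hU hf hR fun z hz => hsubU (hmem q hq z hz),
      circleIntegral, intervalIntegral.integral_of_le hpi]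
  have hd := (key.differentiableAt (Metric.ball_mem_nhds p (show 0 < r / 4 by positivity)))
  simp only [smul_eq_mul] at hnear hd
  exact ((hd.const_mul ((2 * Real.pi * Complex.I : ℂ)⁻¹)).congr_of_eventuallyEq
    hnear).differentiableWithinAt

/-- Holomorphic functions of several variables are smooth. -/
theorem contDiffOn_of_differentiableOn {U : Set E} (hU : IsOpen U) {f : E → ℂ}
    (hf : DifferentiableOn ℂ f U) : ContDiffOn ℂ ∞ f U := by
  refine contDiffOn_infty.2 fun n => ?_
  induction n generalizing f with
  | zero => simpa using hf.continuousOn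
  | succ n ih =>
    push_cast
    refine (contDiffOn_succ_iff_fderiv_apply hU.uniqueDiffOn).2 ⟨hf, by simp, fun v => ?_⟩
    refine (ih (differentiableOn_fderiv_apply hU hf v)).congr fun q hq => ?_
    rw [fderivWithin_of_isOpen hU hq]

end ParametricHolomorphic
end RegTheta

namespace RegTheta

/-! ### Poisson summation in several real variables. -/

section Poisson

variable {d : Type*}

lemma unitAddTorus_isOpenQuotientMap :
    IsOpenQuotientMap (fun (x : d → ℝ) (i : d) => (x i : UnitAddCircle)) :=
  IsOpenQuotientMap.piMap fun _ => QuotientAddGroup.isOpenQuotientMap_mk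

variable [Fintype d]

lemma setIntegral_box_eq (h : (d → ℝ) → ℂ) (n : d → ℤ) :
    ∫ x in {x : d → ℝ | ∀ i, x i ∈ Set.Ioc (n i : ℝ) (n i + 1)}, h x =
      ∫ x in {x : d → ℝ | ∀ i, x i ∈ Set.Ioc (0 : ℝ) (0 + 1)}, h (fun i => x i + n i) := by
  have h1 := (measurePreserving_add_right (volume : Measure (d → ℝ))
    (fun i => (n i : ℝ))).setIntegral_preimage_emb
    (MeasurableEquiv.addRight (fun i => (n i : ℝ))).measurableEmbedding h
    {x : d → ℝ | ∀ i, x i ∈ Set.Ioc (n i : ℝ) (n i + 1)}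
  rw [← h1]
  have : ((fun x : d → ℝ => x + fun i => (n i : ℝ)) ⁻¹'
      {x : d → ℝ | ∀ i, x i ∈ Set.Ioc (n i : ℝ) (n i + 1)}) =
      {x : d → ℝ | ∀ i, x i ∈ Set.Ioc (0 : ℝ) (0 + 1)} := by
    ext x
    simp only [Set.mem_preimage, Set.mem_ofPred_eq, Pi.add_apply, Set.mem_Ioc]
    refine forall_congr' fun i => ?_
    constructor <;> rintro ⟨h1, h2⟩ <;> constructor <;> linarith
  rw [this]
  rfl

lemma measurableSet_box (a : d → ℝ) :
    MeasurableSet {x : d → ℝ | ∀ i, x i ∈ Set.Ioc (a i) (a i + 1)} := by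
  have : {x : d → ℝ | ∀ i, x i ∈ Set.Ioc (a i) (a i + 1)} =
      Set.univ.pi fun i => Set.Ioc (a i) (a i + 1) := by ext; simp
  rw [this]
  exact MeasurableSet.univ_pi fun i => measurableSet_Ioc

/-- The integral over `ℝ^d` is the sum of the integrals over the integral unit boxes. -/
lemma hasSum_setIntegral_box {h : (d → ℝ) → ℂ} (hh : Integrable h) :
    HasSum (fun n : d → ℤ => ∫ x in {x : d → ℝ | ∀ i, x i ∈ Set.Ioc (0 : ℝ) (0 + 1)},
      h (fun i => x i + n i)) (∫ x, h x) := by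
  have hU : (⋃ n : d → ℤ, {x : d → ℝ | ∀ i, x i ∈ Set.Ioc (n i : ℝ) (n i + 1)}) = Set.univ := by
    -- The boxes are open on the left and closed on the right, hence the ceiling minus one.
    refine Set.eq_univ_of_forall fun x => Set.mem_iUnion.2 ⟨fun i => ⌈x i⌉ - 1, fun i => ?_⟩
    push_cast
    exact ⟨by linarith [Int.ceil_lt_add_one (x i)], by linarith [Int.le_ceil (x i)]⟩
  have h1 := hasSum_integral_iUnion (μ := (volume : Measure (d → ℝ))) (f := h)
    (s := fun n : d → ℤ => {x : d → ℝ | ∀ i, x i ∈ Set.Ioc (n i : ℝ) (n i + 1)})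
    (fun n => measurableSet_box _) ?_ (by rw [hU]; exact hh.integrableOn)
  · rw [hU, setIntegral_univ] at h1
    simpa only [setIntegral_box_eq] using h1
  · intro n m hnm
    refine Set.disjoint_left.2 fun x hx hy => hnm ?_
    funext i
    obtain ⟨a1, a2⟩ := hx i
    obtain ⟨b1, b2⟩ := hy i
    have c1 : (n i : ℝ) < m i + 1 := by linarith
    have c2 : (m i : ℝ) < n i + 1 := by linarith
    norm_cast at c1 c2
    omega

/-- **Poisson summation** on `ℝ^d`. -/
theorem tsum_eq_tsum_fourier_of_summable {f : (d → ℝ) → ℂ} (hf : Continuous f)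
    (hint : Integrable f)
    (hb : ∀ R : ℝ, ∃ u : (d → ℤ) → ℝ, Summable u ∧
      ∀ n : d → ℤ, ∀ x : d → ℝ, ‖x‖ ≤ R → ‖f (fun i => x i + n i)‖ ≤ u n)
    (hsum : Summable fun m : d → ℤ =>
      ∫ x : d → ℝ, Complex.exp (-(2 * Real.pi * Complex.I * ∑ i, (m i : ℂ) * x i)) * f x) :
    ∑' n : d → ℤ, f (fun i => (n i : ℝ)) = ∑' m : d → ℤ,
      ∫ x : d → ℝ, Complex.exp (-(2 * Real.pi * Complex.I * ∑ i, (m i : ℂ) * x i)) * f x := by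
  -- The periodization of `f`. The domination on bounded sets makes it continuous, and its Fourier
  -- coefficients on the torus are the values of the Fourier transform of `f`.
  set F' : (d → ℝ) → ℂ := fun x => ∑' n : d → ℤ, f (fun i => x i + n i) with hF'
  have hshift : ∀ n : d → ℤ, Continuous fun x : d → ℝ => f (fun i => x i + n i) := fun n =>
    hf.comp (by fun_prop)
  have hF'c : Continuous F' := by
    rw [continuous_iff_continuousAt]
    intro x
    obtain ⟨u, hu, hbd⟩ := hb (‖x‖ + 1)
    have : ContinuousOn F' (Metric.ball x 1) :=
      continuousOn_tsum (fun n => (hshift n).continuousOn) hu fun n y hy => hbd n y (by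
        rw [Metric.mem_ball, dist_eq_norm] at hy
        have := norm_sub_norm_le y x
        linarith)
    exact this.continuousAt (Metric.ball_mem_nhds x one_pos)
  have hper : ∀ (x : d → ℝ) (k : d → ℤ), F' (fun i => x i + k i) = F' x := by
    intro x k
    simp only [hF']
    rw [← (Equiv.addLeft k).tsum_eq fun n : d → ℤ => f (fun i => x i + n i)]
    refine tsum_congr fun n => ?_
    congr 1
    funext i
    simp [add_assoc]
  -- The descent of the periodization to the torus; periodicity makes the chosen representatives
  -- irrelevant.
  let G : UnitAddTorus d → ℂ := fun t => F' fun i => Quotient.out (t i)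
  have hG : ∀ x : d → ℝ, G (fun i => (x i : UnitAddCircle)) = F' x := by
    intro x
    have h1 : ∀ i, ∃ k : ℤ, Quotient.out ((x i : UnitAddCircle)) = x i + k := by
      intro i
      have h2 : ((Quotient.out ((x i : UnitAddCircle)) : ℝ) : UnitAddCircle) = (x i : UnitAddCircle) :=
        Quotient.out_eq _
      obtain ⟨k, hk⟩ := AddSubgroup.mem_zmultiples_iff.1 (QuotientAddGroup.eq.1 h2.symm)
      refine ⟨k, ?_⟩
      rw [zsmul_eq_mul, mul_one] at hk
      rw [hk]
      ring
    choose k hk using h1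
    simp only [G, hk]
    exact hper x k
  have hGc : Continuous G := by
    rw [unitAddTorus_isOpenQuotientMap.isQuotientMap.continuous_iff]
    convert! hF'c using 1
    funext x
    exact hG x
  have hexp : ∀ (m : d → ℤ) (x : d → ℝ), UnitAddTorus.mFourier m (fun i => (x i : UnitAddCircle)) =
      Complex.exp (2 * Real.pi * Complex.I * ∑ i, (m i : ℂ) * x i) := by
    intro m x
    simp only [UnitAddTorus.mFourier, ContinuousMap.coe_mk, fourier_coe_apply]
    rw [← Complex.exp_sum, Finset.mul_sum]
    congr 1
    refine Finset.sum_congr rfl fun i _ => ?_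
    push_cast
    ring
  have hcoeff : ∀ m : d → ℤ, UnitAddTorus.mFourierCoeff G m =
      ∫ x : d → ℝ, Complex.exp (-(2 * Real.pi * Complex.I * ∑ i, (m i : ℂ) * x i)) * f x := by
    intro m
    set E : (d → ℝ) → ℂ := fun x => Complex.exp (-(2 * Real.pi * Complex.I * ∑ i, (m i : ℂ) * x i))
      with hE
    have hEn : ∀ x, ‖E x‖ = 1 := by
      intro x
      have : -(2 * Real.pi * Complex.I * ∑ i, (m i : ℂ) * x i) =
          ((-(2 * Real.pi * ∑ i, (m i : ℝ) * x i) : ℝ) : ℂ) * Complex.I := by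
        push_cast; ring
      rw [hE]
      simp only [this, Complex.norm_exp_ofReal_mul_I]
    have hEc : Continuous E := by fun_prop
    have hEper : ∀ (x : d → ℝ) (n : d → ℤ), E (fun i => x i + n i) = E x := by
      intro x n
      simp only [hE]
      rw [Complex.exp_eq_exp_iff_exists_int]
      refine ⟨-∑ i, m i * n i, ?_⟩
      push_cast
      simp only [mul_add, Finset.sum_add_distrib]
      ring
    have hEf : Integrable fun x => E x * f x :=
      hint.bdd_mul hEc.aestronglyMeasurable (Eventually.of_forall fun x => (hEn x).le)
    rw [UnitAddTorus.mFourierCoeff_eq_integral G m fun _ => 0]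
    rw [← (hasSum_setIntegral_box hEf).tsum_eq]
    obtain ⟨u, hu, hbd⟩ := hb 1
    have hle : ∀ x ∈ {x : d → ℝ | ∀ i, x i ∈ Set.Ioc (0 : ℝ) (0 + 1)}, ‖x‖ ≤ 1 := by
      intro x hx
      refine (pi_norm_le_iff_of_nonneg zero_le_one).2 fun i => ?_
      obtain ⟨h1, h2⟩ := hx i
      rw [Real.norm_eq_abs, abs_of_pos h1]
      linarith
    have hvol : volume {x : d → ℝ | ∀ i, x i ∈ Set.Ioc (0 : ℝ) (0 + 1)} = 1 := by
      have : {x : d → ℝ | ∀ i, x i ∈ Set.Ioc (0 : ℝ) (0 + 1)} =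
        Set.univ.pi fun i => Set.Ioc (0 : ℝ) (0 + 1) := by ext; simp
      rw [this, Real.volume_pi_Ioc]
      simp
    have hbn : ∀ (n : d → ℤ), ∀ x ∈ {x : d → ℝ | ∀ i, x i ∈ Set.Ioc (0 : ℝ) (0 + 1)},
        ‖E (fun i => x i + n i) * f (fun i => x i + n i)‖ ≤ u n := by
      intro n x hx
      rw [norm_mul, hEn, one_mul]
      exact hbd n x (hle x hx)
    have hIn : ∀ n : d → ℤ, IntegrableOn (fun x : d → ℝ =>
        E (fun i => x i + n i) * f (fun i => x i + n i))
        {x : d → ℝ | ∀ i, x i ∈ Set.Ioc (0 : ℝ) (0 + 1)} := by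
      intro n
      have hm := measurableSet_box (d := d) fun _ => 0
      refine Measure.integrableOn_of_bounded (M := u n) (by rw [hvol]; simp) ?_ ?_
      · exact ((hEc.comp (by fun_prop)).mul (hshift n)).aestronglyMeasurable
      · filter_upwards [ae_restrict_mem hm] with x hx using hbn n x hx
    rw [integral_tsum_of_summable_integral_norm hIn]
    · refine setIntegral_congr_fun (measurableSet_box fun _ => 0) fun x hx => ?_
      simp only [hG, smul_eq_mul]
      rw [hexp, hF', ← tsum_mul_left]
      refine tsum_congr fun n => ?_
      rw [hEper]
      congr 2
      simp
    · refine Summable.of_nonneg_of_le (fun n => integral_nonneg fun x => norm_nonneg _) (fun n => ?_) hu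
      refine (setIntegral_mono_on (hIn n).norm (integrableOn_const (by rw [hvol]; simp))
        (measurableSet_box fun _ => 0) (hbn n)).trans ?_
      rw [setIntegral_const, Measure.real, hvol]
      simp
  -- Summability of the coefficients makes the Fourier series converge pointwise; the formula is its
  -- value at `0`.
  have h1 := UnitAddTorus.hasSum_mFourier_series_apply_of_summable (f := ⟨G, hGc⟩)
    (by simpa only [ContinuousMap.coe_mk, funext hcoeff] using hsum) (fun i => ((0 : ℝ) : UnitAddCircle))
  have h2 := h1.tsum_eq
  simp only [ContinuousMap.coe_mk, hexp, hcoeff] at h2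
  rw [hG fun _ => 0] at h2
  simp only [hF', zero_add, Complex.ofReal_zero, mul_zero, Finset.sum_const_zero,
    Complex.exp_zero, smul_eq_mul, mul_one] at h2
  exact h2.symm

end Poisson
end RegTheta

namespace RegTheta

/-! ### Constant terms and uniqueness of the meromorphic continuation. -/

section ConstTerm

lemma tendsto_norm_inv_sub_atTop (s₀ : ℂ) :
    Tendsto (fun s : ℂ => ‖(s - s₀)⁻¹‖) (𝓝[≠] s₀) atTop := by
  have h : Tendsto (fun s : ℂ => s - s₀) (𝓝[≠] s₀) (𝓝[≠] 0) := by
    refine tendsto_nhdsWithin_iff.2 ⟨?_, ?_⟩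
    · have : Tendsto (fun s : ℂ => s - s₀) (𝓝 s₀) (𝓝 (s₀ - s₀)) := by
        exact (continuous_id.sub continuous_const).tendsto s₀
      rw [sub_self] at this
      exact this.mono_left nhdsWithin_le_nhds
    · filter_upwards [self_mem_nhdsWithin] with s hs using sub_ne_zero.2 hs
  exact tendsto_norm_cobounded_atTop.comp (tendsto_inv₀_nhdsNE_zero.comp h)

/-- The difference of two candidate principal parts is a polynomial in `1 / (s - s₀)` with a finite
limit at `s₀`. A nonconstant polynomial would tend to infinity there. -/
lemma IsConstTerm.unique {G : ℂ → ℂ} {s₀ c c' : ℂ} (h : IsConstTerm G s₀ c)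
    (h' : IsConstTerm G s₀ c') : c = c' := by
  obtain ⟨P, hP, hl⟩ := h
  obtain ⟨P', hP', hl'⟩ := h'
  have hd : Tendsto (fun s => (P' - P).eval (s - s₀)⁻¹) (𝓝[≠] s₀) (𝓝 (c - c')) := by
    refine (hl.sub hl').congr fun s => ?_
    rw [Polynomial.eval_sub]
    ring
  by_cases hdeg : 0 < (P' - P).degree
  · exact absurd hd.norm (not_tendsto_nhds_of_tendsto_atTop
      (Polynomial.tendsto_norm_atTop _ hdeg (tendsto_norm_inv_sub_atTop s₀)) _)
  · rw [Polynomial.eq_C_of_degree_le_zero (not_lt.1 hdeg), Polynomial.coeff_sub, hP, hP'] at hd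
    simp only [sub_zero, map_zero, Polynomial.eval_zero] at hd
    exact (sub_eq_zero.1 (tendsto_nhds_unique hd tendsto_const_nhds))

lemma IsConstTerm.constTerm_eq {G : ℂ → ℂ} {s₀ c : ℂ} (h : IsConstTerm G s₀ c) :
    constTerm G s₀ = c :=
  (Classical.epsilon_spec (p := IsConstTerm G s₀) ⟨c, h⟩).unique h

lemma IsConstTerm.add {G G' : ℂ → ℂ} {s₀ c c' : ℂ} (h : IsConstTerm G s₀ c)
    (h' : IsConstTerm G' s₀ c') : IsConstTerm (fun s => G s + G' s) s₀ (c + c') := by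
  obtain ⟨P, hP, hl⟩ := h
  obtain ⟨P', hP', hl'⟩ := h'
  refine ⟨P + P', by simp [hP, hP'], (hl.add hl').congr fun s => ?_⟩
  rw [Polynomial.eval_add]
  ring

lemma IsConstTerm.congr {G G' : ℂ → ℂ} {s₀ c : ℂ} (h : IsConstTerm G s₀ c)
    (hG : G =ᶠ[𝓝[≠] s₀] G') : IsConstTerm G' s₀ c := by
  obtain ⟨P, hP, hl⟩ := h
  refine ⟨P, hP, hl.congr' ?_⟩
  filter_upwards [hG] with s hs
  rw [hs]

lemma isConstTerm_of_continuousAt {G : ℂ → ℂ} {s₀ : ℂ} (h : ContinuousAt G s₀) :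
    IsConstTerm G s₀ (G s₀) :=
  ⟨0, by simp, by simpa using h.tendsto.mono_left nhdsWithin_le_nhds⟩

/-- The constant term of `a / (s - s₁)` is given by its value, with the convention `a / 0 = 0`. -/
lemma isConstTerm_div_sub (a s₁ s₀ : ℂ) :
    IsConstTerm (fun s => a / (s - s₁)) s₀ (a / (s₀ - s₁)) := by
  by_cases h : s₀ = s₁
  · subst h
    refine ⟨Polynomial.C a * Polynomial.X, by simp, ?_⟩
    simp [div_eq_mul_inv]
  · exact isConstTerm_of_continuousAt (G := fun s => a / (s - s₁)) (by
      have : s₀ - s₁ ≠ 0 := sub_ne_zero.2 h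
      fun_prop (disch := assumption))

/-- A function with at most simple poles at `s'` and `1 - s'`. -/
def polar (s' : ℂ) (H : ℂ → ℂ) (a b s : ℂ) : ℂ := H s + a / (s - s') + b / (s + s' - 1)

lemma polar_eq (s' : ℂ) (H : ℂ → ℂ) (a b : ℂ) :
    polar s' H a b = fun s => H s + a / (s - s') + b / (s - (1 - s')) := by
  funext s
  rw [polar, show s + s' - 1 = s - (1 - s') by ring]

/-- Taking the constant term at a pole discards the polar term, and so does the convention `a / 0 =
0`. Thus the value of `polar` is its constant term at every point, poles included. -/
lemma isConstTerm_polar {H : ℂ → ℂ} (hH : Differentiable ℂ H) (s' a b s₀ : ℂ) :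
    IsConstTerm (polar s' H a b) s₀ (polar s' H a b s₀) := by
  rw [polar_eq]
  exact ((isConstTerm_of_continuousAt hH.continuous.continuousAt).add
    (isConstTerm_div_sub a s' s₀)).add (isConstTerm_div_sub b (1 - s') s₀)

lemma analyticAt_polar {H : ℂ → ℂ} (hH : Differentiable ℂ H) {s' : ℂ} (a b : ℂ) {s : ℂ}
    (h1 : s ≠ s') (h2 : s ≠ 1 - s') : AnalyticAt ℂ (polar s' H a b) s := by
  rw [polar_eq]
  exact ((hH.analyticAt s).add (analyticAt_const.div (analyticAt_id.sub analyticAt_const)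
    (sub_ne_zero.2 h1))).add (analyticAt_const.div (analyticAt_id.sub analyticAt_const)
    (sub_ne_zero.2 h2))

lemma meromorphicOn_polar {H : ℂ → ℂ} (hH : Differentiable ℂ H) (s' a b : ℂ) :
    MeromorphicOn (polar s' H a b) Set.univ := by
  intro s _
  rw [polar_eq]
  exact ((hH.analyticAt s).meromorphicAt.add ((MeromorphicAt.const a s).div
    ((MeromorphicAt.id s).sub (MeromorphicAt.const s' s)))).add ((MeromorphicAt.const b s).div
    ((MeromorphicAt.id s).sub (MeromorphicAt.const (1 - s') s)))

/-- Only an inequality, because `a` may be zero and then the order is infinite. -/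
lemma neg_one_le_meromorphicOrderAt_div_sub (a s₁ s₀ : ℂ) :
    (-1 : ℤ) ≤ meromorphicOrderAt (fun s => a / (s - s₁)) s₀ := by
  have ha : AnalyticAt ℂ (fun _ : ℂ => a) s₀ := analyticAt_const
  by_cases h : s₀ = s₁
  · subst h
    have hm : MeromorphicAt (fun s : ℂ => s - s₀) s₀ :=
      (MeromorphicAt.id s₀).sub (MeromorphicAt.const s₀ s₀)
    have h1 : meromorphicOrderAt (fun s : ℂ => s - s₀) s₀ = (1 : ℤ) := by
      rw [meromorphicOrderAt_eq_int_iff hm]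
      exact ⟨fun _ => 1, analyticAt_const, one_ne_zero, by simp⟩
    have h2 : (fun s => a / (s - s₀)) = (fun _ : ℂ => a) * (fun s : ℂ => s - s₀)⁻¹ := by
      funext s; simp [div_eq_mul_inv]
    rw [h2, meromorphicOrderAt_mul ha.meromorphicAt hm.inv, meromorphicOrderAt_inv, h1]
    have := ha.meromorphicOrderAt_nonneg
    calc ((-1 : ℤ) : WithTop ℤ) = 0 + -(1 : ℤ) := by rfl
      _ ≤ _ := by gcongr
  · have h0 : (0 : WithTop ℤ) ≤ meromorphicOrderAt (fun s => a / (s - s₁)) s₀ :=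
      (ha.div (analyticAt_id.sub analyticAt_const)
        (sub_ne_zero.2 h)).meromorphicOrderAt_nonneg
    exact le_trans (by exact_mod_cast (by norm_num : (-1 : ℤ) ≤ 0)) h0

lemma neg_one_le_meromorphicOrderAt_polar {H : ℂ → ℂ} (hH : Differentiable ℂ H) (s' a b s₀ : ℂ) :
    (-1 : ℤ) ≤ meromorphicOrderAt (polar s' H a b) s₀ := by
  have m1 : MeromorphicAt (fun s => a / (s - s')) s₀ := (MeromorphicAt.const a s₀).div
    ((MeromorphicAt.id s₀).sub (MeromorphicAt.const s' s₀))
  have m2 : MeromorphicAt (fun s => b / (s - (1 - s'))) s₀ := (MeromorphicAt.const b s₀).div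
    ((MeromorphicAt.id s₀).sub (MeromorphicAt.const (1 - s') s₀))
  have m0 := (hH.analyticAt s₀).meromorphicAt
  have h0 := (hH.analyticAt s₀).meromorphicOrderAt_nonneg
  rw [polar_eq]
  refine le_trans (le_min (le_trans (le_min (le_trans ?_ h0)
    (neg_one_le_meromorphicOrderAt_div_sub a s' s₀)) (meromorphicOrderAt_add m0 m1))
    (neg_one_le_meromorphicOrderAt_div_sub b (1 - s') s₀)) (meromorphicOrderAt_add (m0.add m1) m2)
  exact_mod_cast (by norm_num : (-1 : ℤ) ≤ 0)

/-- If `F` agrees with `polar` on a right half plane, its meromorphic continuation is `polar`. -/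
theorem meroCont_spec {F H : ℂ → ℂ} (hH : Differentiable ℂ H) {s' a b : ℂ}
    (hF : ∀ s : ℂ, max s'.re (1 - s'.re) < s.re → F s = polar s' H a b s) :
    MeromorphicNFOn (meroCont F) Set.univ ∧
      ∀ s, meroCont F =ᶠ[𝓝[≠] s] polar s' H a b := by
  set G₀ := polar s' H a b with hG₀
  have hG₀m : MeromorphicOn G₀ Set.univ := meromorphicOn_polar hH s' a b
  -- Existence: the normal form of `polar`, which agrees with `polar` wherever the latter is
  -- analytic, in particular on the half plane.
  have hex : IsMeromorphicContinuation F (toMeromorphicNFOn G₀ Set.univ) := by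
    refine ⟨meromorphicNFOn_toMeromorphicNFOn _ _, max s'.re (1 - s'.re), fun s hs => ?_⟩
    have h1 : s ≠ s' := by
      rintro rfl
      exact absurd hs (not_lt.2 (le_max_left _ _))
    have h2 : s ≠ 1 - s' := by
      rintro rfl
      simp at hs
    have h3 := (meromorphicNFOn_toMeromorphicNFOn G₀ Set.univ
      (Set.mem_univ s)).eventuallyEq_nhdsNE_iff_eventuallyEq_nhds
      (analyticAt_polar hH a b h1 h2).meromorphicNFAt
    rw [(h3.1 (hG₀m.toMeromorphicNFOn_eq_self_on_nhdsNE (Set.mem_univ s))).eq_of_nhds, hF s hs]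
  have hsp : IsMeromorphicContinuation F (meroCont F) := Classical.epsilon_spec ⟨_, hex⟩
  obtain ⟨hNF, β, hβ⟩ := hsp
  refine ⟨hNF, ?_⟩
  set D : ℂ → ℂ := meroCont F - G₀ with hD
  have hDm : MeromorphicOn D Set.univ := hNF.meromorphicOn.sub hG₀m
  set x₀ : ℂ := ((max β (max s'.re (1 - s'.re)) + 1 : ℝ) : ℂ) with hx₀
  have htop : meromorphicOrderAt D x₀ = ⊤ := by
    rw [meromorphicOrderAt_eq_top_iff]
    have hopen : IsOpen {s : ℂ | max β (max s'.re (1 - s'.re)) < s.re} :=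
      isOpen_lt continuous_const Complex.continuous_re
    have hmem : x₀ ∈ {s : ℂ | max β (max s'.re (1 - s'.re)) < s.re} := by
      rw [Set.mem_ofPred_eq, hx₀, Complex.ofReal_re]
      linarith
    filter_upwards [mem_nhdsWithin_of_mem_nhds (hopen.mem_nhds hmem)] with s hs
    have h1 := hβ s (lt_of_le_of_lt (le_max_left _ _) hs)
    have h2 := hF s (lt_of_le_of_lt (le_max_right _ _) hs)
    rw [hD, Pi.sub_apply, h1, h2, sub_self]
  intro s
  -- Identity theorem: the difference vanishes near `x₀`, a real point in both half planes, and
  -- infinite order propagates over the connected plane.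
  have hs : meromorphicOrderAt D s = ⊤ := by
    by_contra hne
    exact hDm.meromorphicOrderAt_ne_top_of_isPreconnected isPreconnected_univ
      (Set.mem_univ s) (Set.mem_univ x₀) hne htop
  rw [meromorphicOrderAt_eq_top_iff] at hs
  filter_upwards [hs] with w hw
  exact sub_eq_zero.1 hw

/-- Two functions in meromorphic normal form that agree on a punctured neighbourhood agree at the
centre; analytic functions are in normal form. -/
lemma eventuallyEq_of_nhdsNE_of_polar {G H : ℂ → ℂ} (hH : Differentiable ℂ H) {s' a b : ℂ}
    (hG : MeromorphicNFOn G Set.univ) {s : ℂ} (h : G =ᶠ[𝓝[≠] s] polar s' H a b)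
    (h1 : s ≠ s') (h2 : s ≠ 1 - s') : G =ᶠ[𝓝 s] polar s' H a b :=
  ((hG (Set.mem_univ s)).eventuallyEq_nhdsNE_iff_eventuallyEq_nhds
    (analyticAt_polar hH a b h1 h2).meromorphicNFAt).1 h

end ConstTerm

/-! ### The Euler equation for constant terms. -/

section EulerEquation

/-- The solutions of the Euler equation `y² a'' + p (1 - p) a = 0` on `(0, ∞)`. -/
theorem euler_equation_solution {p : ℂ} (hp : p ≠ 1 / 2) {a a₁ a₂ : ℝ → ℂ}
    (h1 : ∀ y, 0 < y → HasDerivAt a (a₁ y) y) (h2 : ∀ y, 0 < y → HasDerivAt a₁ (a₂ y) y)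
    (heq : ∀ y : ℝ, 0 < y → (y : ℂ) ^ 2 * a₂ y + p * (1 - p) * a y = 0) :
    ∃ A B : ℂ, ∀ y : ℝ, 0 < y → a y = A * (y : ℂ) ^ p + B * (y : ℂ) ^ (1 - p) := by
  -- The second order operator factors: `(y a' - (1 - r) a) y^{-r}` has derivative `y^{-r-1}` times
  -- the equation, so it is constant. This is used for `r = p` and `r = 1 - p`.
  have key : ∀ r : ℂ, (∀ y : ℝ, 0 < y → (y : ℂ) ^ 2 * a₂ y + r * (1 - r) * a y = 0) →
      ∃ C : ℂ, ∀ y : ℝ, 0 < y → y * a₁ y - (1 - r) * a y = C * (y : ℂ) ^ r := by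
    intro r hr
    set w : ℝ → ℂ := fun y => (y * a₁ y - (1 - r) * a y) * (y : ℂ) ^ (-r) with hw
    have hder : ∀ y : ℝ, 0 < y → HasDerivAt w 0 y := by
      intro y hy
      have hy0 : (y : ℂ) ≠ 0 := by exact_mod_cast hy.ne'
      have hc : HasDerivAt (fun y : ℝ => (y : ℂ)) 1 y := Complex.ofRealCLM.hasDerivAt
      have hpow : HasDerivAt (fun y : ℝ => (y : ℂ) ^ (-r)) (-r * (y : ℂ) ^ (-r - 1)) y := by
        have := (hasDerivAt_id (y : ℂ)).cpow_const (c := -r)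
          (Or.inl (by simpa using hy))
        simpa using this.comp_ofReal
      have hmain := (((hc.mul (h2 y hy)).sub ((h1 y hy).const_mul (1 - r))).mul hpow)
      convert! hmain using 1
      have h3 : (y : ℂ) ^ (-r) = (y : ℂ) ^ (-r - 1) * y := by
        rw [Complex.cpow_sub _ _ hy0, Complex.cpow_one, div_mul_cancel₀ _ hy0]
      simp only [Pi.sub_apply, Pi.mul_apply]
      rw [h3]
      linear_combination (-(y : ℂ) ^ (-r - 1)) * hr y hy
    refine ⟨w 1, fun y hy => ?_⟩
    have hconst : w y = w 1 := by
      have hconv : IsPreconnected (Set.Ioi (0 : ℝ)) := isPreconnected_Ioi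
      refine IsOpen.is_const_of_deriv_eq_zero isOpen_Ioi hconv
        (fun z hz => (hder z hz).differentiableAt.differentiableWithinAt)
        (fun z hz => (hder z hz).deriv) hy (Set.mem_Ioi.2 one_pos)
    have hy0 : (y : ℂ) ≠ 0 := by exact_mod_cast hy.ne'
    rw [← hconst, hw]
    simp only
    rw [mul_assoc, ← Complex.cpow_add _ _ hy0, neg_add_cancel, Complex.cpow_zero, mul_one]
  obtain ⟨C, hC⟩ := key p heq
  obtain ⟨D, hD⟩ := key (1 - p) fun y hy => by
    linear_combination heq y hy
  -- Subtracting the two first order relations eliminates `a'` and leaves `(2 p - 1) a`; at `p =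
  -- 1/2` the relations coincide.
  have hne : 2 * p - 1 ≠ 0 := by
    intro h
    exact hp (by linear_combination h / 2)
  refine ⟨C / (2 * p - 1), -D / (2 * p - 1), fun y hy => ?_⟩
  have e1 := hC y hy
  have e2 := hD y hy
  field_simp
  linear_combination e1 - e2

end EulerEquation
end RegTheta

namespace RegTheta

/-! ### Invariance of the hyperbolic Laplacian. -/

section LaplacianInvariance

lemma laplacian_eq_fderiv_fderiv {f : ℂ → ℂ} {z : ℂ} :
    Laplacian.laplacian f z =
      fderiv ℝ (fderiv ℝ f) z 1 1 + fderiv ℝ (fderiv ℝ f) z Complex.I Complex.I := by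
  rw [InnerProductSpace.laplacian_eq_iteratedFDeriv_complexPlane]
  simp [iteratedFDeriv_two_apply]

/-- The behaviour of the Laplacian under a holomorphic change of coordinates. -/
theorem laplacian_comp_analyticAt {F m : ℂ → ℂ} {z : ℂ} (hF : ContDiffAt ℝ 2 F (m z))
    (hm : AnalyticAt ℂ m z) :
    Laplacian.laplacian (F ∘ m) z = (‖deriv m z‖ ^ 2 : ℝ) * Laplacian.laplacian F (m z) := by
  have hder : ∀ᶠ w in 𝓝 z, HasDerivAt m (deriv m w) w := by
    filter_upwards [hm.eventually_analyticAt] with w hw using hw.differentiableAt.hasDerivAt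
  have hFn : ∀ᶠ w in 𝓝 z, DifferentiableAt ℝ F (m w) := by
    have : ∀ᶠ w in 𝓝 (m z), ContDiffAt ℝ 2 F w := hF.eventually (by simp)
    filter_upwards [hm.continuousAt.eventually this] with w hw using hw.differentiableAt (by simp)
  have hfd : ∀ v : ℂ, (fun w => fderiv ℝ (F ∘ m) w v) =ᶠ[𝓝 z]
      fun w => fderiv ℝ F (m w) (deriv m w * v) := by
    intro v
    filter_upwards [hder, hFn] with w h1 h2
    have h3 : HasFDerivAt m (((ContinuousLinearMap.toSpanSingleton ℂ (deriv m w)).restrictScalars ℝ)) w :=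
      h1.hasFDerivAt.restrictScalars ℝ
    have h4 := (h2.hasFDerivAt.comp w h3).fderiv
    rw [h4]
    simp [mul_comm]
  have hd2 : HasDerivAt (deriv m) (deriv (deriv m) z) z := hm.deriv.differentiableAt.hasDerivAt
  have hDF : DifferentiableAt ℝ (fderiv ℝ F) (m z) :=
    (hF.fderiv_right (m := 1) (by norm_num)).differentiableAt (by simp)
  have hmR : HasFDerivAt m (((ContinuousLinearMap.toSpanSingleton ℂ (deriv m z)).restrictScalars ℝ)) z :=
    hder.self_of_nhds.hasFDerivAt.restrictScalars ℝ
  have hdR : HasFDerivAt (deriv m)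
      (((ContinuousLinearMap.toSpanSingleton ℂ (deriv (deriv m) z)).restrictScalars ℝ)) z :=
    hd2.hasFDerivAt.restrictScalars ℝ
  have hcomp : ContDiffAt ℝ 2 (F ∘ m) z :=
    hF.comp z ((hm.contDiffAt (n := 2)).restrict_scalars ℝ)
  have hDFm : DifferentiableAt ℝ (fderiv ℝ (F ∘ m)) z :=
    (hcomp.fderiv_right (m := 1) (by norm_num)).differentiableAt (by simp)
  have hsecond : ∀ v : ℂ, fderiv ℝ (fderiv ℝ (F ∘ m)) z v v =
      fderiv ℝ (fderiv ℝ F) (m z) (deriv m z * v) (deriv m z * v) +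
        fderiv ℝ F (m z) (deriv (deriv m) z * v * v) := by
    intro v
    have e1 : fderiv ℝ (fun w => fderiv ℝ (F ∘ m) w v) z v = fderiv ℝ (fderiv ℝ (F ∘ m)) z v v := by
      rw [fderiv_clm_apply hDFm (differentiableAt_const v)]
      simp
    rw [← e1, (hfd v).fderiv_eq]
    have e2 := ((hDF.hasFDerivAt.comp z hmR).clm_apply (hdR.mul_const' v)).fderiv
    simp only [Function.comp_def] at e2
    rw [e2]
    simp [mul_comm]
    ring
  set B := fderiv ℝ (fderiv ℝ F) (m z) with hB
  -- Multiplication by `i` swaps real and imaginary parts up to a sign, so the mixed terms cancel.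
  have hbil : ∀ w : ℂ, B w w + B (w * Complex.I) (w * Complex.I) =
      (‖w‖ ^ 2 : ℝ) * (B 1 1 + B Complex.I Complex.I) := by
    intro w
    have h1 : w = w.re • (1 : ℂ) + w.im • Complex.I := by
      simp [Complex.re_add_im]
    have h2 : w * Complex.I = (-w.im) • (1 : ℂ) + w.re • Complex.I := by
      apply Complex.ext <;> simp
    have h3 : B w w = B (w.re • (1 : ℂ) + w.im • Complex.I) (w.re • (1 : ℂ) + w.im • Complex.I) := by
      rw [← h1]
    rw [h2, h3]
    simp only [map_add, map_smul, _root_.add_apply, _root_.smul_apply]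
    rw [← Complex.normSq_eq_norm_sq, Complex.normSq_apply]
    simp only [Complex.real_smul]
    push_cast
    ring
  rw [laplacian_eq_fderiv_fderiv, laplacian_eq_fderiv_fderiv, hsecond, hsecond, ← hbil]
  -- The second derivative of `m` enters through `m'' v²`, and these terms cancel for `v = 1` and `v
  -- = i`.
  have hI : deriv (deriv m) z * Complex.I * Complex.I = -(deriv (deriv m) z * 1 * 1) := by
    linear_combination deriv (deriv m) z * Complex.I_mul_I
  rw [hI, map_neg, mul_one]
  ring

lemma ofComplex_coe_add_natCast (z : ℍ) (k : ℕ) :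
    ofComplex ((z : ℂ) + k) = ModularGroup.T ^ k • z := by
  apply UpperHalfPlane.ext
  have h := UpperHalfPlane.modular_T_zpow_smul z (k : ℤ)
  rw [zpow_natCast] at h
  rw [h, ofComplex_apply_of_im_pos (by simpa using z.im_pos)]
  simp [add_comm]

lemma coe_smul_ofComplex (g : SL(2, ℤ)) {w : ℂ} (hw : 0 < w.im) :
    ((g • ofComplex w : ℍ) : ℂ) =
      ((g.1 0 0 : ℂ) * w + g.1 0 1) / ((g.1 1 0 : ℂ) * w + g.1 1 1) := by
  have h := coe_smul_mul_jfac g (ofComplex w)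
  rw [ofComplex_apply_of_im_pos hw] at h ⊢
  have h2 := jfac_ne_zero g (⟨w, hw⟩ : ℍ)
  rw [eq_div_iff (by simpa [jfac] using h2)]
  simpa [jfac] using h

lemma im_smul_SL (g : SL(2, ℤ)) (z : ℍ) : (g • z).im = z.im / ‖jfac g z‖ ^ 2 := by
  rw [← Complex.normSq_eq_norm_sq]
  have h := UpperHalfPlane.im_smul_eq_div_normSq ((g : SL(2, ℤ)) : GL (Fin 2) ℝ) z
  simpa [jfac, UpperHalfPlane.denom] using h

/-- The Laplace equation of weight `0` is invariant under `SL₂(ℤ)`. -/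
theorem laplacian_smul_SL {f : ℍ → ℂ} {lam : ℂ} (hs : SmoothOnH f)
    (he : ∀ z : ℍ, -((z.im : ℂ) ^ 2) *
      Laplacian.laplacian (fun w : ℂ => f (ofComplex w)) (z : ℂ) = lam * f z)
    (g : SL(2, ℤ)) :
    SmoothOnH (fun z => f (g • z)) ∧ ∀ z : ℍ, -((z.im : ℂ) ^ 2) *
      Laplacian.laplacian (fun w : ℂ => f (g • ofComplex w)) (z : ℂ) = lam * f (g • z) := by
  set m : ℂ → ℂ := fun w => ((g.1 0 0 : ℂ) * w + g.1 0 1) / ((g.1 1 0 : ℂ) * w + g.1 1 1) with hm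
  set F : ℂ → ℂ := fun w => f (ofComplex w) with hF
  have hopen : IsOpen {w : ℂ | 0 < w.im} := isOpen_lt continuous_const Complex.continuous_im
  have hcoe : ∀ w : ℂ, 0 < w.im → m w = ((g • ofComplex w : ℍ) : ℂ) := fun w hw =>
    (coe_smul_ofComplex g hw).symm
  have hpos : ∀ w : ℂ, 0 < w.im → 0 < (m w).im := fun w hw => by
    rw [hcoe w hw]; exact (g • ofComplex w).im_pos
  have hden : ∀ w : ℂ, 0 < w.im → (g.1 1 0 : ℂ) * w + g.1 1 1 ≠ 0 := fun w hw => by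
    simpa [jfac] using jfac_ne_zero g (⟨w, hw⟩ : ℍ)
  have heq : ∀ w : ℂ, 0 < w.im → f (g • ofComplex w) = (F ∘ m) w := fun w hw => by
    simp only [hF, Function.comp_apply]
    rw [hcoe w hw, ofComplex_apply]
  have hman : ∀ w : ℂ, 0 < w.im → AnalyticAt ℂ m w := fun w hw => by
    have := hden w hw
    fun_prop (disch := assumption)
  have hFc : ∀ w : ℂ, 0 < w.im → ContDiffAt ℝ ∞ F w := fun w hw =>
    (hs w hw).contDiffAt (hopen.mem_nhds hw)
  refine ⟨?_, fun z => ?_⟩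
  · refine ContDiffOn.congr (f := F ∘ m) (fun w hw => ?_) heq
    exact ((hFc (m w) (hpos w hw)).comp w (((hman w hw).contDiffAt (n := ∞)).restrict_scalars
      ℝ)).contDiffWithinAt
  · have hz := z.im_pos
    have h1 : (fun w : ℂ => f (g • ofComplex w)) =ᶠ[𝓝 (z : ℂ)] F ∘ m := by
      filter_upwards [hopen.mem_nhds hz] with w hw using heq w hw
    rw [(InnerProductSpace.laplacian_congr_nhds h1).eq_of_nhds,
      laplacian_comp_analyticAt ((hFc _ (hpos z hz)).of_le (WithTop.coe_le_coe.2 le_top)) (hman z hz)]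
    have h2 := he (g • z)
    have h3 : m z = ((g • z : ℍ) : ℂ) := by rw [hcoe _ hz, ofComplex_apply]
    have hd := hden z hz
    -- By determinant one the derivative of the Möbius map is `1 / j²`; its squared modulus `|j|⁻⁴`
    -- is the factor between the squares of the two imaginary parts.
    have h4 : deriv m z = 1 / (jfac g z) ^ 2 := by
      have hd1 : HasDerivAt (fun w : ℂ => (g.1 0 0 : ℂ) * w + g.1 0 1) (g.1 0 0 : ℂ) (z : ℂ) := by
        simpa using ((hasDerivAt_id (z : ℂ)).const_mul (g.1 0 0 : ℂ)).add_const (g.1 0 1 : ℂ)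
      have hd2 : HasDerivAt (fun w : ℂ => (g.1 1 0 : ℂ) * w + g.1 1 1) (g.1 1 0 : ℂ) (z : ℂ) := by
        simpa using ((hasDerivAt_id (z : ℂ)).const_mul (g.1 1 0 : ℂ)).add_const (g.1 1 1 : ℂ)
      have hdet : (g.1 0 0 : ℂ) * g.1 1 1 - g.1 0 1 * g.1 1 0 = 1 := by
        have := g.2
        rw [Matrix.det_fin_two] at this
        exact_mod_cast this
      refine (show deriv m z = _ from (hd1.div hd2 hd).deriv).trans ?_
      simp only [jfac]
      congr 1
      linear_combination hdet
    rw [h3, ← h2, h4, im_smul_SL]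
    have hj : (‖jfac g z‖ : ℂ) ≠ 0 := by
      exact_mod_cast (norm_pos_iff.2 (jfac_ne_zero g z)).ne'
    simp only [norm_div, norm_one, norm_pow]
    push_cast
    field_simp

end LaplacianInvariance
end RegTheta

namespace RegTheta

/-! ### Constant terms of weak Maass forms and cusp widths. -/

section FourierConst

lemma isOpen_im_pos : IsOpen {w : ℂ | 0 < w.im} :=
  isOpen_lt continuous_const Complex.continuous_im

/-- Differentiation under the integral: the vertical derivative is continuous, hence bounded on the
compact rectangle of heights between `y / 2` and `2 y`. -/
lemma hasDerivAt_horizontal_integral {φ : ℂ → ℂ} (hφ : ContDiffOn ℝ 1 φ {w : ℂ | 0 < w.im})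
    (b : ℝ) {y : ℝ} (hy : 0 < y) :
    HasDerivAt (fun y : ℝ => ∫ x in (0 : ℝ)..b, φ (x + y * Complex.I))
      (∫ x in (0 : ℝ)..b, fderiv ℝ φ (x + y * Complex.I) Complex.I) y := by
  have hfd : ContinuousOn (fun w => fderiv ℝ φ w Complex.I) {w : ℂ | 0 < w.im} :=
    (hφ.continuousOn_fderiv_of_isOpen isOpen_im_pos le_rfl).clm_apply continuousOn_const
  set K : Set ℂ := (fun p : ℝ × ℝ => (p.1 : ℂ) + p.2 * Complex.I) ''
    (Set.uIcc 0 b ×ˢ Set.Icc (y / 2) (2 * y)) with hK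
  have hKc : IsCompact K := (isCompact_uIcc.prod isCompact_Icc).image (by fun_prop)
  have hKsub : K ⊆ {w : ℂ | 0 < w.im} := by
    rintro _ ⟨p, hp, rfl⟩
    have := hp.2.1
    simp only [Set.mem_ofPred_eq, Complex.add_im, Complex.ofReal_im, Complex.mul_im,
      Complex.ofReal_re, Complex.I_im, Complex.I_re]
    linarith
  obtain ⟨C, hC⟩ := hKc.exists_bound_of_continuousOn (hfd.mono hKsub)
  have hline : ∀ y' : ℝ, 0 < y' → ∀ ψ : ℂ → ℂ, ContinuousOn ψ {w : ℂ | 0 < w.im} →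
      Continuous fun x : ℝ => ψ (x + y' * Complex.I) := fun y' hy' ψ hψ =>
    hψ.comp_continuous (by fun_prop) fun x => by simpa using hy'
  refine (intervalIntegral.hasDerivAt_integral_of_dominated_loc_of_deriv_le
    (𝕜 := ℝ)
    (F := fun y x : ℝ => φ (x + y * Complex.I))
    (F' := fun y x : ℝ => fderiv ℝ φ (x + y * Complex.I) Complex.I) (bound := fun _ => C)
    (s := Set.Ioo (y / 2) (2 * y)) (Ioo_mem_nhds (by linarith) (by linarith))
    ?_ ?_ ?_ ?_ ?_ ?_).2
  · filter_upwards [lt_mem_nhds hy] with y' hy'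
    exact (hline y' hy' φ hφ.continuousOn).aestronglyMeasurable
  · exact (hline y hy φ hφ.continuousOn).intervalIntegrable _ _
  · exact (hline y hy _ hfd).aestronglyMeasurable
  · refine Eventually.of_forall fun x hx y' hy' => hC _ ?_
    exact ⟨(x, y'), ⟨Set.uIoc_subset_uIcc hx, Set.Ioo_subset_Icc_self hy'⟩, rfl⟩
  · exact intervalIntegrable_const
  · refine Eventually.of_forall fun x hx y' hy' => ?_
    have hy0 : 0 < y' := by linarith [hy'.1]
    have hd : DifferentiableAt ℝ φ (x + y' * Complex.I) :=
      (hφ.contDiffAt (isOpen_im_pos.mem_nhds (by simpa using hy0))).differentiableAt (by simp)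
    have hl : HasDerivAt (fun y' : ℝ => (x : ℂ) + y' * Complex.I) Complex.I y' := by
      simpa using ((Complex.ofRealCLM.hasDerivAt (x := y')).mul_const Complex.I).const_add (x : ℂ)
    exact hd.hasFDerivAt.comp_hasDerivAt y' hl

lemma integral_fderiv_one_eq_zero_of_periodic {φ : ℂ → ℂ}
    (hφ : ContDiffOn ℝ 1 φ {w : ℂ | 0 < w.im}) {b : ℝ}
    (hper : ∀ w : ℂ, 0 < w.im → φ (w + b) = φ w) {y : ℝ} (hy : 0 < y) :
    ∫ x in (0 : ℝ)..b, fderiv ℝ φ (x + y * Complex.I) 1 = 0 := by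
  have hfd : ContinuousOn (fun w => fderiv ℝ φ w 1) {w : ℂ | 0 < w.im} :=
    (hφ.continuousOn_fderiv_of_isOpen isOpen_im_pos le_rfl).clm_apply continuousOn_const
  rw [intervalIntegral.integral_eq_sub_of_hasDerivAt (f := fun x : ℝ => φ (x + y * Complex.I))]
  · have := hper (y * Complex.I) (by simpa using hy)
    simp only [Complex.ofReal_zero, zero_add]
    rw [add_comm, this, sub_self]
  · intro x _
    have hd : DifferentiableAt ℝ φ (x + y * Complex.I) :=
      (hφ.contDiffAt (isOpen_im_pos.mem_nhds (by simpa using hy))).differentiableAt (by simp)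
    have hl : HasDerivAt (fun x : ℝ => (x : ℂ) + y * Complex.I) 1 x := by
      simpa using (Complex.ofRealCLM.hasDerivAt (x := x)).add_const (y * Complex.I)
    exact hd.hasFDerivAt.comp_hasDerivAt x hl
  · exact (hfd.comp_continuous (f := fun x : ℝ => (x : ℂ) + y * Complex.I) (by fun_prop)
      fun x => by simpa using hy).intervalIntegrable _ _

lemma fderiv_add_of_periodic {φ : ℂ → ℂ} {b : ℝ}
    (hper : ∀ w : ℂ, 0 < w.im → φ (w + b) = φ w) {w : ℂ} (hw : 0 < w.im) :
    fderiv ℝ φ (w + b) = fderiv ℝ φ w := by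
  rw [← fderiv_comp_add_right]
  refine Filter.EventuallyEq.fderiv_eq ?_
  filter_upwards [isOpen_im_pos.mem_nhds hw] with v hv using hper v hv

/-- The constant term of a periodic eigenfunction of the Laplacian of weight `0`. -/
theorem constTerm_of_eigenfunction {g : ℂ → ℂ} (hg : ContDiffOn ℝ ∞ g {w : ℂ | 0 < w.im})
    {b : ℝ} (hper : ∀ w : ℂ, 0 < w.im → g (w + b) = g w) {s' : ℂ} (hs' : s' ≠ 1 / 2)
    (heig : ∀ w : ℂ, 0 < w.im → -((w.im : ℂ) ^ 2) * Laplacian.laplacian g w =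
      s' * (1 - s') * g w) :
    ∃ A B : ℂ, ∀ y : ℝ, 0 < y → ∫ x in (0 : ℝ)..b, g (x + y * Complex.I) =
      A * (y : ℂ) ^ s' + B * (y : ℂ) ^ (1 - s') := by
  have hD : ContDiffOn ℝ ∞ (fderiv ℝ g) {w : ℂ | 0 < w.im} :=
    hg.fderiv_of_isOpen isOpen_im_pos (by simp)
  have hDv : ∀ v : ℂ, ContDiffOn ℝ 1 (fun w => fderiv ℝ g w v) {w : ℂ | 0 < w.im} := fun v =>
    (hD.clm_apply contDiffOn_const).of_le (WithTop.coe_le_coe.2 le_top)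
  have hg1 : ContDiffOn ℝ 1 g {w : ℂ | 0 < w.im} :=
    hg.of_le (WithTop.coe_le_coe.2 le_top)
  refine euler_equation_solution hs'
    (a₁ := fun y => ∫ x in (0 : ℝ)..b, fderiv ℝ g (x + y * Complex.I) Complex.I)
    (a₂ := fun y => ∫ x in (0 : ℝ)..b,
      fderiv ℝ (fun w => fderiv ℝ g w Complex.I) (x + y * Complex.I) Complex.I)
    (fun y hy => hasDerivAt_horizontal_integral hg1 b hy)
    (fun y hy => hasDerivAt_horizontal_integral (hDv Complex.I) b hy) fun y hy => ?_
  have hz := integral_fderiv_one_eq_zero_of_periodic (hDv 1)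
    (fun w hw => by rw [fderiv_add_of_periodic hper hw]) hy
  have hcont : ∀ v : ℂ, Continuous fun x : ℝ =>
      fderiv ℝ (fun w => fderiv ℝ g w v) (x + y * Complex.I) v := fun v =>
    (((hDv v).continuousOn_fderiv_of_isOpen isOpen_im_pos le_rfl).clm_apply
      continuousOn_const).comp_continuous (f := fun x : ℝ => (x : ℂ) + y * Complex.I)
      (by fun_prop) fun x => by simpa using hy
  -- The `∂_x²` part integrates to zero over a period, so the integrated Laplace equation becomes an
  -- ordinary equation in `y`.
  have hsum : (∫ x in (0 : ℝ)..b,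
      fderiv ℝ (fun w => fderiv ℝ g w Complex.I) (x + y * Complex.I) Complex.I) =
      ∫ x in (0 : ℝ)..b, Laplacian.laplacian g (x + y * Complex.I) := by
    rw [← zero_add (intervalIntegral _ _ _ _), ← hz, ← intervalIntegral.integral_add
      ((hcont 1).intervalIntegrable _ _) ((hcont Complex.I).intervalIntegrable _ _)]
    refine intervalIntegral.integral_congr fun x _ => ?_
    have hpt : (x : ℂ) + y * Complex.I ∈ {w : ℂ | 0 < w.im} := by simpa using hy
    have hdd : DifferentiableAt ℝ (fderiv ℝ g) (x + y * Complex.I) :=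
      (hD.contDiffAt (isOpen_im_pos.mem_nhds hpt)).differentiableAt (by simp)
    simp only [laplacian_eq_fderiv_fderiv]
    rw [fderiv_clm_apply hdd (differentiableAt_const _), fderiv_clm_apply hdd
      (differentiableAt_const _)]
    simp
  rw [hsum, ← intervalIntegral.integral_const_mul, ← intervalIntegral.integral_const_mul,
    ← intervalIntegral.integral_add]
  · refine (intervalIntegral.integral_congr (g := fun _ => (0 : ℂ)) fun x _ => ?_).trans (by simp)
    have hpt : 0 < ((x : ℂ) + y * Complex.I).im := by simpa using hy
    have := heig _ hpt
    simp only [Complex.add_im, Complex.ofReal_im, Complex.mul_im,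
      Complex.ofReal_re, Complex.I_im, Complex.I_re, mul_one, mul_zero, zero_add, add_zero] at this
    simp only
    linear_combination -this
  · refine ((((hcont 1).add (hcont Complex.I)).congr fun x => ?_).const_mul _).intervalIntegrable _ _
    have hpt : (x : ℂ) + y * Complex.I ∈ {w : ℂ | 0 < w.im} := by simpa using hy
    have hdd : DifferentiableAt ℝ (fderiv ℝ g) (x + y * Complex.I) :=
      (hD.contDiffAt (isOpen_im_pos.mem_nhds hpt)).differentiableAt (by simp)
    rw [Pi.add_apply, laplacian_eq_fderiv_fderiv, fderiv_clm_apply hdd (differentiableAt_const _),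
      fderiv_clm_apply hdd (differentiableAt_const _)]
    simp
  · exact ((hg.continuousOn.comp_continuous (f := fun x : ℝ => (x : ℂ) + y * Complex.I)
      (by fun_prop) fun x => by simpa using hy).const_mul _).intervalIntegrable _ _

lemma neg_mem_or_mem_smul_eq {Γ : Subgroup SL(2, ℤ)} {f : ℍ → ℂ}
    (hf : ∀ γ ∈ Γ, ∀ z : ℍ, f (γ • z) = f z) {γ : SL(2, ℤ)} (hγ : γ ∈ Γ ∨ -γ ∈ Γ) (z : ℍ) :
    f (γ • z) = f z := by
  rcases hγ with h | h
  · exact hf γ h z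
  · rw [← hf _ h z, ModularGroup.SL_neg_smul]

/-- `Γ` contains some `Γ(M)`, which is normal and contains `T^M`; so the set in the definition of
the width is nonempty and its infimum is attained. -/
lemma cuspWidth_spec {Γ : Subgroup SL(2, ℤ)} (hΓ : CongruenceSubgroup.IsCongruenceSubgroup Γ)
    (σ : SL(2, ℤ)) : 0 < cuspWidth Γ σ ∧ (σ * ModularGroup.T ^ cuspWidth Γ σ * σ⁻¹ ∈ Γ ∨
      -(σ * ModularGroup.T ^ cuspWidth Γ σ * σ⁻¹) ∈ Γ) := by
  obtain ⟨M, hM, hle⟩ := hΓ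
  refine Nat.sInf_mem (s := {k : ℕ | 0 < k ∧ (σ * ModularGroup.T ^ k * σ⁻¹ ∈ Γ ∨
    -(σ * ModularGroup.T ^ k * σ⁻¹) ∈ Γ)}) ⟨M, Nat.pos_of_ne_zero hM, Or.inl (hle ?_)⟩
  refine (CongruenceSubgroup.Gamma_normal M).conj_mem _ ?_ σ
  rw [CongruenceSubgroup.Gamma_mem, ← zpow_natCast, ModularGroup.coe_T_zpow]
  simp

lemma apply_smul_T_pow_cuspWidth {Γ : Subgroup SL(2, ℤ)}
    (hΓ : CongruenceSubgroup.IsCongruenceSubgroup Γ) {f : ℍ → ℂ}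
    (hf : ∀ γ ∈ Γ, ∀ z : ℍ, f (γ • z) = f z) (σ : SL(2, ℤ)) (z : ℍ) :
    f (σ • (ModularGroup.T ^ cuspWidth Γ σ • z)) = f (σ • z) := by
  rw [← neg_mem_or_mem_smul_eq hf (cuspWidth_spec hΓ σ).2 (σ • z)]
  simp only [← mul_smul]
  congr 2
  group

/-- The Fourier expansion of the constant term of a weak Maass form at a cusp. -/
theorem exists_fourierConst_eq {Γ : Subgroup SL(2, ℤ)}
    (hΓ : CongruenceSubgroup.IsCongruenceSubgroup Γ) {s' : ℂ} (hs' : s' ≠ 1 / 2) {f : ℍ → ℂ}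
    (hf : IsWeakMaassForm Γ (s' * (1 - s')) f) (σ : SL(2, ℤ)) :
    ∃ A B : ℂ, ∀ y : ℝ, 0 < y →
      fourierConst Γ σ f y = A * (y : ℂ) ^ s' + B * (y : ℂ) ^ (1 - s') := by
  obtain ⟨hsm, heig⟩ := laplacian_smul_SL hf.smooth hf.eigen σ
  have hper : ∀ w : ℂ, 0 < w.im → f (σ • ofComplex (w + (cuspWidth Γ σ : ℝ))) =
      f (σ • ofComplex w) := fun w hw => by
    have := apply_smul_T_pow_cuspWidth hΓ hf.invariant σ (⟨w, hw⟩ : ℍ)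
    rw [← ofComplex_coe_add_natCast] at this
    simpa [ofComplex_apply_of_im_pos hw] using this
  obtain ⟨A, B, hAB⟩ := constTerm_of_eigenfunction (g := fun w => f (σ • ofComplex w)) hsm
    hper hs' (fun w hw => by
      have := heig (⟨w, hw⟩ : ℍ)
      simpa [ofComplex_apply_of_im_pos hw] using this)
  refine ⟨(cuspWidth Γ σ : ℂ)⁻¹ * A, (cuspWidth Γ σ : ℂ)⁻¹ * B, fun y hy => ?_⟩
  have := hAB y hy
  simp only [fourierConst, pt]
  rw [this]
  ring

end FourierConst
end RegTheta

namespace RegTheta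

/-! ### Hyperbolic integrals over strips. -/

section StripIntegrals

lemma setIntegral_eq_setIntegral_image_coe (g : ℍ → ℂ) {S : Set ℍ} (hS : MeasurableSet S) :
    ∫ z in S, g z = ∫ w in UpperHalfPlane.coe '' S, ((w.im ^ 2)⁻¹ : ℝ) • g (ofComplex w) := by
  have hmp : MeasurePreserving UpperHalfPlane.coe (volume.comap UpperHalfPlane.coe)
      (volume.restrict (Set.range UpperHalfPlane.coe)) :=
    ⟨measurable_coe, by rw [measurableEmbedding_coe.map_comap]⟩
  have hpre : UpperHalfPlane.coe ⁻¹' (UpperHalfPlane.coe '' S) = S :=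
    Set.preimage_image_eq S UpperHalfPlane.coe_injective
  have h1 := hmp.setIntegral_preimage_emb measurableEmbedding_coe
    (fun w : ℂ => ((w.im ^ 2)⁻¹ : ℝ) • g (ofComplex w)) (UpperHalfPlane.coe '' S)
  rw [Measure.restrict_restrict' measurableEmbedding_coe.measurableSet_range,
    Set.inter_eq_self_of_subset_left (Set.image_subset_range _ _), hpre] at h1
  rw [← h1, volume_def, setIntegral_withDensity_eq_setIntegral_smul ?_ g hS]
  · refine setIntegral_congr_fun hS fun z _ => ?_
    simp only [ofComplex_apply, NNReal.smul_def, coe_im]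
    congr 1
    simp
  · refine Measurable.pow_const (Measurable.div measurable_const ?_) 2
    exact (UpperHalfPlane.continuous_im.subtype_mk _).measurable

lemma image_coe_strip {p q : ℝ} {t : Set ℝ} (ht : ∀ y ∈ t, 0 < y) :
    UpperHalfPlane.coe '' {z : ℍ | z.re ∈ Set.Icc p q ∧ z.im ∈ t} =
      {w : ℂ | w.re ∈ Set.Icc p q ∧ w.im ∈ t} := by
  ext w
  constructor
  · rintro ⟨z, hz, rfl⟩
    exact hz
  · intro hw
    exact ⟨⟨w, ht _ hw.2⟩, hw, rfl⟩

lemma preimage_realProd_strip {p q : ℝ} {t : Set ℝ} :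
    Complex.measurableEquivRealProd.symm ⁻¹' {w : ℂ | w.re ∈ Set.Icc p q ∧ w.im ∈ t} =
      Set.Icc p q ×ˢ t := by
  ext x
  simp [Complex.measurableEquivRealProd_symm_apply]

lemma measurableSet_strip {p q : ℝ} {t : Set ℝ} (ht : MeasurableSet t) :
    MeasurableSet {z : ℍ | z.re ∈ Set.Icc p q ∧ z.im ∈ t} :=
  (UpperHalfPlane.continuous_re.measurable measurableSet_Icc).inter
    (UpperHalfPlane.continuous_im.measurable ht)

/-- Iterated integration over a strip with respect to the hyperbolic measure. -/
lemma setIntegral_strip {g : ℍ → ℂ} (hg : Continuous g) (p q : ℝ) {b T : ℝ} (hb : 0 < b) :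
    ∫ z in {z : ℍ | z.re ∈ Set.Icc p q ∧ z.im ∈ Set.Ioc b T}, g z =
      ∫ y in Set.Ioc b T, ∫ x in Set.Icc p q, ((y ^ 2)⁻¹ : ℝ) • g (pt x y) := by
  rw [setIntegral_eq_setIntegral_image_coe g (measurableSet_strip measurableSet_Ioc),
    image_coe_strip fun y hy => hb.trans hy.1,
    ← (Complex.volume_preserving_equiv_real_prod.symm).setIntegral_preimage_emb
      Complex.measurableEquivRealProd.symm.measurableEmbedding, preimage_realProd_strip,
    Measure.volume_eq_prod, ← setIntegral_prod_swap, setIntegral_prod]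
  · refine setIntegral_congr_fun measurableSet_Ioc fun y _ => ?_
    refine setIntegral_congr_fun measurableSet_Icc fun x _ => ?_
    simp only [Prod.swap, Complex.measurableEquivRealProd_symm_apply, pt]
    congr 3
    apply Complex.ext <;> simp
  · have hc : ContinuousOn (fun z : ℝ × ℝ => (((Complex.measurableEquivRealProd.symm z.swap).im
        ^ 2)⁻¹ : ℝ) • g (ofComplex (Complex.measurableEquivRealProd.symm z.swap)))
        (Set.Icc b T ×ˢ Set.Icc p q) := by
      have hcs : Continuous fun z : ℝ × ℝ => Complex.measurableEquivRealProd.symm z.swap := by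
        have : (fun z : ℝ × ℝ => Complex.measurableEquivRealProd.symm z.swap) =
            fun z => (z.2 : ℂ) + z.1 * Complex.I := by
          funext z
          apply Complex.ext <;> simp [Complex.measurableEquivRealProd_symm_apply]
        rw [this]
        fun_prop
      have him : ∀ z ∈ Set.Icc b T ×ˢ Set.Icc p q,
          0 < (Complex.measurableEquivRealProd.symm z.swap).im := fun z hz => by
        simpa [Complex.measurableEquivRealProd_symm_apply] using hb.trans_le hz.1.1
      have hA : ContinuousOn (fun z : ℝ × ℝ =>
          (((Complex.measurableEquivRealProd.symm z.swap).im ^ 2)⁻¹ : ℝ))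
          (Set.Icc b T ×ˢ Set.Icc p q) :=
        ContinuousOn.inv₀ ((Complex.continuous_im.comp hcs).pow 2).continuousOn
          fun z hz => (pow_pos (him z hz) 2).ne'
      have hB : ContinuousOn (fun z : ℝ × ℝ =>
          g (ofComplex (Complex.measurableEquivRealProd.symm z.swap)))
          (Set.Icc b T ×ˢ Set.Icc p q) := by
        refine hg.comp_continuousOn fun z hz => ?_
        have h1 : ContinuousAt ofComplex (Complex.measurableEquivRealProd.symm z.swap) :=
          (contMDiffAt_ofComplex (n := 0) (him z hz)).continuousAt
        exact (ContinuousAt.comp_of_eq h1 hcs.continuousAt rfl).continuousWithinAt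
      exact hA.smul hB
    exact (hc.integrableOn_compact (isCompact_Icc.prod isCompact_Icc)).mono_set
      (Set.prod_mono Set.Ioc_subset_Icc_self le_rfl)

/-- `∫ y⁻² dy` converges at infinity. Finite volume is what later allows constants as dominating
functions. -/
lemma volume_strip_lt_top (p q : ℝ) {b : ℝ} (hb : 0 < b) :
    volume {z : ℍ | z.re ∈ Set.Icc p q ∧ z.im ∈ Set.Ici b} < ⊤ := by
  rw [volume_eq_lintegral, image_coe_strip (t := Set.Ici b) fun y hy => hb.trans_le hy,
    ← (Complex.volume_preserving_equiv_real_prod.symm).setLIntegral_comp_preimage_emb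
      Complex.measurableEquivRealProd.symm.measurableEmbedding, preimage_realProd_strip]
  have h1 : IntegrableOn (fun y : ℝ => y ^ (-2 : ℝ)) (Set.Ici b) := by
    rw [integrableOn_Ici_iff_integrableOn_Ioi]
    exact integrableOn_Ioi_rpow_of_lt (by norm_num) hb
  have h2 : Integrable (fun z : ℝ × ℝ => (1 : ℝ) * z.2 ^ (-2 : ℝ))
      ((volume.restrict (Set.Icc p q)).prod (volume.restrict (Set.Ici b))) :=
    Integrable.mul_prod (f := fun _ : ℝ => (1 : ℝ)) (integrable_const _) h1
  rw [Measure.prod_restrict, ← Measure.volume_eq_prod] at h2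
  refine lt_of_le_of_lt (lintegral_mono_ae ?_) h2.2
  filter_upwards [ae_restrict_mem (measurableSet_Icc.prod measurableSet_Ici)] with z hz
  have hz2 : 0 < z.2 := hb.trans_le hz.2
  have : (Complex.measurableEquivRealProd.symm z).im = z.2 := by
    simp [Complex.measurableEquivRealProd_symm_apply]
  rw [this, one_mul, Real.rpow_neg hz2.le, ← ofReal_norm, ← ENNReal.ofReal_coe_nnreal]
  refine ENNReal.ofReal_le_ofReal ?_
  simp

end StripIntegrals

/-! ### The union of translated fundamental domains. -/

section Domain

lemma continuous_smul_SL (g : SL(2, ℤ)) : Continuous fun z : ℍ => g • z :=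
  (mdifferentiable_smul_SL g).continuous

/-- The union of the translates by `0, …, a - 1` of the standard fundamental domain. -/
def fullDomain (a : ℕ) : Set ℍ := {z : ℍ | ∃ j < a, ∃ w ∈ 𝒟, z = ModularGroup.T ^ j • w}

lemma truncDomain_eq (a : ℕ) (T : ℝ) : truncDomain a T = fullDomain a ∩ {z | z.im ≤ T} := rfl

lemma T_pow_smul_re (j : ℕ) (w : ℍ) : (ModularGroup.T ^ j • w).re = w.re + j := by
  have := ModularGroup.re_T_zpow_smul w j
  rwa [zpow_natCast, Int.cast_natCast] at this

lemma T_pow_smul_im (j : ℕ) (w : ℍ) : (ModularGroup.T ^ j • w).im = w.im := by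
  have := ModularGroup.im_T_zpow_smul w j
  rwa [zpow_natCast] at this

lemma mem_fullDomain_bounds {a : ℕ} {z : ℍ} (hz : z ∈ fullDomain a) :
    z.re ∈ Set.Icc (-1 / 2 : ℝ) (a - 1 / 2) ∧ z.im ∈ Set.Ici (1 / 2 : ℝ) := by
  obtain ⟨j, hj, w, hw, rfl⟩ := hz
  -- The sharp bound is `√3 / 2`; the weaker `1 / 2` is enough everywhere.
  have h1 := ModularGroup.three_le_four_mul_im_sq_of_mem_fd hw
  have h2 := abs_le.1 hw.2
  have h3 : (j : ℝ) + 1 ≤ a := by exact_mod_cast hj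
  have h4 : (0 : ℝ) ≤ j := Nat.cast_nonneg j
  rw [T_pow_smul_re, T_pow_smul_im]
  refine ⟨⟨by linarith, by linarith⟩, ?_⟩
  have := w.im_pos
  rw [Set.mem_Ici]
  nlinarith

lemma mem_fullDomain_of_one_lt_im {a : ℕ} (ha : 0 < a) {z : ℍ} (hz : 1 < z.im)
    (hre : z.re ∈ Set.Icc (-1 / 2 : ℝ) (a - 1 / 2)) : z ∈ fullDomain a := by
  -- The tile index is a floor, except on the right edge `re z = a - 1/2`, which belongs to the last
  -- tile.
  obtain ⟨j, hj, h1, h2⟩ : ∃ j : ℕ, j < a ∧ (j : ℝ) - 1 / 2 ≤ z.re ∧ z.re ≤ j + 1 / 2 := by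
    by_cases h : z.re < a - 1 / 2
    · have h0 : 0 ≤ z.re + 1 / 2 := by linarith [hre.1]
      refine ⟨⌊z.re + 1 / 2⌋₊, (Nat.floor_lt h0).2 (by linarith), ?_, ?_⟩
      · linarith [Nat.floor_le h0]
      · linarith [Nat.lt_floor_add_one (z.re + 1 / 2)]
    · refine ⟨a - 1, by omega, ?_, ?_⟩ <;> push_cast [Nat.cast_sub ha]
      · linarith [not_lt.1 h, hre.2]
      · linarith [hre.2]
  refine ⟨j, hj, ModularGroup.T ^ (-(j : ℤ)) • z, ⟨?_, ?_⟩, ?_⟩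
  · rw [Complex.normSq_apply, coe_im, ModularGroup.im_T_zpow_smul]
    nlinarith [mul_self_nonneg (ModularGroup.T ^ (-(j : ℤ)) • z : ℍ).re, 
      mul_self_nonneg ((ModularGroup.T ^ (-(j : ℤ)) • z : ℍ) : ℂ).re]
  · rw [ModularGroup.re_T_zpow_smul, abs_le]
    push_cast
    constructor <;> linarith
  · rw [← mul_smul, ← zpow_natCast, ← zpow_add, add_neg_cancel, zpow_zero, one_smul]

/-- Above height `1` the condition `|z| ≥ 1` is automatic. With `a` the cusp width the base of this
rectangle is one period, so integration in `x` isolates the constant term. -/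
lemma fullDomain_inter_eq {a : ℕ} (ha : 0 < a) {T : ℝ} :
    fullDomain a ∩ {z | z.im ∈ Set.Ioc 1 T} =
      {z : ℍ | z.re ∈ Set.Icc (-1 / 2 : ℝ) (a - 1 / 2) ∧ z.im ∈ Set.Ioc 1 T} := by
  ext z
  exact ⟨fun h => ⟨(mem_fullDomain_bounds h.1).1, h.2⟩,
    fun h => ⟨mem_fullDomain_of_one_lt_im ha h.2.1 h.1, h.2⟩⟩

lemma isClosed_fd : IsClosed (𝒟 : Set ℍ) :=
  (isClosed_le continuous_const (Complex.continuous_normSq.comp continuous_coe)).inter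
    (isClosed_le UpperHalfPlane.continuous_re.abs continuous_const)

lemma measurableSet_fullDomain (a : ℕ) : MeasurableSet (fullDomain a) := by
  have : fullDomain a = ⋃ j ∈ Finset.range a, (fun z : ℍ => ModularGroup.T ^ (-(j : ℤ)) • z) ⁻¹' 𝒟 := by
    ext z
    simp only [fullDomain, Set.mem_ofPred_eq, Set.mem_iUnion, Finset.mem_range, Set.mem_preimage]
    constructor
    · rintro ⟨j, hj, w, hw, rfl⟩
      refine ⟨j, hj, ?_⟩
      rwa [← mul_smul, ← zpow_natCast, ← zpow_add, neg_add_cancel, zpow_zero, one_smul]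
    · rintro ⟨j, hj, hz⟩
      refine ⟨j, hj, _, hz, ?_⟩
      rw [← mul_smul, ← zpow_natCast, ← zpow_add, add_neg_cancel, zpow_zero, one_smul]
  rw [this]
  refine Finset.measurableSet_biUnion _ fun j _ => ?_
  exact (isClosed_fd.preimage (continuous_smul_SL _)).measurableSet

lemma volume_fullDomain_lt_top (a : ℕ) : volume (fullDomain a) < ⊤ :=
  (measure_mono fun _ hz => mem_fullDomain_bounds hz).trans_lt
    (volume_strip_lt_top (-1 / 2) (a - 1 / 2) (by norm_num : (0 : ℝ) < 1 / 2))

lemma measurableSet_truncDomain (a : ℕ) (T : ℝ) : MeasurableSet (truncDomain a T) :=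
  (measurableSet_fullDomain a).inter (UpperHalfPlane.continuous_im.measurable measurableSet_Iic)

/-- The volume of the part of the domain above height `T` tends to `0`. -/
lemma tendsto_volume_fullDomain_above (a : ℕ) :
    Tendsto (fun T : ℝ => volume.real (fullDomain a ∩ {z | T < z.im})) atTop (𝓝 0) := by
  have h1 : Tendsto (fun T : ℝ => volume (fullDomain a ∩ {z | T < z.im})) atTop
      (𝓝 (volume (⋂ T : ℝ, fullDomain a ∩ {z | T < z.im}))) := by
    refine tendsto_measure_iInter_atTop (fun T => ?_) (fun T T' h z hz => ?_) ⟨0, ?_⟩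
    · exact ((measurableSet_fullDomain a).inter
        (UpperHalfPlane.continuous_im.measurable measurableSet_Ioi)).nullMeasurableSet
    · exact ⟨hz.1, lt_of_le_of_lt h hz.2⟩
    · exact ((measure_mono Set.inter_subset_left).trans_lt (volume_fullDomain_lt_top a)).ne
  have h2 : (⋂ T : ℝ, fullDomain a ∩ {z | T < z.im}) = ∅ := by
    refine Set.eq_empty_of_forall_notMem fun z hz => ?_
    exact lt_irrefl z.im (Set.mem_iInter.1 hz z.im).2
  rw [h2, measure_empty] at h1
  exact (ENNReal.tendsto_toReal ENNReal.zero_ne_top).comp h1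

end Domain
end RegTheta

namespace RegTheta

/-! ### The elementary integral that produces the poles. -/

section MainTermIntegral

lemma SmoothOnH.continuous {f : ℍ → ℂ} (hf : SmoothOnH f) : Continuous f := by
  have h := hf.continuousOn.comp_continuous continuous_coe fun z => z.im_pos
  simpa [Function.comp_def] using h

lemma pt_coe {x y : ℝ} (hy : 0 < y) : ((pt x y : ℍ) : ℂ) = x + y * Complex.I := by
  rw [pt, ofComplex_apply_of_im_pos (by simpa using hy)]

lemma pt_im {x y : ℝ} (hy : 0 < y) : (pt x y).im = y := by
  rw [← coe_im, pt_coe hy]; simp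

lemma pt_add_natCast {x y : ℝ} (hy : 0 < y) (k : ℕ) :
    pt (x + k) y = ModularGroup.T ^ k • pt x y := by
  rw [← ofComplex_coe_add_natCast, pt_coe hy, pt]
  congr 1
  push_cast
  ring

lemma setIntegral_Icc_eq_fourierConst {Γ : Subgroup SL(2, ℤ)}
    (hΓ : CongruenceSubgroup.IsCongruenceSubgroup Γ) {f : ℍ → ℂ}
    (hf : ∀ γ ∈ Γ, ∀ z : ℍ, f (γ • z) = f z) (σ : SL(2, ℤ)) {y : ℝ} (hy : 0 < y) :
    ∫ x in Set.Icc (-1 / 2 : ℝ) (cuspWidth Γ σ - 1 / 2), f (σ • pt x y) =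
      cuspWidth Γ σ * fourierConst Γ σ f y := by
  have hpos := (cuspWidth_spec hΓ σ).1
  have hper : Function.Periodic (fun x : ℝ => f (σ • pt x y)) (cuspWidth Γ σ) := fun x => by
    simp only [pt_add_natCast hy, apply_smul_T_pow_cuspWidth hΓ hf]
  have h0 : (-1 / 2 : ℝ) ≤ cuspWidth Γ σ - 1 / 2 := by
    have : (0 : ℝ) ≤ cuspWidth Γ σ := Nat.cast_nonneg _
    linarith
  rw [integral_Icc_eq_integral_Ioc, ← intervalIntegral.integral_of_le h0,
    show (cuspWidth Γ σ - 1 / 2 : ℝ) = -1 / 2 + cuspWidth Γ σ by ring,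
    hper.intervalIntegral_add_eq (-1 / 2) 0, zero_add, fourierConst]
  have : (cuspWidth Γ σ : ℂ) ≠ 0 := by exact_mod_cast hpos.ne'
  rw [mul_inv_cancel_left₀ this]

lemma continuous_im_cpow (r : ℂ) : Continuous fun z : ℍ => (z.im : ℂ) ^ r := by
  refine continuous_iff_continuousAt.2 fun z => ?_
  refine ContinuousAt.cpow (Complex.continuous_ofReal.comp UpperHalfPlane.continuous_im).continuousAt
    continuousAt_const (Or.inl (by simpa using z.im_pos))

/-- The integral of the main term over the truncated cusp. -/
lemma setIntegral_mainTerm {Γ : Subgroup SL(2, ℤ)}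
    (hΓ : CongruenceSubgroup.IsCongruenceSubgroup Γ) {f : ℍ → ℂ} (hfc : Continuous f)
    (hf : ∀ γ ∈ Γ, ∀ z : ℍ, f (γ • z) = f z) (σ : SL(2, ℤ)) {s' A B : ℂ}
    (hAB : ∀ y : ℝ, 0 < y →
      fourierConst Γ σ f y = A * (y : ℂ) ^ s' + B * (y : ℂ) ^ (1 - s'))
    {s : ℂ} (h1 : s ≠ s') (h2 : s ≠ 1 - s') {T : ℝ} (hT : 1 ≤ T) :
    ∫ z in fullDomain (cuspWidth Γ σ) ∩ {z | z.im ∈ Set.Ioc 1 T},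
      f (σ • z) * (z.im : ℂ) * (z.im : ℂ) ^ (-s) =
    cuspWidth Γ σ * (A * ((1 - (T : ℂ) ^ (s' - s)) / (s - s')) +
      B * ((1 - (T : ℂ) ^ (1 - s' - s)) / (s + s' - 1))) := by
  have hpos := (cuspWidth_spec hΓ σ).1
  have hcont : Continuous fun z : ℍ => f (σ • z) * (z.im : ℂ) * (z.im : ℂ) ^ (-s) :=
    ((hfc.comp (continuous_smul_SL σ)).mul (Complex.continuous_ofReal.comp
      UpperHalfPlane.continuous_im)).mul (continuous_im_cpow _)
  rw [fullDomain_inter_eq hpos, setIntegral_strip hcont _ _ one_pos]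
  -- The integrand carries one power of `y` from the theta kernel, `y^{-s}` from the regularization
  -- and `y⁻²` from the measure.
  have hinner : ∀ y ∈ Set.Ioc 1 T, (∫ x in Set.Icc (-1 / 2 : ℝ) (cuspWidth Γ σ - 1 / 2),
      ((y ^ 2)⁻¹ : ℝ) • (f (σ • pt x y) * ((pt x y).im : ℂ) * ((pt x y).im : ℂ) ^ (-s))) =
      cuspWidth Γ σ * (A * (y : ℂ) ^ (s' - s - 1) + B * (y : ℂ) ^ (1 - s' - s - 1)) := by
    intro y hy
    have hy0 : 0 < y := one_pos.trans hy.1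
    have hyc : (y : ℂ) ≠ 0 := by exact_mod_cast hy0.ne'
    simp only [pt_im hy0, Complex.real_smul]
    have e1 : ∀ x : ℝ, ((((y ^ 2)⁻¹ : ℝ) : ℂ) * (f (σ • pt x y) * (y : ℂ) * (y : ℂ) ^ (-s))) =
        f (σ • pt x y) * ((y : ℂ) ^ (-s) * (y : ℂ)⁻¹) := fun x => by
      push_cast
      field_simp
    simp only [e1]
    rw [integral_mul_const, setIntegral_Icc_eq_fourierConst hΓ hf σ hy0, hAB y hy0]
    have e2 : ∀ r : ℂ, (y : ℂ) ^ (r - s - 1) = (y : ℂ) ^ r * ((y : ℂ) ^ (-s) * (y : ℂ)⁻¹) := by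
      intro r
      rw [show r - s - 1 = r + (-s + -1) by ring, Complex.cpow_add _ _ hyc,
        Complex.cpow_add _ _ hyc, Complex.cpow_neg_one]
    rw [e2, e2]
    ring
  rw [setIntegral_congr_fun measurableSet_Ioc hinner, integral_const_mul,
    ← intervalIntegral.integral_of_le hT]
  have hpow : ∀ r : ℂ, r ≠ 0 → ∫ y in (1 : ℝ)..T, (y : ℂ) ^ (r - 1) = ((T : ℂ) ^ r - 1) / r := by
    intro r hr
    rw [integral_cpow]
    · simp
    · refine Or.inr ⟨fun h => hr (by linear_combination h), ?_⟩
      rw [Set.uIcc_of_le hT]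
      exact fun h => absurd h.1 (by norm_num)
  have hint : ∀ r : ℂ, IntervalIntegrable (fun y : ℝ => (y : ℂ) ^ (r - 1)) volume 1 T := by
    intro r
    refine intervalIntegral.intervalIntegrable_cpow (Or.inr ?_)
    rw [Set.uIcc_of_le hT]
    exact fun h => absurd h.1 (by norm_num)
  rw [intervalIntegral.integral_add ((hint _).const_mul _) ((hint _).const_mul _),
    intervalIntegral.integral_const_mul, intervalIntegral.integral_const_mul,
    hpow _ (sub_ne_zero.2 h1.symm), hpow _ (sub_ne_zero.2 h2.symm)]
  have d1 : s - s' ≠ 0 := sub_ne_zero.2 h1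
  have d1' : s' - s ≠ 0 := sub_ne_zero.2 h1.symm
  have d2 : s + s' - 1 ≠ 0 := by
    intro h
    exact h2 (by linear_combination h)
  have d2' : 1 - s' - s ≠ 0 := sub_ne_zero.2 h2.symm
  congr 2
  · congr 1
    rw [div_eq_div_iff d1' d1]
    ring
  · congr 1
    rw [div_eq_div_iff d2' d2]
    ring

/-- Convergence of the main term, locally uniformly in a right half plane. -/
lemma tendstoLocallyUniformlyOn_cpow (r : ℂ) {x₀ : ℝ} (hx : r.re ≤ x₀) :
    TendstoLocallyUniformlyOn (fun (T : ℝ) (s : ℂ) => (T : ℂ) ^ (r - s)) (fun _ => 0) atTop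
      {s : ℂ | x₀ < s.re} := by
  have hopen : IsOpen {s : ℂ | x₀ < s.re} := isOpen_lt continuous_const Complex.continuous_re
  rw [tendstoLocallyUniformlyOn_iff_forall_isCompact hopen]
  intro K hK hKc
  rcases K.eq_empty_or_nonempty with rfl | hne
  · exact tendstoUniformlyOn_empty
  -- On a compact subset of the half plane `Re s` has a minimum, which gives a uniform negative
  -- exponent of `T`.
  obtain ⟨s₁, hs₁, hmin⟩ := hKc.exists_isMinOn hne Complex.continuous_re.continuousOn
  have hδ : 0 < s₁.re - r.re := by
    have : x₀ < s₁.re := hK hs₁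
    linarith
  rw [Metric.tendstoUniformlyOn_iff]
  intro ε hε
  have hlim := tendsto_rpow_neg_atTop hδ
  filter_upwards [hlim.eventually (gt_mem_nhds hε), eventually_ge_atTop 1] with T hT hT1 s hs
  rw [dist_zero_left, Complex.norm_cpow_eq_rpow_re_of_pos (by linarith)]
  refine lt_of_le_of_lt (Real.rpow_le_rpow_of_exponent_le hT1 ?_) hT
  have : s₁.re ≤ s.re := hmin hs
  simp only [Complex.sub_re]
  linarith

end MainTermIntegral
end RegTheta

namespace RegTheta

/-! ### Matrix coordinates on the quadratic space. -/

section Coordinates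

/-- The trace zero matrix `(a, b; c, -a)`. -/
def vec (a b c : ℚ) : V := ⟨!![a, b; c, -a], by simp [Matrix.trace, Fin.sum_univ_two]⟩

lemma V.apply_one_one (X : V) : X.1 1 1 = -X.1 0 0 := by
  have h : Matrix.trace X.1 = 0 := X.2
  rw [Matrix.trace_fin_two] at h
  linarith

lemma V.ext_iff' {X Y : V} :
    X = Y ↔ X.1 0 0 = Y.1 0 0 ∧ X.1 0 1 = Y.1 0 1 ∧ X.1 1 0 = Y.1 1 0 := by
  refine ⟨fun h => by rw [h]; exact ⟨rfl, rfl, rfl⟩, fun ⟨h1, h2, h3⟩ => Subtype.ext ?_⟩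
  ext i j
  fin_cases i <;> fin_cases j
  · exact h1
  · exact h2
  · exact h3
  · change X.1 1 1 = Y.1 1 1
    rw [V.apply_one_one, V.apply_one_one, h1]

@[simp] lemma vec_apply_00 (a b c : ℚ) : (vec a b c).1 0 0 = a := rfl
@[simp] lemma vec_apply_01 (a b c : ℚ) : (vec a b c).1 0 1 = b := rfl
@[simp] lemma vec_apply_10 (a b c : ℚ) : (vec a b c).1 1 0 = c := rfl

lemma eq_vec (X : V) : X = vec (X.1 0 0) (X.1 0 1) (X.1 1 0) := by simp [V.ext_iff']

lemma V.coe_zsmul (n : ℤ) (X : V) : (n • X).1 = n • X.1 := rfl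
lemma V.zsmul_apply (n : ℤ) (X : V) (i j : Fin 2) : (n • X).1 i j = n * X.1 i j := by
  rw [V.coe_zsmul, Matrix.smul_apply, zsmul_eq_mul]
lemma V.add_apply (X Y : V) (i j : Fin 2) : (X + Y).1 i j = X.1 i j + Y.1 i j := rfl
lemma V.sub_apply (X Y : V) (i j : Fin 2) : (X - Y).1 i j = X.1 i j - Y.1 i j := rfl
lemma V.neg_apply (X : V) (i j : Fin 2) : (-X).1 i j = -X.1 i j := rfl

lemma form_apply (N : ℕ) (X Y : V) : form N X Y =
    N * (2 * X.1 0 0 * Y.1 0 0 + X.1 0 1 * Y.1 1 0 + X.1 1 0 * Y.1 0 1) := by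
  simp only [form, LinearMap.mk₂_apply, Matrix.trace_fin_two, Matrix.mul_apply, Fin.sum_univ_two,
    V.apply_one_one]
  ring

lemma quad_apply (N : ℕ) (X : V) : quad N X = N * (X.1 0 0 ^ 2 + X.1 0 1 * X.1 1 0) := by
  rw [quad, Matrix.det_fin_two, V.apply_one_one]
  ring

lemma form_conj (N : ℕ) (g : SL(2, ℤ)) (X Y : V) : form N (conj g X) (conj g Y) = form N X Y := by
  simp only [form, LinearMap.mk₂_apply, coe_conj]
  congr 1
  rw [show ratMat g * X.1 * ratMat g⁻¹ * (ratMat g * Y.1 * ratMat g⁻¹) =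
    ratMat g * (X.1 * (ratMat g⁻¹ * ratMat g) * Y.1 * ratMat g⁻¹) by simp only [mul_assoc],
    Matrix.trace_mul_comm, ratMat_inv_mul, mul_one, mul_assoc, ratMat_inv_mul, mul_one]

lemma conj_inv_conj (g : SL(2, ℤ)) (X : V) : conj g⁻¹ (conj g X) = X := by
  rw [← LinearMap.comp_apply, ← conj_mul, inv_mul_cancel, conj_one, LinearMap.id_apply]

lemma conj_conj_inv (g : SL(2, ℤ)) (X : V) : conj g (conj g⁻¹ X) = X := by
  rw [← LinearMap.comp_apply, ← conj_mul, mul_inv_cancel, conj_one, LinearMap.id_apply]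

end Coordinates

/-! ### Hermite bases of lattices. -/

section Hermite

/-- A basis of a lattice in `V` in Hermite normal form. -/
structure HermiteBasis (L : Submodule ℤ V) where
  (β δ γ μ κ ν : ℚ)
  β_pos : 0 < β
  δ_pos : 0 < δ
  γ_pos : 0 < γ
  mem_iff : ∀ X : V, X ∈ L ↔
    ∃ k m n : ℤ, X = vec (m * δ + n * μ) (k * β + m * κ + n * ν) (n * γ)

/-- A finitely generated subgroup of `ℚ` is a fractional ideal of the principal ideal domain `ℤ`,
hence cyclic. -/
lemma exists_generator_of_fg_rat {P : Submodule ℤ ℚ} (hP : P.FG) {q : ℚ} (hq : q ∈ P)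
    (hq0 : q ≠ 0) : ∃ r : ℚ, 0 < r ∧ ∀ x : ℚ, x ∈ P ↔ ∃ n : ℤ, x = n * r := by
  have hprin : P.IsPrincipal := FractionalIdeal.isPrincipal (R := ℤ) (K := ℚ)
    (⟨P, FractionalIdeal.isFractional_of_fg hP⟩ : FractionalIdeal (nonZeroDivisors ℤ) ℚ)
  obtain ⟨r, hr⟩ := hprin.principal
  have hmem : ∀ x : ℚ, x ∈ P ↔ ∃ n : ℤ, x = n * r := by
    intro x
    rw [hr, Submodule.mem_span_singleton]
    simp only [zsmul_eq_mul, eq_comm]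
  have hr0 : r ≠ 0 := by
    rintro rfl
    obtain ⟨n, hn⟩ := (hmem q).1 hq
    exact hq0 (by simpa using hn)
  refine ⟨|r|, abs_pos.2 hr0, fun x => ?_⟩
  rw [hmem]
  rcases abs_choice r with h | h <;> rw [h]
  constructor <;> rintro ⟨n, hn⟩ <;> refine ⟨-n, ?_⟩ <;> rw [hn] <;> push_cast <;> ring

/-- The matrix entry at `(i, j)` as a linear functional. -/
def entry (i j : Fin 2) : V →ₗ[ℤ] ℚ where
  toFun X := X.1 i j
  map_add' _ _ := rfl
  map_smul' n X := by simp [V.zsmul_apply]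

lemma entry_apply (i j : Fin 2) (X : V) : entry i j X = X.1 i j := rfl

/-- Filter `L` by the vanishing of the lower left entry and then of the diagonal entry. Each step
maps onto a nonzero cyclic group in `ℚ`, and lifts of the generators form the basis. The filtration
is `L ∩ ℓ₀ ⊂ L ∩ ℓ₀^⊥ ⊂ L`, so the basis is adapted to the cusp. -/
theorem exists_hermiteBasis {L : Submodule ℤ V} (hfg : L.FG)
    (hfull : ∀ X : V, ∃ n : ℤ, n ≠ 0 ∧ n • X ∈ L) : Nonempty (HermiteBasis L) := by
  have hnoeth : IsNoetherian ℤ L := isNoetherian_of_fg_of_noetherian L hfg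
  have hle : ∀ {P : Submodule ℤ V}, P ≤ L → P.FG := fun {P} hP => by
    have := (IsNoetherian.noetherian (P.submoduleOf L)).map L.subtype
    rwa [Submodule.submoduleOf, Submodule.map_comap_subtype, inf_eq_right.2 hP] at this
  have hne : ∀ (i j : Fin 2) (X : V) (n : ℤ), n ≠ 0 → X.1 i j = 1 → (n • X).1 i j ≠ 0 := by
    intro i j X n hn hX
    rw [V.zsmul_apply, hX]; simpa using hn
  obtain ⟨n3, hn3, hm3⟩ := hfull (vec 0 0 1)
  obtain ⟨n1, hn1, hm1⟩ := hfull (vec 1 0 0)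
  obtain ⟨n2, hn2, hm2⟩ := hfull (vec 0 1 0)
  set L0 := L ⊓ LinearMap.ker (entry 1 0) with hL0
  set L1 := L0 ⊓ LinearMap.ker (entry 0 0) with hL1
  have hmem0 : ∀ X, X ∈ L0 ↔ X ∈ L ∧ X.1 1 0 = 0 := fun X => by
    rw [hL0, Submodule.mem_inf, LinearMap.mem_ker, entry_apply]
  have hmem1 : ∀ X, X ∈ L1 ↔ (X ∈ L ∧ X.1 1 0 = 0) ∧ X.1 0 0 = 0 := fun X => by
    rw [hL1, Submodule.mem_inf, LinearMap.mem_ker, entry_apply, hmem0]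
  obtain ⟨γ, hγ, hγm⟩ := exists_generator_of_fg_rat (hfg.map (entry 1 0))
    ⟨_, hm3, rfl⟩ (hne 1 0 (vec 0 0 1) n3 hn3 rfl)
  obtain ⟨δ, hδ, hδm⟩ := exists_generator_of_fg_rat ((hle inf_le_left : L0.FG).map (entry 0 0))
    ⟨_, (hmem0 _).2 ⟨hm1, by rw [V.zsmul_apply]; simp⟩, rfl⟩ (hne 0 0 (vec 1 0 0) n1 hn1 rfl)
  obtain ⟨β, hβ, hβm⟩ := exists_generator_of_fg_rat
    ((hle (inf_le_left.trans inf_le_left) : L1.FG).map (entry 0 1))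
    ⟨_, (hmem1 _).2 ⟨⟨hm2, by rw [V.zsmul_apply]; simp⟩, by rw [V.zsmul_apply]; simp⟩, rfl⟩
    (hne 0 1 (vec 0 1 0) n2 hn2 rfl)
  obtain ⟨E3, hE3, hE3γ⟩ := (hγm γ).2 ⟨1, by simp⟩
  obtain ⟨E2, hE2, hE2δ⟩ := (hδm δ).2 ⟨1, by simp⟩
  obtain ⟨E1, hE1, hE1β⟩ := (hβm β).2 ⟨1, by simp⟩
  rw [entry_apply] at hE3γ hE2δ hE1β
  have hE2' := (hmem0 E2).1 hE2
  have hE1' := (hmem1 E1).1 hE1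
  refine ⟨⟨β, δ, γ, E3.1 0 0, E2.1 0 1, E3.1 0 1, hβ, hδ, hγ, fun X => ⟨fun hX => ?_, ?_⟩⟩⟩
  · obtain ⟨n, hn⟩ := (hγm (X.1 1 0)).1 ⟨X, hX, rfl⟩
    have hX0 : X - n • E3 ∈ L0 := by
      refine (hmem0 _).2 ⟨L.sub_mem hX (L.smul_mem n hE3), ?_⟩
      rw [V.sub_apply, V.zsmul_apply, hE3γ, show X.1 1 0 = n * γ from hn, sub_self]
    obtain ⟨m, hm⟩ := (hδm _).1 ⟨_, hX0, rfl⟩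
    have hX1 : X - n • E3 - m • E2 ∈ L1 := by
      rw [hL1]
      refine ⟨L0.sub_mem hX0 (L0.smul_mem m hE2), ?_⟩
      change entry 0 0 (X - n • E3 - m • E2) = 0
      rw [map_sub, hm, map_smul, entry_apply 0 0 E2, hE2δ, zsmul_eq_mul, sub_self]
    obtain ⟨k, hk⟩ := (hβm _).1 ⟨_, hX1, rfl⟩
    refine ⟨k, m, n, V.ext_iff'.2 ⟨?_, ?_, ?_⟩⟩
    · simp only [entry_apply, V.sub_apply, V.zsmul_apply] at hm
      rw [vec_apply_00]
      linarith
    · simp only [entry_apply, V.sub_apply, V.zsmul_apply] at hk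
      rw [vec_apply_01]
      linarith
    · rw [vec_apply_10]; exact hn
  · rintro ⟨k, m, n, rfl⟩
    have : vec (m * δ + n * E3.1 0 0) (k * β + m * E2.1 0 1 + n * E3.1 0 1) (n * γ) =
        k • E1 + m • E2 + n • E3 := by
      refine V.ext_iff'.2 ⟨?_, ?_, ?_⟩ <;>
      rw [V.add_apply, V.add_apply, V.zsmul_apply, V.zsmul_apply, V.zsmul_apply] <;>
      simp [hE1'.2, hE1'.1.2, hE2'.2, hE2δ, hE1β, hE3γ]
    rw [this]
    exact L.add_mem (L.add_mem (L.smul_mem _ hE1'.1.1) (L.smul_mem _ hE2'.1)) (L.smul_mem _ hE3)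

/-- The lattice `g⁻¹.L`. -/
def conjLattice (g : SL(2, ℤ)) (L : Submodule ℤ V) : Submodule ℤ V :=
  L.comap ((conj g).restrictScalars ℤ)

lemma mem_conjLattice {g : SL(2, ℤ)} {L : Submodule ℤ V} {X : V} :
    X ∈ conjLattice g L ↔ conj g X ∈ L := Iff.rfl

/-- Clearing denominators in a rational combination of lattice vectors. -/
lemma exists_smul_mem_of_isLattice {L : Submodule ℤ V} (hL : Submodule.IsLattice ℚ L) (X : V) :
    ∃ n : ℤ, n ≠ 0 ∧ n • X ∈ L := by
  have hX : X ∈ Submodule.span ℚ (L : Set V) := by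
    rw [hL.span_eq_top]
    trivial
  induction hX using Submodule.span_induction with
  | mem x hx => exact ⟨1, one_ne_zero, by simpa using hx⟩
  | zero => exact ⟨1, one_ne_zero, by simp⟩
  | add x y _ _ hx hy =>
    obtain ⟨n, hn, hnx⟩ := hx
    obtain ⟨m, hm, hmy⟩ := hy
    refine ⟨n * m, mul_ne_zero hn hm, ?_⟩
    rw [smul_add]
    refine L.add_mem ?_ ?_
    · rw [mul_comm, mul_smul]
      exact L.smul_mem _ hnx
    · rw [mul_smul]
      exact L.smul_mem _ hmy
  | smul a x _ hx =>
    obtain ⟨n, hn, hnx⟩ := hx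
    refine ⟨n * a.den, mul_ne_zero hn (by exact_mod_cast a.den_nz), ?_⟩
    have : ((n * a.den : ℤ)) • a • x = a.num • n • x := by
      rw [← Int.cast_smul_eq_zsmul ℚ, ← Int.cast_smul_eq_zsmul ℚ, ← Int.cast_smul_eq_zsmul ℚ,
        smul_smul, smul_smul]
      congr 1
      push_cast
      rw [mul_assoc, mul_comm (a.den : ℚ), Rat.mul_den_eq_num]
      ring
    rw [this]
    exact L.smul_mem _ hnx

lemma nonempty_hermiteBasis_conjLattice {L : Submodule ℤ V} (hL : Submodule.IsLattice ℚ L)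
    (g : SL(2, ℤ)) : Nonempty (HermiteBasis (conjLattice g L)) := by
  refine exists_hermiteBasis ?_ fun X => ?_
  · have : conjLattice g L = L.map ((conj g⁻¹).restrictScalars ℤ) := by
      ext X
      rw [mem_conjLattice, Submodule.mem_map]
      constructor
      · exact fun h => ⟨_, h, conj_inv_conj g X⟩
      · rintro ⟨Y, hY, rfl⟩
        change conj g (conj g⁻¹ Y) ∈ L
        rwa [conj_conj_inv]
    rw [this]
    exact hL.fg.map _
  · obtain ⟨n, hn, h⟩ := exists_smul_mem_of_isLattice hL (conj g X)
    refine ⟨n, hn, ?_⟩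
    change conj g (n • X) ∈ L
    rwa [map_zsmul]

end Hermite
end RegTheta

namespace RegTheta

/-! ### The dual lattice and the order of the discriminant group. -/

section Discriminant

variable {N : ℕ} {L : Submodule ℤ V}

lemma mem_dual_iff {X : V} : X ∈ dual N L ↔ ∀ Y ∈ L, ∃ n : ℤ, form N X Y = n := by
  rw [LinearMap.BilinForm.mem_dualSubmodule]
  simp only [Submodule.mem_one, eq_intCast, eq_comm]

lemma form_comm (X Y : V) : form N X Y = form N Y X := by
  rw [form_apply, form_apply]
  ring

lemma form_self (X : V) : form N X X = 2 * quad N X := by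
  rw [form_apply, quad_apply]
  ring

lemma quad_add (X Y : V) : quad N (X + Y) = quad N X + quad N Y + form N X Y := by
  simp only [quad_apply, form_apply, V.add_apply]
  ring

/-- Polarization: `(X, Y) = Q(X + Y) - Q(X) - Q(Y)` is an integer on an even lattice. -/
lemma le_dual (hL : IsEvenLattice N L) : L ≤ dual N L := by
  intro X hX
  refine mem_dual_iff.2 fun Y hY => ?_
  obtain ⟨a, ha⟩ := hL.even _ (L.add_mem hX hY)
  obtain ⟨b, hb⟩ := hL.even _ hX
  obtain ⟨c, hc⟩ := hL.even _ hY
  refine ⟨a - b - c, ?_⟩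
  rw [quad_add, hb, hc] at ha
  push_cast
  linarith

lemma HermiteBasis.vec_mem (b : HermiteBasis L) (k m n : ℤ) :
    vec (m * b.δ + n * b.μ) (k * b.β + m * b.κ + n * b.ν) (n * b.γ) ∈ L :=
  (b.mem_iff _).2 ⟨k, m, n, rfl⟩

lemma HermiteBasis.mem_dual_iff (b : HermiteBasis L) (X : V) : X ∈ dual N L ↔
    (∃ n : ℤ, N * b.β * X.1 1 0 = n) ∧
    (∃ m : ℤ, N * (2 * X.1 0 0 * b.δ + X.1 1 0 * b.κ) = m) ∧
    (∃ k : ℤ, N * (2 * X.1 0 0 * b.μ + X.1 0 1 * b.γ + X.1 1 0 * b.ν) = k) := by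
  rw [RegTheta.mem_dual_iff]
  constructor
  · intro h
    refine ⟨?_, ?_, ?_⟩
    · obtain ⟨n, hn⟩ := h _ (b.vec_mem 1 0 0)
      refine ⟨n, ?_⟩
      rw [← hn, form_apply]
      simp
      ring
    · obtain ⟨n, hn⟩ := h _ (b.vec_mem 0 1 0)
      refine ⟨n, ?_⟩
      rw [← hn, form_apply]
      simp
    · obtain ⟨n, hn⟩ := h _ (b.vec_mem 0 0 1)
      refine ⟨n, ?_⟩
      rw [← hn, form_apply]
      simp
  · rintro ⟨⟨n', hn⟩, ⟨m', hm⟩, ⟨k', hk⟩⟩ Y hY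
    obtain ⟨k, m, n, rfl⟩ := (b.mem_iff Y).1 hY
    refine ⟨k * n' + m * m' + n * k', ?_⟩
    rw [form_apply]
    push_cast
    rw [← hn, ← hm, ← hk]
    simp only [vec_apply_00, vec_apply_01, vec_apply_10]
    ring

/-- The Hermite basis of the dual lattice. -/
def HermiteBasis.dual (b : HermiteBasis L) (hN : 0 < N) : HermiteBasis (dual N L) where
  -- These six numbers solve the triangular system that prescribes integral pairings with the three
  -- basis vectors.
  β := 1 / (N * b.γ)
  δ := 1 / (2 * N * b.δ)
  γ := 1 / (N * b.β)
  μ := -b.κ / (2 * N * b.β * b.δ)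
  κ := -b.μ / (N * b.δ * b.γ)
  ν := b.κ * b.μ / (N * b.β * b.δ * b.γ) - b.ν / (N * b.β * b.γ)
  β_pos := by have := b.γ_pos; positivity
  δ_pos := by have := b.δ_pos; positivity
  γ_pos := by have := b.β_pos; positivity
  mem_iff X := by
    have hβ := b.β_pos.ne'
    have hδ := b.δ_pos.ne'
    have hγ := b.γ_pos.ne'
    have hN' : (N : ℚ) ≠ 0 := by exact_mod_cast hN.ne'
    rw [b.mem_dual_iff]
    constructor
    · rintro ⟨⟨n, hn⟩, ⟨m, hm⟩, ⟨k, hk⟩⟩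
      refine ⟨k, m, n, V.ext_iff'.2 ⟨?_, ?_, ?_⟩⟩
      · rw [vec_apply_00, ← hn, ← hm]
        field_simp
        ring
      · rw [vec_apply_01, ← hn, ← hm, ← hk]
        field_simp
        ring
      · rw [vec_apply_10, ← hn]
        field_simp
    · rintro ⟨k, m, n, rfl⟩
      refine ⟨⟨n, ?_⟩, ⟨m, ?_⟩, ⟨k, ?_⟩⟩ <;>
      simp only [vec_apply_00, vec_apply_01, vec_apply_10] <;> field_simp <;> ring

/-- Coordinates with respect to a Hermite basis. -/
def HermiteBasis.coords (b : HermiteBasis L) : V ≃ₗ[ℚ] (Fin 3 → ℚ) where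
  toFun X := ![(X.1 0 1 - (X.1 0 0 - X.1 1 0 / b.γ * b.μ) / b.δ * b.κ - X.1 1 0 / b.γ * b.ν) / b.β,
    (X.1 0 0 - X.1 1 0 / b.γ * b.μ) / b.δ, X.1 1 0 / b.γ]
  map_add' X Y := by
    ext i
    fin_cases i <;> simp [V.add_apply] <;> ring
  map_smul' c X := by
    ext i
    fin_cases i <;> simp <;> ring
  invFun a := vec (a 1 * b.δ + a 2 * b.μ) (a 0 * b.β + a 1 * b.κ + a 2 * b.ν) (a 2 * b.γ)
  left_inv X := by
    have hβ := b.β_pos.ne'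
    have hδ := b.δ_pos.ne'
    have hγ := b.γ_pos.ne'
    refine V.ext_iff'.2 ⟨?_, ?_, ?_⟩ <;> simp <;> field_simp <;> ring
  right_inv a := by
    have hβ := b.β_pos.ne'
    have hδ := b.δ_pos.ne'
    have hγ := b.γ_pos.ne'
    ext i
    fin_cases i <;> simp <;> field_simp <;> ring

/-- The vectors of a Hermite basis, as a basis of `V`. -/
def HermiteBasis.basis (b : HermiteBasis L) : Module.Basis (Fin 3) ℚ V :=
  Module.Basis.ofEquivFun b.coords

lemma HermiteBasis.basis_apply (b : HermiteBasis L) (i : Fin 3) :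
    b.basis i = ![vec 0 b.β 0, vec b.δ b.κ 0, vec b.μ b.ν b.γ] i := by
  rw [basis, Module.Basis.coe_ofEquivFun]
  fin_cases i <;> refine V.ext_iff'.2 ⟨?_, ?_, ?_⟩ <;> simp [coords]

lemma HermiteBasis.closure_range_basis (b : HermiteBasis L) :
    L.toAddSubgroup = AddSubgroup.closure (Set.range b.basis) := by
  apply le_antisymm
  · intro X hX
    obtain ⟨k, m, n, rfl⟩ := (b.mem_iff X).1 hX
    have : vec (m * b.δ + n * b.μ) (k * b.β + m * b.κ + n * b.ν) (n * b.γ) =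
        k • b.basis 0 + m • b.basis 1 + n • b.basis 2 := by
      rw [basis_apply, basis_apply, basis_apply]
      refine V.ext_iff'.2 ⟨?_, ?_, ?_⟩ <;>
      rw [V.add_apply, V.add_apply, V.zsmul_apply, V.zsmul_apply, V.zsmul_apply] <;> simp
    rw [this]
    have h : ∀ i, b.basis i ∈ AddSubgroup.closure (Set.range b.basis) :=
      fun i => AddSubgroup.subset_closure ⟨i, rfl⟩
    exact add_mem (add_mem (zsmul_mem (h 0) _) (zsmul_mem (h 1) _)) (zsmul_mem (h 2) _)
  · rw [AddSubgroup.closure_le]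
    rintro _ ⟨i, rfl⟩
    rw [basis_apply]
    fin_cases i
    · simpa using b.vec_mem 1 0 0
    · simpa using b.vec_mem 0 1 0
    · simpa using b.vec_mem 0 0 1

/-- The index is the absolute determinant of the change of basis, which is triangular, so only the
diagonal entries matter. -/
lemma HermiteBasis.relIndex_eq {L₁ L₂ : Submodule ℤ V} (b₁ : HermiteBasis L₁)
    (b₂ : HermiteBasis L₂) (h : L₁ ≤ L₂) :
    (L₁.toAddSubgroup.relIndex L₂.toAddSubgroup : ℚ) =
      b₁.β * b₁.δ * b₁.γ / (b₂.β * b₂.δ * b₂.γ) := by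
  have hβ := b₁.β_pos
  have hδ := b₁.δ_pos
  have hγ := b₁.γ_pos
  have hβ' := b₂.β_pos
  have hδ' := b₂.δ_pos
  have hγ' := b₂.γ_pos
  rw [AddSubgroup.relIndex_eq_abs_det _ _ h b₁.basis b₂.basis b₁.closure_range_basis
    b₂.closure_range_basis, Module.Basis.det_apply, Matrix.det_fin_three]
  simp only [Module.Basis.toMatrix_apply, basis_apply]
  have hr : ∀ X i, b₂.basis.repr X i = b₂.coords X i := fun X i => by
    rw [basis, Module.Basis.ofEquivFun_repr_apply]
  simp only [hr]
  simp [coords]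
  rw [abs_of_pos (div_pos hβ hβ'), abs_of_pos (div_pos hδ hδ'), abs_of_pos (div_pos hγ hγ')]
  field_simp

/-- The dual basis has diagonal product `1 / (2 N³ βδγ)`. The value is needed to match the covolume
factor of Poisson summation with `|L'/L|^{-1/2}`. -/
theorem HermiteBasis.card_disc (b : HermiteBasis L) (hN : 0 < N) (hL : IsEvenLattice N L) :
    (Nat.card (Disc N L) : ℚ) = 2 * N ^ 3 * (b.β * b.δ * b.γ) ^ 2 := by
  have h1 : Nat.card (Disc N L) = L.toAddSubgroup.relIndex (RegTheta.dual N L).toAddSubgroup := rfl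
  rw [h1, b.relIndex_eq (b.dual hN) (le_dual hL)]
  have hβ := b.β_pos
  have hδ := b.δ_pos
  have hγ := b.γ_pos
  have hN' : (N : ℚ) ≠ 0 := by exact_mod_cast hN.ne'
  simp only [HermiteBasis.dual]
  field_simp

lemma finite_disc (hN : 0 < N) (hL : IsEvenLattice N L) : Finite (Disc N L) := by
  obtain ⟨b⟩ := exists_hermiteBasis hL.isLattice.fg (exists_smul_mem_of_isLattice hL.isLattice)
  apply Nat.finite_of_card_ne_zero
  intro h
  have := b.card_disc hN hL
  have hβ := b.β_pos
  have hδ := b.δ_pos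
  have hγ := b.γ_pos
  rw [h] at this
  have h2 : (0 : ℚ) < 2 * N ^ 3 * (b.β * b.δ * b.γ) ^ 2 := by positivity
  rw [← this] at h2
  simp at h2

end Discriminant
end RegTheta

namespace RegTheta

/-! ### Equivariance of the kernel and theta series over cosets. -/

section ThetaCoset

variable {N : ℕ} {L : Submodule ℤ V}

lemma pairXz_eq (X : V) (z : ℍ) : pairXz N X z = -N / (Real.sqrt N * z.im) *
    ((X.1 0 1 : ℝ) + 2 * z.re * X.1 0 0 - X.1 1 0 * (z.re ^ 2 + z.im ^ 2)) := by
  rw [pairXz, Matrix.trace_fin_two, Xz, Matrix.mul_apply, Matrix.mul_apply, Fin.sum_univ_two,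
    Fin.sum_univ_two]
  simp [V.apply_one_one]
  ring

lemma pairXz_eq' (hN : 0 < N) (X : V) (z : ℍ) : pairXz N X z = -Real.sqrt N *
    (((X.1 0 1 : ℝ) + 2 * z.re * X.1 0 0 - X.1 1 0 * (z.re ^ 2 + z.im ^ 2)) / z.im) := by
  have h : Real.sqrt N ≠ 0 := by positivity
  have := z.im_pos.ne'
  rw [pairXz_eq]
  field_simp
  rw [Real.sq_sqrt (Nat.cast_nonneg N)]

lemma coe_conj_apply (g : SL(2, ℤ)) (X : V) :
    (conj g X).1 0 0 = g.1 1 1 * (g.1 0 0 * X.1 0 0 + g.1 0 1 * X.1 1 0) -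
      g.1 1 0 * (g.1 0 0 * X.1 0 1 - g.1 0 1 * X.1 0 0) ∧
    (conj g X).1 0 1 = -g.1 0 1 * (g.1 0 0 * X.1 0 0 + g.1 0 1 * X.1 1 0) +
      g.1 0 0 * (g.1 0 0 * X.1 0 1 - g.1 0 1 * X.1 0 0) ∧
    (conj g X).1 1 0 = g.1 1 1 * (g.1 1 0 * X.1 0 0 + g.1 1 1 * X.1 1 0) -
      g.1 1 0 * (g.1 1 0 * X.1 0 1 - g.1 1 1 * X.1 0 0) := by
  rw [coe_conj]
  simp only [Matrix.mul_apply, Fin.sum_univ_two, ratMat, Matrix.map_apply,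
    Matrix.SpecialLinearGroup.coe_inv, Matrix.adjugate_fin_two, V.apply_one_one]
  simp
  refine ⟨?_, ?_, ?_⟩ <;> ring

/-- This is `X(g z) = g.X(z)` paired with `g.X`. The proof clears the factor `|cz + d|²`, which
multiplies `im (g z)`, `re (g z)` and `|g z|²` into polynomials in `re z` and `im z`. -/
lemma pairXz_conj (g : SL(2, ℤ)) (X : V) (z : ℍ) :
    pairXz N (conj g X) (g • z) = pairXz N X z := by
  obtain ⟨h1, h2, h3⟩ := coe_conj_apply g X
  have hdet : (g.1 0 0 : ℝ) * g.1 1 1 - g.1 0 1 * g.1 1 0 = 1 := by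
    have h := g.2
    rw [Matrix.det_fin_two] at h
    exact_mod_cast h
  have hj := jfac_ne_zero g z
  set D : ℝ := Complex.normSq (jfac g z) with hD
  have hD0 : 0 < D := Complex.normSq_pos.2 hj
  have hDe : D = (g.1 1 0 * z.re + g.1 1 1) ^ 2 + (g.1 1 0 * z.im) ^ 2 := by
    rw [hD, Complex.normSq_apply, jfac]
    simp
    ring
  have him : (g • z).im * D = z.im := by
    rw [im_smul_SL, hD, Complex.normSq_eq_norm_sq, div_mul_cancel₀]
    exact pow_ne_zero 2 (norm_ne_zero_iff.2 hj)
  have hw := coe_smul_mul_jfac g z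
  have hwre : (g • z).re * D = (g.1 0 0 * z.re + g.1 0 1) * (g.1 1 0 * z.re + g.1 1 1) +
      g.1 0 0 * g.1 1 0 * z.im ^ 2 := by
    have h : ((g • z : ℍ) : ℂ).re * D =
        (((g.1 0 0 : ℂ) * z + (g.1 0 1 : ℂ)) * (starRingEnd ℂ) (jfac g z)).re := by
      rw [← hw, mul_assoc, Complex.mul_conj, ← hD, Complex.re_mul_ofReal]
    refine h.trans ?_
    simp [jfac]
    ring
  have hnorm : ((g • z).re ^ 2 + (g • z).im ^ 2) * D =
      (g.1 0 0 * z.re + g.1 0 1) ^ 2 + (g.1 0 0 * z.im) ^ 2 := by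
    have h : ((g • z).re ^ 2 + (g • z).im ^ 2) * D =
        Complex.normSq ((g.1 0 0 : ℂ) * z + (g.1 0 1 : ℂ)) := by
      rw [← hw, map_mul, ← hD, Complex.normSq_apply, pow_two, pow_two]
      rfl
    rw [h, Complex.normSq_apply]
    simp
    ring
  have hz := z.im_pos.ne'
  have hgz := (g • z).im_pos.ne'
  rw [pairXz_eq, pairXz_eq, h1, h2, h3]
  have key : (((conj g X).1 0 1 : ℚ) + 2 * (g • z).re * ((conj g X).1 0 0 : ℚ) -
      ((conj g X).1 1 0 : ℚ) * ((g • z).re ^ 2 + (g • z).im ^ 2) : ℝ) * D =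
      (X.1 0 1 : ℝ) + 2 * z.re * X.1 0 0 - X.1 1 0 * (z.re ^ 2 + z.im ^ 2) := by
    have : (X.1 0 1 : ℝ) + 2 * z.re * X.1 0 0 - X.1 1 0 * (z.re ^ 2 + z.im ^ 2) =
      ((g.1 0 0 : ℝ) * g.1 1 1 - g.1 0 1 * g.1 1 0) ^ 2 *
      ((X.1 0 1 : ℝ) + 2 * z.re * X.1 0 0 - X.1 1 0 * (z.re ^ 2 + z.im ^ 2)) := by
      rw [hdet]; ring
    have expand : ∀ p q r : ℝ, (p + 2 * (g • z).re * q -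
        r * ((g • z).re ^ 2 + (g • z).im ^ 2)) * D = p * D + 2 * q * ((g • z).re * D) -
        r * (((g • z).re ^ 2 + (g • z).im ^ 2) * D) := fun p q r => by ring
    rw [this, expand, hnorm, hwre, hDe, h1, h2, h3]
    push_cast
    ring
  rw [h1, h2, h3] at key
  rw [← key, ← him]
  field_simp

lemma phi0_conj (g : SL(2, ℤ)) (X : V) (τ z : ℍ) :
    phi0 N (conj g X) τ (g • z) = phi0 N X τ z := by
  simp only [phi0, majorant, pairXz_conj, form_conj]

lemma toDisc_eq_iff (X : dual N L) (h : Disc N L) : toDisc N L X = h ↔ (X : V) - rep h ∈ L := by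
  conv_lhs => rw [← Quotient.out_eq h]
  exact Submodule.Quotient.eq _

lemma rep_mem_dual (h : Disc N L) : rep h ∈ dual N L := (Quotient.out h : dual N L).2

/-- The points of a coset of a lattice in Hermite coordinates. -/
def HermiteBasis.point (b : HermiteBasis L) (X₀ : V) (q : ℤ × ℤ × ℤ) : V :=
  X₀ + vec (q.2.1 * b.δ + q.2.2 * b.μ) (q.1 * b.β + q.2.1 * b.κ + q.2.2 * b.ν) (q.2.2 * b.γ)

lemma HermiteBasis.vec_injective (b : HermiteBasis L) {k m n k' m' n' : ℤ}
    (h : vec (m * b.δ + n * b.μ) (k * b.β + m * b.κ + n * b.ν) (n * b.γ) =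
      vec (m' * b.δ + n' * b.μ) (k' * b.β + m' * b.κ + n' * b.ν) (n' * b.γ)) :
    k = k' ∧ m = m' ∧ n = n' := by
  obtain ⟨h1, h2, h3⟩ := V.ext_iff'.1 h
  simp only [vec_apply_00, vec_apply_01, vec_apply_10] at h1 h2 h3
  have hn : n = n' := by exact_mod_cast mul_right_cancel₀ b.γ_pos.ne' h3
  subst hn
  have hm : m = m' := by exact_mod_cast mul_right_cancel₀ b.δ_pos.ne' (add_right_cancel h1)
  subst hm
  have hk : k = k' := by
    exact_mod_cast mul_right_cancel₀ b.β_pos.ne' (add_right_cancel (add_right_cancel h2))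
  exact ⟨hk, rfl, rfl⟩

/-- Parametrization of a coset in `L'/L` by means of a Hermite basis of `g⁻¹.L`. -/
def HermiteBasis.cosetEquiv {g : SL(2, ℤ)} (b : HermiteBasis (conjLattice g L))
    (hLd : L ≤ RegTheta.dual N L) (h : Disc N L) :
    ℤ × ℤ × ℤ ≃ {X : RegTheta.dual N L // toDisc N L X = h} := by
  have hmem : ∀ q : ℤ × ℤ × ℤ, conj g (b.point (conj g⁻¹ (rep h)) q) - rep h ∈ L := fun q => by
    rw [HermiteBasis.point, map_add, conj_conj_inv, add_sub_cancel_left]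
    exact b.vec_mem q.1 q.2.1 q.2.2
  have hmem' : ∀ q : ℤ × ℤ × ℤ, conj g (b.point (conj g⁻¹ (rep h)) q) ∈ RegTheta.dual N L := fun q => by
    have := (RegTheta.dual N L).add_mem (hLd (hmem q)) (rep_mem_dual h)
    rwa [sub_add_cancel] at this
  refine Equiv.ofBijective (fun q => ⟨⟨_, hmem' q⟩, (toDisc_eq_iff _ _).2 (hmem q)⟩) ⟨?_, ?_⟩
  · intro q q' hq
    have h1 : conj g (b.point (conj g⁻¹ (rep h)) q) = conj g (b.point (conj g⁻¹ (rep h)) q') :=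
      congrArg (fun X => (X.1 : V)) hq
    have h2 := congrArg (conj g⁻¹) h1
    rw [conj_inv_conj, conj_inv_conj] at h2
    obtain ⟨hk, hm, hn⟩ := b.vec_injective (add_left_cancel h2)
    exact Prod.ext hk (Prod.ext hm hn)
  · rintro ⟨X, hX⟩
    have hX' := (toDisc_eq_iff _ _).1 hX
    have : conj g⁻¹ ((X : V) - rep h) ∈ conjLattice g L := by
      rw [mem_conjLattice, conj_conj_inv]
      exact hX'
    obtain ⟨k, m, n, hk⟩ := (b.mem_iff _).1 this
    refine ⟨(k, m, n), ?_⟩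
    apply Subtype.ext
    apply Subtype.ext
    change conj g (b.point (conj g⁻¹ (rep h)) (k, m, n)) = X
    rw [HermiteBasis.point, ← hk, ← map_add, conj_conj_inv, add_sub_cancel]

lemma HermiteBasis.cosetEquiv_apply {g : SL(2, ℤ)} (b : HermiteBasis (conjLattice g L))
    (hLd : L ≤ RegTheta.dual N L) (h : Disc N L) (q : ℤ × ℤ × ℤ) :
    ((b.cosetEquiv hLd h q).1 : V) = conj g (b.point (conj g⁻¹ (rep h)) q) := rfl

/-- Equivariance moves `g` from the point to the lattice: the cusp becomes `∞` and `L` becomes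
`g⁻¹.L`, where a Hermite basis turns the coset into `ℤ³`. -/
theorem theta_smul_eq_tsum {g : SL(2, ℤ)} (b : HermiteBasis (conjLattice g L))
    (hLd : L ≤ dual N L) (τ z : ℍ) (h : Disc N L) :
    theta N L τ (g • z) h = ∑' q : ℤ × ℤ × ℤ, phi0 N (b.point (conj g⁻¹ (rep h)) q) τ z := by
  rw [theta, ← (b.cosetEquiv hLd h).tsum_eq]
  congr 1
  funext q
  rw [b.cosetEquiv_apply, phi0_conj]

/-- `Q` is constant modulo `ℤ` on a class of `L'/L`, so the chosen representative in the Weil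
representation does not matter. -/
lemma exists_quad_eq_add {X : V} {h : Disc N L} (hL : IsEvenLattice N L) (hX : X - rep h ∈ L) :
    ∃ n : ℤ, quad N X = quad N (rep h) + n := by
  obtain ⟨a, ha⟩ := hL.even _ hX
  obtain ⟨c, hc⟩ := mem_dual_iff.1 (rep_mem_dual h) _ hX
  refine ⟨a + c, ?_⟩
  have := quad_add (N := N) (rep h) (X - rep h)
  rw [add_sub_cancel, ha, hc] at this
  rw [this]
  push_cast
  ring

lemma exists_form_eq_add {X Y : V} {h h' : Disc N L} (hLd : L ≤ dual N L) (hX : X - rep h ∈ L)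
    (hY : Y - rep h' ∈ L) : ∃ n : ℤ, form N X Y = form N (rep h) (rep h') + n := by
  obtain ⟨a, ha⟩ := mem_dual_iff.1 (rep_mem_dual h) _ hY
  obtain ⟨c, hc⟩ := mem_dual_iff.1 (rep_mem_dual h') _ hX
  obtain ⟨d, hd⟩ := mem_dual_iff.1 (hLd hX) _ hY
  refine ⟨a + c + d, ?_⟩
  have e1 : form N X Y = form N (rep h) (rep h') + form N (X - rep h) (rep h') +
      (form N (rep h) (Y - rep h') + form N (X - rep h) (Y - rep h')) := by
    simp only [map_sub, LinearMap.sub_apply]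
    ring
  rw [e1, ha, form_comm (X - rep h) (rep h'), hc, hd]
  push_cast
  ring

end ThetaCoset

/-! ### Cusp invariants and finiteness of the set of cusps. -/

section CuspData

variable {N : ℕ} {L : Submodule ℤ V}

lemma HermiteBasis.smul_u0_mem_iff {g : SL(2, ℤ)} (b : HermiteBasis (conjLattice g L)) (q : ℚ) :
    q • conj g u0 ∈ L ↔ ∃ k : ℤ, q = k * b.β := by
  rw [← map_smul, ← mem_conjLattice, b.mem_iff]
  have h1 : ∀ i j, (q • u0).1 i j = q * u0.1 i j := fun i j => rfl
  constructor
  · rintro ⟨k, m, n, h⟩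
    obtain ⟨h00, h01, h10⟩ := V.ext_iff'.1 h
    simp only [h1, vec_apply_00, vec_apply_01, vec_apply_10] at h00 h01 h10
    simp [u0, b.γ_pos.ne'] at h10
    subst h10
    simp [u0, b.δ_pos.ne'] at h00
    subst h00
    simp [u0] at h01
    exact ⟨k, h01⟩
  · rintro ⟨k, rfl⟩
    refine ⟨k, 0, 0, V.ext_iff'.2 ⟨?_, ?_, ?_⟩⟩ <;> rw [h1] <;> simp [u0]

theorem HermiteBasis.cuspBeta_eq {g : SL(2, ℤ)} (b : HermiteBasis (conjLattice g L)) :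
    cuspBeta L g = b.β := by
  have hβ : (0 : ℝ) < b.β := by exact_mod_cast b.β_pos
  refine IsLeast.csInf_eq ⟨⟨hβ, b.β, rfl, (b.smul_u0_mem_iff _).2 ⟨1, by simp⟩⟩, ?_⟩
  rintro t ⟨ht, q, rfl, hq⟩
  obtain ⟨k, rfl⟩ := (b.smul_u0_mem_iff _).1 hq
  push_cast at ht ⊢
  have hk : (0 : ℝ) < k := pos_of_mul_pos_left ht hβ.le
  have hk1 : (1 : ℝ) ≤ k := by exact_mod_cast (by exact_mod_cast hk : 0 < k)
  exact le_mul_of_one_le_left hβ.le hk1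

/-- `Γ` has finite index, and distinct cusps give distinct cosets of `(σ c)⁻¹`: equal cosets would
give an element of `Γ` carrying one line to the other. -/
theorem finite_cusps {Γ : Subgroup SL(2, ℤ)} (hΓ : CongruenceSubgroup.IsCongruenceSubgroup Γ)
    {σ : Cusps N Γ → SL(2, ℤ)} (hσ : ∀ c, toCusp Γ (σ c • ell0 N) = c) : Finite (Cusps N Γ) := by
  have : Γ.FiniteIndex := hΓ.finiteIndex
  have : Finite (SL(2, ℤ) ⧸ Γ) := inferInstance
  refine Finite.of_injective (fun c => (((σ c)⁻¹ : SL(2, ℤ)) : SL(2, ℤ) ⧸ Γ)) fun c c' h => ?_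
  have h1 := QuotientGroup.eq.1 h
  rw [inv_inv] at h1
  rw [← hσ c, ← hσ c']
  refine Quotient.sound ?_
  change σ c • ell0 N ∈ MulAction.orbit Γ (σ c' • ell0 N)
  refine ⟨⟨_, h1⟩, ?_⟩
  change (σ c * (σ c')⁻¹) • (σ c' • ell0 N) = _
  rw [← mul_smul, inv_mul_cancel_right]

end CuspData
end RegTheta

namespace RegTheta

/-! ### The theta function of `K_ℓ` in Hermite coordinates. -/

section ThetaTilde

variable {N : ℕ} {L : Submodule ℤ V} {g : SL(2, ℤ)}

lemma mem_ell0_iff {X : V} : X ∈ (ell0 N).1 ↔ X.1 0 0 = 0 ∧ X.1 1 0 = 0 := by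
  rw [ell0, Submodule.mem_span_singleton]
  have h : ∀ (c : ℚ) i j, (c • u0).1 i j = c * u0.1 i j := fun c i j => rfl
  constructor
  · rintro ⟨c, rfl⟩
    constructor <;> rw [h] <;> simp [u0]
  · rintro ⟨h1, h2⟩
    refine ⟨X.1 0 1, V.ext_iff'.2 ⟨?_, ?_, ?_⟩⟩ <;> rw [h] <;> simp [u0, h1, h2]

lemma mem_smul_ell0_iff {X : V} :
    X ∈ (g • ell0 N).1 ↔ (conj g⁻¹ X).1 0 0 = 0 ∧ (conj g⁻¹ X).1 1 0 = 0 := by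
  rw [← mem_ell0_iff (N := N)]
  change X ∈ (ell0 N).1.map (conj g) ↔ _
  rw [Submodule.mem_map]
  constructor
  · rintro ⟨Y, hY, rfl⟩
    rwa [conj_inv_conj]
  · exact fun h => ⟨_, h, conj_conj_inv g X⟩

lemma mem_perp_smul_ell0_iff (hN : 0 < N) {X : V} :
    X ∈ perp N (g • ell0 N) ↔ (conj g⁻¹ X).1 1 0 = 0 := by
  have hN' : (N : ℚ) ≠ 0 := by exact_mod_cast hN.ne'
  rw [LinearMap.BilinForm.mem_orthogonal_iff]
  have key : ∀ Y : V, Y ∈ (g • ell0 N).1 →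
      form N Y X = N * (conj g⁻¹ Y).1 0 1 * (conj g⁻¹ X).1 1 0 := by
    intro Y hY
    obtain ⟨h1, h2⟩ := mem_smul_ell0_iff.1 hY
    rw [← form_conj N g⁻¹, form_apply, h1, h2]
    ring
  constructor
  · intro h
    have hu : conj g u0 ∈ (g • ell0 N).1 := by
      rw [mem_smul_ell0_iff, conj_inv_conj]
      simp [u0]
    have h1 : form N (conj g u0) X = 0 := h _ hu
    rw [key _ hu, conj_inv_conj] at h1
    simpa [u0, hN'] using h1
  · intro h Y hY
    change form N Y X = 0
    rw [key Y hY, h, mul_zero]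

lemma toW_eq_iff {X Y : perp N (g • ell0 N)} (hN : 0 < N) : toW (g • ell0 N) X = toW (g • ell0 N) Y ↔
    (conj g⁻¹ (X : V)).1 0 0 = (conj g⁻¹ (Y : V)).1 0 0 := by
  have h1 := (mem_perp_smul_ell0_iff hN).1 X.2
  have h2 := (mem_perp_smul_ell0_iff hN).1 Y.2
  rw [toW, toW, Submodule.Quotient.eq]
  change (X : V) - Y ∈ (g • ell0 N).1 ↔ _
  rw [mem_smul_ell0_iff, map_sub, V.sub_apply, V.sub_apply, h1, h2, sub_zero, sub_eq_zero]
  simp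

lemma quadW_toW (hN : 0 < N) (X : perp N (g • ell0 N)) :
    quadW (g • ell0 N) (toW (g • ell0 N) X) = N * (conj g⁻¹ (X : V)).1 0 0 ^ 2 := by
  set Y : perp N (g • ell0 N) := Quotient.out (toW (g • ell0 N) X) with hY
  have h : toW (g • ell0 N) Y = toW (g • ell0 N) X := Quotient.out_eq _
  rw [toW_eq_iff hN] at h
  change quad N (Y : V) = _
  rw [← quad_conj N g⁻¹, quad_apply, h, (mem_perp_smul_ell0_iff hN).1 Y.2]
  ring

/-- A vector of `ℓ^⊥` with given coordinates. -/
def perpVec (hN : 0 < N) (g : SL(2, ℤ)) (a b : ℚ) : perp N (g • ell0 N) :=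
  ⟨conj g (vec a b 0), (mem_perp_smul_ell0_iff hN).2 (by rw [conj_inv_conj, vec_apply_10])⟩

lemma conj_perpVec (hN : 0 < N) (a b : ℚ) :
    conj g⁻¹ (perpVec hN g a b : V) = vec a b 0 := conj_inv_conj _ _

lemma toW_mem_latK_iff (hN : 0 < N) (b : HermiteBasis (conjLattice g L))
    (X : perp N (g • ell0 N)) : toW (g • ell0 N) X ∈ latK L (g • ell0 N) ↔
      ∃ m : ℤ, (conj g⁻¹ (X : V)).1 0 0 = m * b.δ := by
  constructor
  · rintro ⟨Y, hY, hYX⟩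
    have hYL : (Y : V) ∈ L := hY
    have h1 := (toW_eq_iff hN).1 (show toW (g • ell0 N) Y = toW (g • ell0 N) X from hYX)
    have h2 := (mem_perp_smul_ell0_iff hN).1 Y.2
    have h3 : conj g⁻¹ (Y : V) ∈ conjLattice g L := by
      rwa [mem_conjLattice, conj_conj_inv]
    obtain ⟨k, m, n, h⟩ := (b.mem_iff _).1 h3
    rw [h, vec_apply_10] at h2
    have hn : n = 0 := by simpa [b.γ_pos.ne'] using h2
    subst hn
    refine ⟨m, ?_⟩
    rw [← h1, h]
    simp
  · rintro ⟨m, hm⟩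
    refine ⟨perpVec hN g (m * b.δ) (m * b.κ), ?_, ?_⟩
    · change conj g _ ∈ L
      have := b.vec_mem 0 m 0
      rw [mem_conjLattice] at this
      simpa using this
    · refine (toW_eq_iff hN).2 ?_
      rw [conj_perpVec, hm, vec_apply_00]

/-- After moving `ℓ` to `ℓ₀`, the upper left entry identifies `W_ℓ` with `ℚ`, with `Q = N a²` and
`K_ℓ = δ ℤ`. -/
lemma thetaK_toW (hN : 0 < N) (b : HermiteBasis (conjLattice g L)) (τ : ℍ)
    (X : perp N (g • ell0 N)) : thetaK L (g • ell0 N) τ (toW (g • ell0 N) X) =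
      ∑' m : ℤ, e (N * ((((conj g⁻¹ (X : V)).1 0 0 + m * b.δ : ℚ) : ℂ)) ^ 2 * τ) := by
  set x := (conj g⁻¹ (X : V)).1 0 0 with hx
  have hX : X = perpVec hN g x ((conj g⁻¹ (X : V)).1 0 1) := by
    apply Subtype.ext
    change (X : V) = conj g (vec _ _ 0)
    rw [← (mem_perp_smul_ell0_iff hN).1 X.2, hx, ← eq_vec, conj_conj_inv]
  have hmem : ∀ Y : perp N (g • ell0 N),
      toW (g • ell0 N) Y - toW (g • ell0 N) X ∈ latK L (g • ell0 N) ↔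
      ∃ m : ℤ, (conj g⁻¹ (Y : V)).1 0 0 = x + m * b.δ := by
    intro Y
    rw [show toW (g • ell0 N) Y - toW (g • ell0 N) X = toW (g • ell0 N) (Y - X) from rfl,
      toW_mem_latK_iff hN b]
    refine exists_congr fun m => ?_
    rw [show ((Y - X : perp N (g • ell0 N)) : V) = (Y : V) - X from rfl, map_sub, V.sub_apply,
      sub_eq_iff_eq_add', hx]
  let E : ℤ ≃ {w : Wspace N (g • ell0 N) // w - toW (g • ell0 N) X ∈ latK L (g • ell0 N)} := by
    refine Equiv.ofBijective (fun m => ⟨toW (g • ell0 N) (perpVec hN g (x + m * b.δ) 0),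
      (hmem _).2 ⟨m, by rw [conj_perpVec, vec_apply_00]⟩⟩) ⟨?_, ?_⟩
    · intro m m' h
      have h1 := (toW_eq_iff hN).1 (congrArg Subtype.val h)
      rw [conj_perpVec, conj_perpVec, vec_apply_00, vec_apply_00] at h1
      exact_mod_cast mul_right_cancel₀ b.δ_pos.ne' (add_left_cancel h1)
    · rintro ⟨w, hw⟩
      obtain ⟨Y, rfl⟩ : ∃ Y, toW (g • ell0 N) Y = w := ⟨Quotient.out w, Quotient.out_eq w⟩
      obtain ⟨m, hm⟩ := (hmem Y).1 hw
      refine ⟨m, Subtype.ext ((toW_eq_iff hN).2 ?_)⟩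
      rw [conj_perpVec, hm, vec_apply_00]
  rw [thetaK, ← E.tsum_eq]
  refine tsum_congr fun m => ?_
  have : quadW (g • ell0 N) (E m).1 = N * (x + m * b.δ) ^ 2 := by
    rw [show (E m).1 = toW (g • ell0 N) (perpVec hN g (x + m * b.δ) 0) from rfl, quadW_toW hN,
      conj_perpVec, vec_apply_00]
  rw [this]
  push_cast
  rfl

/-- The lower left entry vanishes for exactly one value of the second index, so the double sum is a
shifted single one. This form is independent of the representative `X` and matches the nondecaying
terms of the kernel. -/
lemma thetaK_eq_tsum (hN : 0 < N) (b : HermiteBasis (conjLattice g L)) (τ : ℍ) (h : Disc N L)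
    (X : perp N (g • ell0 N)) (hX : (X : V) ∈ dual N L) (hXh : toDisc N L ⟨X, hX⟩ = h) :
    thetaK L (g • ell0 N) τ (toW (g • ell0 N) X) = ∑' q : ℤ × ℤ,
      if (conj g⁻¹ (rep h)).1 1 0 + q.2 * b.γ = 0 then
        e (N * (((conj g⁻¹ (rep h)).1 0 0 + q.1 * b.δ + q.2 * b.μ : ℚ) : ℂ) ^ 2 * τ) else 0 := by
  have hXL := (toDisc_eq_iff _ _).1 hXh
  have h1 : conj g⁻¹ ((X : V) - rep h) ∈ conjLattice g L := by
    rwa [mem_conjLattice, conj_conj_inv]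
  obtain ⟨k, m, n, hk⟩ := (b.mem_iff _).1 h1
  rw [map_sub] at hk
  obtain ⟨hk1, -, hk3⟩ := V.ext_iff'.1 hk
  rw [V.sub_apply, vec_apply_00, sub_eq_iff_eq_add'] at hk1
  rw [V.sub_apply, vec_apply_10, (mem_perp_smul_ell0_iff hN).1 X.2] at hk3
  have hn : (conj g⁻¹ (rep h)).1 1 0 + n * b.γ = 0 := by rw [← hk3]; ring
  have hinj : Function.Injective fun j : ℤ => (j + m, n) := fun i j hij => by simpa using hij
  rw [thetaK_toW hN b, ← hinj.tsum_eq]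
  · refine tsum_congr fun j => ?_
    simp only [hn, if_true, hk1]
    push_cast
    ring_nf
  · intro q hq
    have hq' : (conj g⁻¹ (rep h)).1 1 0 + q.2 * b.γ = 0 := by
      by_contra hne
      simp [hne] at hq
    have : q.2 = n := by
      have := mul_right_cancel₀ b.γ_pos.ne' (add_left_cancel (hq'.trans hn.symm))
      exact_mod_cast this
    exact ⟨q.1 - m, by simp [← this]⟩

/-- If the class has no representative in `ℓ^⊥`, no index kills the lower left entry and the right
side is zero as well. -/
theorem thetaTilde_eq_tsum (hN : 0 < N) (hLd : L ≤ dual N L)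
    (b : HermiteBasis (conjLattice g L)) (τ : ℍ) (h : Disc N L) :
    thetaTilde L (g • ell0 N) τ h = ∑' q : ℤ × ℤ,
      if (conj g⁻¹ (rep h)).1 1 0 + q.2 * b.γ = 0 then
        e (N * (((conj g⁻¹ (rep h)).1 0 0 + q.1 * b.δ + q.2 * b.μ : ℚ) : ℂ) ^ 2 * τ) else 0 := by
  rw [thetaTilde]
  split_ifs with H
  · exact thetaK_eq_tsum hN b τ h H.choose H.choose_spec.choose H.choose_spec.choose_spec
  · symm
    refine (tsum_congr fun q => if_neg fun hq => H ?_).trans tsum_zero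
    refine ⟨perpVec hN g ((conj g⁻¹ (rep h)).1 0 0 + q.2 * b.μ)
      ((conj g⁻¹ (rep h)).1 0 1 + q.2 * b.ν), ?_⟩
    have hmem : (perpVec hN g ((conj g⁻¹ (rep h)).1 0 0 + q.2 * b.μ)
      ((conj g⁻¹ (rep h)).1 0 1 + q.2 * b.ν) : V) - rep h ∈ L := by
      rw [← conj_conj_inv g ((perpVec hN g _ _ : V) - rep h), ← mem_conjLattice, map_sub,
        conj_perpVec, b.mem_iff]
      refine ⟨0, 0, q.2, V.ext_iff'.2 ⟨?_, ?_, ?_⟩⟩ <;> rw [V.sub_apply] <;> simp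
      linarith
    have hd := (dual N L).add_mem (hLd hmem) (rep_mem_dual h)
    rw [sub_add_cancel] at hd
    exact ⟨hd, (toDisc_eq_iff _ _).2 hmem⟩

end ThetaTilde
end RegTheta

namespace RegTheta

/-! ### Complexified variables `u` and `v`. -/

section ParamDomain

/-- The quadratic form `|τ a - b|² / v`, continued to complex values of `u` and `v`. -/
def quadP (p : ℂ × ℂ) (a b : ℝ) : ℂ := (p.1 * a - b) ^ 2 / p.2 + p.2 * a ^ 2

/-- The coefficient of `a²` in the real part of `quadP`. -/
def quadA (p : ℂ × ℂ) : ℝ := (p.1 ^ 2 / p.2 + p.2).re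

/-- The coefficient of `-2 a b` in the real part of `quadP`. -/
def quadB (p : ℂ × ℂ) : ℝ := (p.1 / p.2).re

/-- The coefficient of `b²` in the real part of `quadP`. -/
def quadC (p : ℂ × ℂ) : ℝ := (1 / p.2).re

lemma quadP_re (p : ℂ × ℂ) (a b : ℝ) :
    (quadP p a b).re = quadA p * a ^ 2 - 2 * quadB p * (a * b) + quadC p * b ^ 2 := by
  have h : quadP p a b = (p.1 ^ 2 / p.2 + p.2) * ((a ^ 2 : ℝ) : ℂ) -
      (p.1 / p.2) * ((2 * (a * b) : ℝ) : ℂ) + (1 / p.2) * ((b ^ 2 : ℝ) : ℂ) := by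
    rw [quadP]
    push_cast
    ring
  rw [h, Complex.add_re, Complex.sub_re, Complex.re_mul_ofReal, Complex.re_mul_ofReal,
    Complex.re_mul_ofReal, quadA, quadB, quadC]
  ring

/-- A neighbourhood of the set of real pairs `(u, v)` with `v > 0`. -/
def paramDomain : Set (ℂ × ℂ) :=
  {p | 0 < p.2.re ∧ 0 < p.1.im + p.2.re ∧ 0 < quadA p * quadC p - quadB p ^ 2}

lemma paramDomain_snd_ne_zero {p : ℂ × ℂ} (hp : p ∈ paramDomain) : p.2 ≠ 0 := by
  intro h
  have := hp.1
  simp [h] at this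

lemma continuousAt_quad {p : ℂ × ℂ} (hp : p.2 ≠ 0) :
    ContinuousAt quadA p ∧ ContinuousAt quadB p ∧ ContinuousAt quadC p := by
  have h1 : ContinuousAt (fun q : ℂ × ℂ => q.1) p := continuousAt_fst
  have h2 : ContinuousAt (fun q : ℂ × ℂ => q.2) p := continuousAt_snd
  refine ⟨?_, ?_, ?_⟩
  · exact Complex.continuous_re.continuousAt.comp (((h1.pow 2).div h2 hp).add h2)
  · exact Complex.continuous_re.continuousAt.comp (h1.div h2 hp)
  · exact Complex.continuous_re.continuousAt.comp (continuousAt_const.div h2 hp)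

lemma isOpen_paramDomain : IsOpen paramDomain := by
  rw [isOpen_iff_mem_nhds]
  intro p hp
  obtain ⟨hA, hB, hC⟩ := continuousAt_quad (paramDomain_snd_ne_zero hp)
  have h1 : ContinuousAt (fun q : ℂ × ℂ => q.2.re) p :=
    Complex.continuous_re.continuousAt.comp continuousAt_snd
  have h2 : ContinuousAt (fun q : ℂ × ℂ => q.1.im + q.2.re) p :=
    (Complex.continuous_im.continuousAt.comp continuousAt_fst).add h1
  filter_upwards [h1.eventually_const_lt hp.1, h2.eventually_const_lt hp.2.1,
    ((hA.mul hC).sub (hB.pow 2)).eventually_const_lt hp.2.2] with q h1 h2 h3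
  exact ⟨h1, h2, h3⟩

lemma quad_pos {p : ℂ × ℂ} (hp : p ∈ paramDomain) : 0 < quadA p ∧ 0 < quadC p := by
  have hC : 0 < quadC p := by
    rw [quadC, one_div, Complex.inv_re]
    exact div_pos hp.1 (Complex.normSq_pos.2 (paramDomain_snd_ne_zero hp))
  have := hp.2.2
  exact ⟨pos_of_mul_pos_left (by nlinarith [sq_nonneg (quadB p)]) hC.le, hC⟩

/-- The smallest eigenvalue of a positive definite binary form is at least determinant over trace;
the difference of the two sides, times the trace, is the sum of the two squares used below. -/
lemma le_quadP_re {p : ℂ × ℂ} (hp : p ∈ paramDomain) (a b : ℝ) :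
    (quadA p * quadC p - quadB p ^ 2) / (quadA p + quadC p) * (a ^ 2 + b ^ 2) ≤
      (quadP p a b).re := by
  obtain ⟨hA, hC⟩ := quad_pos hp
  rw [quadP_re, div_mul_eq_mul_div, div_le_iff₀ (by positivity)]
  nlinarith [sq_nonneg (quadA p * a - quadB p * b), sq_nonneg (quadB p * a - quadC p * b)]

/-- The conditions defining `paramDomain` make `Re quadP` positive definite and give `|e(N (u + iv)
x²)|` Gaussian decay in `x`. Both are open, and half of each constant at `p` works nearby. -/
lemma exists_bound_paramDomain {p : ℂ × ℂ} (hp : p ∈ paramDomain) : ∃ c : ℝ, 0 < c ∧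
    ∀ᶠ q in 𝓝 p, q ∈ paramDomain ∧ c ≤ q.1.im + q.2.re ∧
      ∀ a b : ℝ, c * (a ^ 2 + b ^ 2) ≤ (quadP q a b).re := by
  obtain ⟨hA, hB, hC⟩ := continuousAt_quad (paramDomain_snd_ne_zero hp)
  obtain ⟨hA0, hC0⟩ := quad_pos hp
  have h2 : ContinuousAt (fun q : ℂ × ℂ => q.1.im + q.2.re) p :=
    (Complex.continuous_im.continuousAt.comp continuousAt_fst).add
      (Complex.continuous_re.continuousAt.comp continuousAt_snd)
  have h3 := ((hA.mul hC).sub (hB.pow 2)).div (hA.add hC) (by simp; positivity)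
  set d : ℝ := (quadA p * quadC p - quadB p ^ 2) / (quadA p + quadC p) with hd
  have hd0 : 0 < d := div_pos hp.2.2 (by positivity)
  refine ⟨min ((p.1.im + p.2.re) / 2) (d / 2), lt_min (half_pos hp.2.1) (half_pos hd0), ?_⟩
  filter_upwards [isOpen_paramDomain.mem_nhds hp, h2.eventually_const_lt (half_lt_self hp.2.1),
    h3.eventually_const_lt (half_lt_self hd0)] with q hq hq2 hq3
  refine ⟨hq, (min_le_left _ _).trans hq2.le, fun a b => le_trans ?_ (le_quadP_re hq a b)⟩
  exact mul_le_mul_of_nonneg_right ((min_le_right _ _).trans hq3.le) (by positivity)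

lemma ofReal_mem_paramDomain {u v : ℝ} (hv : 0 < v) : ((u : ℂ), (v : ℂ)) ∈ paramDomain := by
  have hA : quadA ((u : ℂ), (v : ℂ)) = u ^ 2 / v + v := by
    simp only [quadA]
    exact_mod_cast Complex.ofReal_re _
  have hB : quadB ((u : ℂ), (v : ℂ)) = u / v := by
    simp only [quadB]
    exact_mod_cast Complex.ofReal_re _
  have hC : quadC ((u : ℂ), (v : ℂ)) = 1 / v := by
    simp only [quadC]
    exact_mod_cast Complex.ofReal_re _
  refine ⟨by simpa using hv, by simpa using hv, ?_⟩
  rw [hA, hB, hC]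
  have : (u ^ 2 / v + v) * (1 / v) - (u / v) ^ 2 = 1 := by
    field_simp
    ring
  rw [this]
  exact one_pos

end ParamDomain

/-! ### Holomorphic series in several variables. -/

section TsumHolomorphic

/-- A locally dominated sum of holomorphic functions of several variables is holomorphic. -/
lemma differentiableOn_tsum_of_locally_dominated {E ι : Type*} [NormedAddCommGroup E]
    [NormedSpace ℂ E] [FiniteDimensional ℂ E] [Countable ι] {U : Set E} (hU : IsOpen U)
    {g : E → ι → ℂ} (hdiff : ∀ i, DifferentiableOn ℂ (fun q => g q i) U)
    (hb : ∀ p ∈ U, ∃ u : ι → ℝ, Summable u ∧ ∀ᶠ q in 𝓝 p, ∀ i, ‖g q i‖ ≤ u i) :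
    DifferentiableOn ℂ (fun q => ∑' i, g q i) U := by
  -- The sum is treated as an integral against counting measure.
  let _ : MeasurableSpace ι := ⊤
  have : MeasurableSingletonClass ι := ⟨fun _ => trivial⟩
  have h := differentiableOn_integral_of_locally_dominated (μ := Measure.count (α := ι)) hU
    (g := g) (fun q _ => (measurable_of_countable _).aestronglyMeasurable)
    (ae_of_all _ hdiff) (fun p hp => by
      obtain ⟨u, hu, h⟩ := hb p hp
      refine ⟨u, _, h, ?_, ae_of_all _ fun i q hq => hq i⟩
      rw [integrable_count_iff]
      exact hu.norm)
  refine h.congr fun q hq => ?_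
  obtain ⟨u, hu, h⟩ := hb q hq
  have hs : Summable fun i => ‖g q i‖ :=
    Summable.of_nonneg_of_le (fun _ => norm_nonneg _) h.self_of_nhds hu
  rw [integral_countable (integrable_count_iff.2 hs)]
  simp

end TsumHolomorphic

/-! ### Convergence of Gaussian sums over integer lattices. -/

section GaussianSums

lemma summable_exp_neg_sq {a : ℝ} (ha : 0 < a) : Summable fun n : ℤ => Real.exp (-a * (n : ℝ) ^ 2) := by
  have h := (summable_jacobiTheta₂_term_iff 0 (Complex.I * (a / Real.pi : ℝ))).2 (by
    simp
    positivity)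
  refine h.norm.congr fun n => ?_
  rw [norm_jacobiTheta₂_term]
  congr 1
  simp
  field_simp

lemma summable_exp_neg_sq_prod {a : ℝ} (ha : 0 < a) :
    Summable fun q : ℤ × ℤ => Real.exp (-a * ((q.1 : ℝ) ^ 2 + (q.2 : ℝ) ^ 2)) := by
  have h := (summable_exp_neg_sq ha).mul_of_nonneg (summable_exp_neg_sq ha)
    (fun _ => (Real.exp_pos _).le) (fun _ => (Real.exp_pos _).le)
  refine h.congr fun q => ?_
  rw [← Real.exp_add]
  ring_nf

lemma summable_exp_neg_sq_prod₃ {a : ℝ} (ha : 0 < a) : Summable fun q : ℤ × ℤ × ℤ =>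
    Real.exp (-a * ((q.1 : ℝ) ^ 2 + (q.2.1 : ℝ) ^ 2 + (q.2.2 : ℝ) ^ 2)) := by
  have h := (summable_exp_neg_sq ha).mul_of_nonneg (summable_exp_neg_sq_prod ha)
    (fun _ => (Real.exp_pos _).le) (fun _ => (Real.exp_pos _).le)
  refine h.congr fun q => ?_
  rw [← Real.exp_add]
  ring_nf

end GaussianSums
end RegTheta

namespace RegTheta

/-! ### The expansion along a cusp and its bounds. -/

section MixedSeries

variable {Λ : Submodule ℤ V}

/-- The upper left entry of the points of a coset. -/
def HermiteBasis.diag (b : HermiteBasis Λ) (X₀ : V) (q : ℤ × ℤ) : ℝ :=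
  ((X₀.1 0 0 + q.1 * b.δ + q.2 * b.μ : ℚ) : ℝ)

/-- The upper right entry of the points of a coset, for `k = 0`. -/
def HermiteBasis.upper (b : HermiteBasis Λ) (X₀ : V) (q : ℤ × ℤ) : ℝ :=
  ((X₀.1 0 1 + q.1 * b.κ + q.2 * b.ν : ℚ) : ℝ)

/-- The lower left entry of the points of a coset. -/
def HermiteBasis.lower (b : HermiteBasis Λ) (X₀ : V) (q : ℤ × ℤ) : ℝ :=
  ((X₀.1 1 0 + q.2 * b.γ : ℚ) : ℝ)

/-- The terms of the Fourier expansion of the theta function along a cusp. -/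
def mixedTerm (N : ℕ) (b : HermiteBasis Λ) (X₀ : V) (p : ℂ × ℂ) (z : ℍ) (i : (ℤ × ℤ) × ℤ) : ℂ :=
  Complex.exp (2 * Real.pi * Complex.I * ((i.2 * (b.upper X₀ i.1 + 2 * z.re * b.diag X₀ i.1 -
    z.re ^ 2 * b.lower X₀ i.1) / b.β : ℝ) : ℂ)) *
  Complex.exp (2 * Real.pi * Complex.I * N * (p.1 + Complex.I * p.2) *
    ((b.diag X₀ i.1 - z.re * b.lower X₀ i.1 : ℝ) : ℂ) ^ 2) *
  Complex.exp (-(Real.pi * N * (z.im : ℂ) ^ 2 * quadP p (b.lower X₀ i.1) (i.2 / (b.β * N))))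

/-- The terms that do not decay along the cusp. -/
def mainTerm (N : ℕ) (b : HermiteBasis Λ) (X₀ : V) (p : ℂ × ℂ) (q : ℤ × ℤ) : ℂ :=
  Complex.exp (2 * Real.pi * Complex.I * N * (p.1 + Complex.I * p.2) * (b.diag X₀ q : ℂ) ^ 2)

lemma norm_exp_imag_mul (N : ℕ) (p : ℂ × ℂ) (x : ℝ) :
    ‖Complex.exp (2 * Real.pi * Complex.I * N * (p.1 + Complex.I * p.2) * (x : ℂ) ^ 2)‖ =
      Real.exp (-(Real.pi * N * (2 * (p.1.im + p.2.re) * x ^ 2))) := by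
  rw [Complex.norm_exp]
  congr 1
  rw [show 2 * (Real.pi : ℂ) * Complex.I * N * (p.1 + Complex.I * p.2) * (x : ℂ) ^ 2 =
    (Complex.I * (p.1 + Complex.I * p.2)) * ((2 * Real.pi * N * x ^ 2 : ℝ) : ℂ) by push_cast; ring,
    Complex.re_mul_ofReal]
  simp
  ring

lemma norm_mixedTerm (N : ℕ) (b : HermiteBasis Λ) (X₀ : V) (p : ℂ × ℂ) (z : ℍ)
    (i : (ℤ × ℤ) × ℤ) : ‖mixedTerm N b X₀ p z i‖ =
      Real.exp (-(Real.pi * N * (2 * (p.1.im + p.2.re) *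
        (b.diag X₀ i.1 - z.re * b.lower X₀ i.1) ^ 2 +
        z.im ^ 2 * (quadP p (b.lower X₀ i.1) (i.2 / (b.β * N))).re))) := by
  rw [mixedTerm, norm_mul, norm_mul, norm_exp_imag_mul, mul_right_comm (2 * (Real.pi : ℂ)),
    mul_comm _ Complex.I, mul_comm (2 * (Real.pi : ℂ))]
  have h1 : ∀ x : ℝ, ‖Complex.exp (Complex.I * (x : ℂ) * (2 * Real.pi))‖ = 1 := fun x => by
    rw [Complex.norm_exp]
    simp
  rw [show ∀ x : ℂ, Complex.I * (x * (2 * (Real.pi : ℂ))) = Complex.I * x * (2 * Real.pi) from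
    fun x => by ring, h1, one_mul, Complex.norm_exp, ← Real.exp_add]
  congr 1
  rw [show Real.pi * N * (z.im : ℂ) ^ 2 * quadP p (b.lower X₀ i.1) (i.2 / (b.β * N)) =
    quadP p (b.lower X₀ i.1) (i.2 / (b.β * N)) * ((Real.pi * N * z.im ^ 2 : ℝ) : ℂ) by
      push_cast; ring, Complex.neg_re, Complex.re_mul_ofReal]
  ring

lemma HermiteBasis.exists_sq_le (b : HermiteBasis Λ) (X₀ : V) : ∃ K : ℝ, 0 < K ∧
    ∀ q : ℤ × ℤ, (q.1 : ℝ) ^ 2 + (q.2 : ℝ) ^ 2 ≤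
      K * (b.diag X₀ q ^ 2 + b.lower X₀ q ^ 2 + 1) := by
  have hδ : (0 : ℝ) < b.δ := by exact_mod_cast b.δ_pos
  have hγ : (0 : ℝ) < b.γ := by exact_mod_cast b.γ_pos
  set x₁ : ℝ := ((X₀.1 0 0 : ℚ) : ℝ)
  set x₃ : ℝ := ((X₀.1 1 0 : ℚ) : ℝ)
  set K₃ : ℝ := 2 * (1 + x₃ ^ 2) / b.γ ^ 2 with hK₃
  set K₁ : ℝ := 3 * (1 + x₁ ^ 2 + b.μ ^ 2 * K₃) / b.δ ^ 2 with hK₁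
  have hK₃0 : 0 < K₃ := by positivity
  have hK₁0 : 0 < K₁ := by positivity
  refine ⟨K₁ + K₃, by positivity, fun q => ?_⟩
  have h1 : b.diag X₀ q = x₁ + q.1 * b.δ + q.2 * b.μ := by simp [diag, x₁]
  have h3 : b.lower X₀ q = x₃ + q.2 * b.γ := by simp [lower, x₃]
  set d := b.diag X₀ q
  set l := b.lower X₀ q
  set S := d ^ 2 + l ^ 2 + 1
  have hS : 1 ≤ S := by nlinarith [sq_nonneg d, sq_nonneg l]
  have hn : (q.2 : ℝ) ^ 2 ≤ K₃ * S := by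
    rw [hK₃, div_mul_eq_mul_div, le_div_iff₀ (by positivity)]
    have : (q.2 : ℝ) ^ 2 * b.γ ^ 2 = (l - x₃) ^ 2 := by rw [h3]; ring
    rw [this]
    nlinarith [sq_nonneg (l + x₃), sq_nonneg d, mul_nonneg (sq_nonneg x₃) (sub_nonneg.2 hS)]
  have hm : (q.1 : ℝ) ^ 2 ≤ K₁ * S := by
    rw [hK₁, div_mul_eq_mul_div, le_div_iff₀ (by positivity)]
    have : (q.1 : ℝ) ^ 2 * b.δ ^ 2 = (d - x₁ - q.2 * b.μ) ^ 2 := by rw [h1]; ring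
    rw [this]
    have h4 : (d - x₁ - q.2 * b.μ) ^ 2 ≤ 3 * (d ^ 2 + x₁ ^ 2 + b.μ ^ 2 * (q.2 : ℝ) ^ 2) := by
      nlinarith [sq_nonneg (d + x₁), sq_nonneg (d + q.2 * b.μ), sq_nonneg (x₁ - q.2 * b.μ)]
    have h5 : (b.μ : ℝ) ^ 2 * (q.2 : ℝ) ^ 2 ≤ (b.μ : ℝ) ^ 2 * (K₃ * S) :=
      mul_le_mul_of_nonneg_left hn (sq_nonneg _)
    nlinarith [mul_nonneg (sq_nonneg x₁) (sub_nonneg.2 hS), sq_nonneg l]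
  linarith

/-- The shear by `x` is bounded on the strip, so the sheared forms control the indices uniformly.
The weight `1/8` is what half of `y² ≥ 1/4` leaves in `exists_mixedTerm_bound`. -/
lemma HermiteBasis.exists_sq_le_strip {N : ℕ} (hN : 0 < N) (b : HermiteBasis Λ) (X₀ : V) (B : ℝ) :
    ∃ W : ℝ, 0 < W ∧ ∀ x : ℝ, |x| ≤ B → ∀ i : (ℤ × ℤ) × ℤ,
      (i.1.1 : ℝ) ^ 2 + (i.1.2 : ℝ) ^ 2 + (i.2 : ℝ) ^ 2 ≤
        W * (2 * (b.diag X₀ i.1 - x * b.lower X₀ i.1) ^ 2 +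
          (b.lower X₀ i.1 ^ 2 + (i.2 / (b.β * N)) ^ 2) / 8 + 1) := by
  obtain ⟨K, hK, h⟩ := b.exists_sq_le X₀
  have hβ : (0 : ℝ) < b.β := by exact_mod_cast b.β_pos
  have hN' : (0 : ℝ) < N := by exact_mod_cast hN
  refine ⟨K + 8 * K * (2 * B ^ 2 + 1) + 8 * (b.β * N) ^ 2, by positivity, fun x hx i => ?_⟩
  have h1 := h i.1
  set d := b.diag X₀ i.1
  set l := b.lower X₀ i.1
  set ξ := d - x * l with hξ
  set j : ℝ := i.2 / (b.β * N) with hj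
  have hj2 : (i.2 : ℝ) ^ 2 = (b.β * N) ^ 2 * j ^ 2 := by rw [hj]; field_simp
  have hx2 : x ^ 2 ≤ B ^ 2 := sq_le_sq' (abs_le.1 hx).1 (abs_le.1 hx).2
  have hd : d ^ 2 ≤ 2 * ξ ^ 2 + 2 * B ^ 2 * l ^ 2 := by
    have : d = ξ + x * l := by rw [hξ]; ring
    rw [this]
    nlinarith [sq_nonneg (ξ - x * l), mul_le_mul_of_nonneg_right hx2 (sq_nonneg l)]
  rw [hj2]
  have e1 : K * (d ^ 2 + l ^ 2 + 1) ≤ K * (2 * ξ ^ 2 + (2 * B ^ 2 + 1) * l ^ 2 + 1) :=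
    mul_le_mul_of_nonneg_left (by linarith) hK.le
  have p1 : 0 ≤ K * l ^ 2 := by positivity
  have p2 : 0 ≤ K * j ^ 2 := by positivity
  have p3 : 0 ≤ K * (2 * B ^ 2 + 1) * (16 * ξ ^ 2 + j ^ 2 + 8) := by positivity
  have p4 : 0 ≤ (b.β * N : ℝ) ^ 2 * (16 * ξ ^ 2 + l ^ 2 + 8) := by positivity
  nlinarith

/-- Discreteness: the lower left entries are integral multiples of `γ` over a fixed denominator, and
the frequencies are multiples of `1 / (β N)`. A pair that is not zero is bounded away from zero. -/
lemma HermiteBasis.exists_le_lower_sq {N : ℕ} (hN : 0 < N) (b : HermiteBasis Λ) (X₀ : V) :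
    ∃ ρ : ℝ, 0 < ρ ∧ ∀ i : (ℤ × ℤ) × ℤ, ¬(b.lower X₀ i.1 = 0 ∧ i.2 = 0) →
      ρ ≤ b.lower X₀ i.1 ^ 2 + (i.2 / (b.β * N)) ^ 2 := by
  have hβ : (0 : ℝ) < b.β := by exact_mod_cast b.β_pos
  have hγ : (0 : ℝ) < b.γ := by exact_mod_cast b.γ_pos
  have hN' : (0 : ℝ) < N := by exact_mod_cast hN
  set r : ℚ := X₀.1 1 0 / b.γ with hr
  have hden : (0 : ℝ) < r.den := by exact_mod_cast r.den_pos
  refine ⟨min ((b.γ / r.den) ^ 2) ((1 / (b.β * N)) ^ 2), lt_min (by positivity) (by positivity),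
    fun i hi => ?_⟩
  by_cases hj : i.2 = 0
  · have hl : b.lower X₀ i.1 ≠ 0 := fun h => hi ⟨h, hj⟩
    refine (min_le_left _ _).trans (le_add_of_le_of_nonneg ?_ (sq_nonneg _))
    have e1 : X₀.1 1 0 + i.1.2 * b.γ = b.γ / r.den * ((r.num + i.1.2 * r.den : ℤ) : ℚ) := by
      have h2 : (r.num : ℚ) = r * r.den := (Rat.mul_den_eq_num r).symm
      have h3 : (r.den : ℚ) ≠ 0 := by exact_mod_cast r.den_nz
      have h4 : X₀.1 1 0 = r * b.γ := by
        rw [hr, div_mul_cancel₀ _ b.γ_pos.ne']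
      push_cast
      rw [h2, h4]
      field_simp
    have e2 : b.lower X₀ i.1 = b.γ / r.den * ((r.num + i.1.2 * r.den : ℤ) : ℝ) := by
      rw [lower, e1]
      push_cast
      ring
    have h0 : r.num + i.1.2 * (r.den : ℤ) ≠ 0 := by
      intro h
      rw [e2, h] at hl
      simp at hl
    rw [e2, mul_pow]
    refine le_mul_of_one_le_right (sq_nonneg _) ?_
    have : (1 : ℤ) ≤ (r.num + i.1.2 * (r.den : ℤ)) ^ 2 := by
      have := sq_pos_of_ne_zero h0
      omega
    exact_mod_cast this
  · refine (min_le_right _ _).trans (le_add_of_nonneg_of_le (sq_nonneg _) ?_)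
    rw [div_pow, div_pow]
    refine div_le_div_of_nonneg_right ?_ (sq_nonneg _)
    have : (1 : ℤ) ≤ i.2 ^ 2 := by
      have := sq_pos_of_ne_zero hj
      omega
    rw [one_pow]
    exact_mod_cast this

/-- The exponent contains `y²` times a form that is at least `ρ` on the decaying terms. One half of
it yields `exp (-c y²)`; the other half, with `y² ≥ 1/4` and the term in `ξ²`, yields a summable
Gaussian majorant independent of `z`. -/
theorem exists_mixedTerm_bound {N : ℕ} (hN : 0 < N) (b : HermiteBasis Λ) (X₀ : V) {p : ℂ × ℂ}
    (hp : p ∈ paramDomain) (B : ℝ) : ∃ c : ℝ, 0 < c ∧ ∃ u : (ℤ × ℤ) × ℤ → ℝ, Summable u ∧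
      ∀ᶠ q in 𝓝 p, ∀ z : ℍ, |z.re| ≤ B → 1 / 2 ≤ z.im → ∀ i : (ℤ × ℤ) × ℤ,
        ¬(b.lower X₀ i.1 = 0 ∧ i.2 = 0) →
          ‖mixedTerm N b X₀ q z i‖ ≤ Real.exp (-c * z.im ^ 2) * u i := by
  obtain ⟨c, hc, hq⟩ := exists_bound_paramDomain hp
  obtain ⟨ρ, hρ, hρl⟩ := b.exists_le_lower_sq hN X₀
  obtain ⟨W, hW, hWl⟩ := b.exists_sq_le_strip hN X₀ B
  have hN' : (0 : ℝ) < N := by exact_mod_cast hN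
  set C : ℝ := Real.pi * N * c with hC
  have hC0 : 0 < C := by positivity
  refine ⟨C * ρ / 2, by positivity, fun i => Real.exp C * Real.exp (-(C / W) *
    ((i.1.1 : ℝ) ^ 2 + (i.1.2 : ℝ) ^ 2 + (i.2 : ℝ) ^ 2)), ?_, ?_⟩
  · refine Summable.mul_left _ ?_
    rw [← (Equiv.prodAssoc ℤ ℤ ℤ).symm.summable_iff]
    refine (summable_exp_neg_sq_prod₃ (div_pos hC0 hW)).congr fun q => ?_
    rfl
  · filter_upwards [hq] with q hq z hx hy i hi
    obtain ⟨-, hq1, hq2⟩ := hq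
    rw [norm_mixedTerm, ← Real.exp_add, ← Real.exp_add, Real.exp_le_exp]
    have h1 := hρl i hi
    have h2 := hWl z.re hx i
    have h3 := hq2 (b.lower X₀ i.1) (i.2 / (b.β * N))
    set ξ := b.diag X₀ i.1 - z.re * b.lower X₀ i.1
    set s := b.lower X₀ i.1 ^ 2 + (i.2 / (b.β * N)) ^ 2
    set m := (i.1.1 : ℝ) ^ 2 + (i.1.2 : ℝ) ^ 2 + (i.2 : ℝ) ^ 2
    have hy2 : (1 / 4 : ℝ) ≤ z.im ^ 2 := by nlinarith
    have h4 : C / W * m ≤ C * (2 * ξ ^ 2 + s / 8 + 1) := by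
      rw [div_mul_eq_mul_div, div_le_iff₀ hW]
      nlinarith
    have h5 : C * (2 * ξ ^ 2 + z.im ^ 2 * s) ≤ Real.pi * N * (2 * (q.1.im + q.2.re) * ξ ^ 2 +
        z.im ^ 2 * (quadP q (b.lower X₀ i.1) (i.2 / (b.β * N))).re) := by
      rw [hC, mul_assoc (Real.pi * N)]
      refine mul_le_mul_of_nonneg_left ?_ (by positivity)
      have e1 := mul_le_mul_of_nonneg_right hq1 (sq_nonneg ξ)
      have e2 := mul_le_mul_of_nonneg_left h3 (sq_nonneg z.im)
      linarith
    have h6 : s / 8 + z.im ^ 2 * ρ / 2 ≤ z.im ^ 2 * s := by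
      have e1 := mul_le_mul_of_nonneg_left h1 (sq_nonneg z.im)
      have e2 := mul_le_mul_of_nonneg_right hy2 (hρ.le.trans h1)
      linarith
    have h7 := mul_le_mul_of_nonneg_left h6 hC0.le
    linarith

/-- On indices with vanishing lower left entry the diagonal entry alone controls both integers. -/
theorem exists_mainTerm_bound {N : ℕ} (hN : 0 < N) (b : HermiteBasis Λ) (X₀ : V) {p : ℂ × ℂ}
    (hp : p ∈ paramDomain) : ∃ u : ℤ × ℤ → ℝ, Summable u ∧ ∀ᶠ r in 𝓝 p, ∀ q : ℤ × ℤ,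
        b.lower X₀ q = 0 → ‖mainTerm N b X₀ r q‖ ≤ u q := by
  obtain ⟨c, hc, hr⟩ := exists_bound_paramDomain hp
  obtain ⟨K, hK, hKl⟩ := b.exists_sq_le X₀
  have hN' : (0 : ℝ) < N := by exact_mod_cast hN
  set C : ℝ := Real.pi * N * (2 * c) with hC
  have hC0 : 0 < C := by positivity
  refine ⟨fun q => Real.exp C * Real.exp (-(C / K) * ((q.1 : ℝ) ^ 2 + (q.2 : ℝ) ^ 2)),
    (summable_exp_neg_sq_prod (div_pos hC0 hK)).mul_left _, ?_⟩
  filter_upwards [hr] with r hr q hq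
  obtain ⟨-, hr1, -⟩ := hr
  rw [mainTerm, norm_exp_imag_mul, ← Real.exp_add, Real.exp_le_exp]
  have h1 := hKl q
  rw [hq] at h1
  set d := b.diag X₀ q
  set m := (q.1 : ℝ) ^ 2 + (q.2 : ℝ) ^ 2
  have h4 : C / K * m ≤ C * (d ^ 2 + 1) := by
    rw [div_mul_eq_mul_div, div_le_iff₀ hK]
    nlinarith
  have h5 : C * d ^ 2 ≤ Real.pi * N * (2 * (r.1.im + r.2.re) * d ^ 2) := by
    rw [hC, mul_assoc (Real.pi * N)]
    refine mul_le_mul_of_nonneg_left ?_ (by positivity)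
    have e1 := mul_le_mul_of_nonneg_right hr1 (sq_nonneg d)
    linarith
  linarith

open Classical in
/-- The sum of the terms that decay along the cusp. -/
def decayPart (N : ℕ) (b : HermiteBasis Λ) (X₀ : V) (p : ℂ × ℂ) (z : ℍ) : ℂ :=
  ∑' i : (ℤ × ℤ) × ℤ, if b.lower X₀ i.1 = 0 ∧ i.2 = 0 then 0 else mixedTerm N b X₀ p z i

open Classical in
/-- The sum of the terms that do not decay along the cusp. -/
def mainPart (N : ℕ) (b : HermiteBasis Λ) (X₀ : V) (p : ℂ × ℂ) : ℂ :=
  ∑' q : ℤ × ℤ, if b.lower X₀ q = 0 then mainTerm N b X₀ p q else 0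

lemma differentiableOn_mixedTerm (N : ℕ) (b : HermiteBasis Λ) (X₀ : V) (z : ℍ)
    (i : (ℤ × ℤ) × ℤ) : DifferentiableOn ℂ (fun p => mixedTerm N b X₀ p z i) paramDomain := by
  intro p hp
  have hp2 := paramDomain_snd_ne_zero hp
  have h1 : DifferentiableAt ℂ (fun q : ℂ × ℂ => q.1) p := differentiableAt_fst
  have h2 : DifferentiableAt ℂ (fun q : ℂ × ℂ => q.2) p := differentiableAt_snd
  have h3 : DifferentiableAt ℂ (fun q : ℂ × ℂ =>
      quadP q (b.lower X₀ i.1) (i.2 / (b.β * N))) p := by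
    simp only [quadP, div_eq_mul_inv]
    exact ((((h1.mul_const _).sub_const _).pow 2).mul (h2.inv hp2)).add (h2.mul_const _)
  refine DifferentiableAt.differentiableWithinAt ?_
  unfold mixedTerm
  refine ((differentiableAt_const _).mul ?_).mul ?_
  · exact (((h1.add (h2.const_mul _)).const_mul _).mul_const _).cexp
  · exact (h3.const_mul _).neg.cexp

lemma differentiableOn_mainPart {N : ℕ} (hN : 0 < N) (b : HermiteBasis Λ) (X₀ : V) :
    DifferentiableOn ℂ (mainPart N b X₀) paramDomain := by
  classical
  refine differentiableOn_tsum_of_locally_dominated isOpen_paramDomain (fun q => ?_) fun p hp => ?_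
  · split_ifs
    · have : Differentiable ℂ fun p : ℂ × ℂ => mainTerm N b X₀ p q := by
        unfold mainTerm
        exact (((differentiable_fst.add (differentiable_snd.const_mul _)).const_mul _).mul_const
          _).cexp
      exact this.differentiableOn
    · exact differentiableOn_const _
  · obtain ⟨u, hu, h⟩ := exists_mainTerm_bound hN b X₀ hp
    refine ⟨fun q => |u q|, hu.abs, ?_⟩
    filter_upwards [h] with r hr q
    split_ifs with hq
    · exact (hr q hq).trans (le_abs_self _)
    · simp

lemma differentiableOn_decayPart {N : ℕ} (hN : 0 < N) (b : HermiteBasis Λ) (X₀ : V) {z : ℍ}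
    (hz : 1 / 2 ≤ z.im) : DifferentiableOn ℂ (fun p => decayPart N b X₀ p z) paramDomain := by
  classical
  refine differentiableOn_tsum_of_locally_dominated isOpen_paramDomain (fun i => ?_) fun p hp => ?_
  · split_ifs
    · exact differentiableOn_const _
    · exact differentiableOn_mixedTerm N b X₀ z i
  · obtain ⟨c, hc, u, hu, h⟩ := exists_mixedTerm_bound hN b X₀ hp |z.re|
    refine ⟨fun i => Real.exp (-c * z.im ^ 2) * |u i|, hu.abs.mul_left _, ?_⟩
    filter_upwards [h] with r hr i
    split_ifs with hi
    · simp
      positivity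
    · exact (hr z le_rfl hz i hi).trans
        (mul_le_mul_of_nonneg_left (le_abs_self _) (Real.exp_pos _).le)

lemma exists_decayPart_bound {N : ℕ} (hN : 0 < N) (b : HermiteBasis Λ) (X₀ : V) {p : ℂ × ℂ}
    (hp : p ∈ paramDomain) (B : ℝ) : ∃ c : ℝ, 0 < c ∧ ∃ K : ℝ, 0 ≤ K ∧
      ∀ᶠ q in 𝓝 p, ∀ z : ℍ, |z.re| ≤ B → 1 / 2 ≤ z.im →
        ‖decayPart N b X₀ q z‖ ≤ K * Real.exp (-c * z.im ^ 2) := by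
  classical
  obtain ⟨c, hc, u, hu, h⟩ := exists_mixedTerm_bound hN b X₀ hp B
  refine ⟨c, hc, ∑' i, |u i|, tsum_nonneg fun _ => abs_nonneg _, ?_⟩
  filter_upwards [h] with r hr z hx hz
  rw [mul_comm, ← tsum_mul_left]
  refine tsum_of_norm_bounded (hu.abs.mul_left _).hasSum fun i => ?_
  split_ifs with hi
  · simp
    positivity
  · exact (hr z hx hz i hi).trans
      (mul_le_mul_of_nonneg_left (le_abs_self _) (Real.exp_pos _).le)

lemma continuousOn_decayPart {N : ℕ} (hN : 0 < N) (b : HermiteBasis Λ) (X₀ : V) {p : ℂ × ℂ}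
    (hp : p ∈ paramDomain) (B : ℝ) :
    ContinuousOn (decayPart N b X₀ p) {z : ℍ | |z.re| ≤ B ∧ 1 / 2 ≤ z.im} := by
  classical
  obtain ⟨c, hc, u, hu, h⟩ := exists_mixedTerm_bound hN b X₀ hp B
  refine continuousOn_tsum (u := fun i => |u i|) (fun i => ?_) hu.abs fun i z hz => ?_
  · split_ifs
    · exact continuousOn_const
    · refine Continuous.continuousOn ?_
      have h1 : Continuous fun z : ℍ => z.re := UpperHalfPlane.continuous_re
      have h2 : Continuous fun z : ℍ => z.im := UpperHalfPlane.continuous_im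
      unfold mixedTerm
      fun_prop
  · split_ifs with hi
    · simp
    · refine (h.self_of_nhds z hz.1 hz.2 i hi).trans ?_
      refine (mul_le_mul_of_nonneg_left (le_abs_self _) (Real.exp_pos _).le).trans ?_
      refine mul_le_of_le_one_left (abs_nonneg _) (Real.exp_le_one_iff.2 ?_)
      have := sq_nonneg z.im
      nlinarith

end MixedSeries
end RegTheta

namespace RegTheta

/-! ### The kernel as a Gaussian in real coordinates. -/

section GaussianCoordinates

variable {Λ : Submodule ℤ V}

/-- The positive definite form `(X, X)_z / N` in real coordinates. -/
def isoMaj (z : ℍ) (x₁ x₂ x₃ : ℝ) : ℝ :=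
  2 * (x₁ - z.re * x₃) ^ 2 + x₃ ^ 2 * z.im ^ 2 +
    (x₂ + 2 * z.re * x₁ - z.re ^ 2 * x₃) ^ 2 / z.im ^ 2

/-- The Gaussian `φ₀` in real coordinates. -/
def phiReal (N : ℕ) (τ z : ℍ) (x₁ x₂ x₃ : ℝ) : ℂ :=
  (Real.sqrt τ.im : ℂ) * Complex.exp (2 * Real.pi * Complex.I * N * τ.re *
    ((x₁ ^ 2 + x₂ * x₃ : ℝ) : ℂ) - Real.pi * N * τ.im * (isoMaj z x₁ x₂ x₃ : ℂ))

lemma isoMaj_nonneg (z : ℍ) (x₁ x₂ x₃ : ℝ) : 0 ≤ isoMaj z x₁ x₂ x₃ := by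
  rw [isoMaj]
  positivity

lemma phi0_eq_phiReal {N : ℕ} (hN : 0 < N) (X : V) (τ z : ℍ) :
    phi0 N X τ z = phiReal N τ z (X.1 0 0 : ℚ) (X.1 0 1 : ℚ) (X.1 1 0 : ℚ) := by
  have hy := z.im_pos.ne'
  have hmaj : majorant N X z = N * isoMaj z (X.1 0 0 : ℚ) (X.1 0 1 : ℚ) (X.1 1 0 : ℚ) := by
    rw [majorant, pairXz_eq' hN, mul_pow, neg_sq, Real.sq_sqrt (Nat.cast_nonneg N), form_apply,
      isoMaj]
    push_cast
    field_simp
    ring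
  rw [phi0, phiReal, hmaj, form_apply]
  congr 2
  push_cast
  linear_combination (Real.pi : ℂ) * (τ.im : ℂ) * N *
    (isoMaj z (X.1 0 0 : ℚ) (X.1 0 1 : ℚ) (X.1 1 0 : ℚ) : ℂ) * Complex.I_sq

lemma norm_phiReal (N : ℕ) (τ z : ℍ) (x₁ x₂ x₃ : ℝ) : ‖phiReal N τ z x₁ x₂ x₃‖ =
    Real.sqrt τ.im * Real.exp (-(Real.pi * N * τ.im * isoMaj z x₁ x₂ x₃)) := by
  rw [phiReal, norm_mul, Complex.norm_real, Real.norm_of_nonneg (Real.sqrt_nonneg _),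
    Complex.norm_exp]
  congr 2
  rw [show 2 * (Real.pi : ℂ) * Complex.I * N * τ.re * ((x₁ ^ 2 + x₂ * x₃ : ℝ) : ℂ) -
    Real.pi * N * τ.im * (isoMaj z x₁ x₂ x₃ : ℂ) =
    Complex.I * ((2 * Real.pi * N * τ.re * (x₁ ^ 2 + x₂ * x₃) : ℝ) : ℂ) -
    ((Real.pi * N * τ.im * isoMaj z x₁ x₂ x₃ : ℝ) : ℂ) by push_cast; ring,
    Complex.sub_re, Complex.ofReal_re, Complex.re_mul_ofReal]
  simp

-- A definite form bounds its coordinates. Every coordinate is shown to be `O(√(isoMaj + 1))`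
-- globally, which the filter `⊤` expresses, by undoing first the shear by `z` and then the
-- triangular basis.
open Asymptotics in
lemma HermiteBasis.exists_sq_le_isoMaj (b : HermiteBasis Λ) (z : ℍ) (x₁ x₂ x₃ : ℝ) :
    ∃ W : ℝ, 0 < W ∧ ∀ k m n : ℝ, k ^ 2 + m ^ 2 + n ^ 2 ≤
      W * (isoMaj z (x₁ + (m * b.δ + n * b.μ)) (x₂ + (k * b.β + m * b.κ + n * b.ν))
        (x₃ + n * b.γ) + 1) := by
  have hβ : (b.β : ℝ) ≠ 0 := by exact_mod_cast b.β_pos.ne'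
  have hδ : (b.δ : ℝ) ≠ 0 := by exact_mod_cast b.δ_pos.ne'
  have hγ : (b.γ : ℝ) ≠ 0 := by exact_mod_cast b.γ_pos.ne'
  have hy := z.im_pos
  let y₁ : ℝ × ℝ × ℝ → ℝ := fun q => x₁ + (q.2.1 * b.δ + q.2.2 * b.μ)
  let y₂ : ℝ × ℝ × ℝ → ℝ := fun q => x₂ + (q.1 * b.β + q.2.1 * b.κ + q.2.2 * b.ν)
  let y₃ : ℝ × ℝ × ℝ → ℝ := fun q => x₃ + q.2.2 * b.γ
  let M : ℝ × ℝ × ℝ → ℝ := fun q => isoMaj z (y₁ q) (y₂ q) (y₃ q) + 1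
  let G : ℝ × ℝ × ℝ → ℝ := fun q => Real.sqrt (M q)
  have hM : ∀ q, 0 ≤ M q := fun q => add_nonneg (isoMaj_nonneg _ _ _ _) zero_le_one
  have of_sq : ∀ f : ℝ × ℝ × ℝ → ℝ, (∃ C, 0 ≤ C ∧ ∀ q, f q ^ 2 ≤ C ^ 2 * M q) → f =O[⊤] G := by
    rintro f ⟨C, hC, h⟩
    rw [isBigO_top]
    refine ⟨C, fun q => ?_⟩
    rw [Real.norm_eq_abs, Real.norm_of_nonneg (Real.sqrt_nonneg _)]
    refine abs_le_of_sq_le_sq ?_ (mul_nonneg hC (Real.sqrt_nonneg _))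
    rw [mul_pow, Real.sq_sqrt (hM q)]
    exact h q
  have h1 : (fun _ => 1 : ℝ × ℝ × ℝ → ℝ) =O[⊤] G := of_sq _ ⟨1, zero_le_one, fun q => by
    have := isoMaj_nonneg z (y₁ q) (y₂ q) (y₃ q)
    simp only [M]
    linarith⟩
  have hξ : (fun q => y₁ q - z.re * y₃ q) =O[⊤] G := of_sq _ ⟨1, zero_le_one, fun q => by
    simp only [M, isoMaj]
    have : 0 ≤ (y₁ q - z.re * y₃ q) ^ 2 + y₃ q ^ 2 * z.im ^ 2 +
      (y₂ q + 2 * z.re * y₁ q - z.re ^ 2 * y₃ q) ^ 2 / z.im ^ 2 := by positivity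
    linarith⟩
  have h3 : y₃ =O[⊤] G := of_sq _ ⟨1 / z.im, by positivity, fun q => by
    simp only [M, isoMaj]
    have : 0 ≤ 2 * (y₁ q - z.re * y₃ q) ^ 2 +
      (y₂ q + 2 * z.re * y₁ q - z.re ^ 2 * y₃ q) ^ 2 / z.im ^ 2 + 1 := by positivity
    rw [div_pow, one_pow, div_mul_eq_mul_div, one_mul, le_div_iff₀ (by positivity)]
    linarith⟩
  have ht : (fun q => y₂ q + 2 * z.re * y₁ q - z.re ^ 2 * y₃ q) =O[⊤] G :=
    of_sq _ ⟨z.im, hy.le, fun q => by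
      simp only [M, isoMaj]
      have : 0 ≤ 2 * (y₁ q - z.re * y₃ q) ^ 2 + y₃ q ^ 2 * z.im ^ 2 + 1 := by positivity
      rw [← div_le_iff₀' (by positivity)]
      linarith⟩
  have e1 : y₁ =O[⊤] G := (hξ.add (h3.const_mul_left z.re)).congr_left fun q => by ring
  have e2 : y₂ =O[⊤] G :=
    ((ht.sub (e1.const_mul_left (2 * z.re))).add (h3.const_mul_left (z.re ^ 2))).congr_left
      fun q => by ring
  have hn : (fun q : ℝ × ℝ × ℝ => q.2.2) =O[⊤] G :=
    ((h3.sub (h1.const_mul_left x₃)).const_mul_left (b.γ : ℝ)⁻¹).congr_left fun q => by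
      simp only [y₃]
      field_simp
      ring
  have hm : (fun q : ℝ × ℝ × ℝ => q.2.1) =O[⊤] G :=
    (((e1.sub (h1.const_mul_left x₁)).sub (hn.const_mul_left b.μ)).const_mul_left
      (b.δ : ℝ)⁻¹).congr_left fun q => by
      simp only [y₁]
      field_simp
      ring
  have hk : (fun q : ℝ × ℝ × ℝ => q.1) =O[⊤] G :=
    ((((e2.sub (h1.const_mul_left x₂)).sub (hn.const_mul_left b.ν)).sub
      (hm.const_mul_left b.κ)).const_mul_left (b.β : ℝ)⁻¹).congr_left fun q => by
      simp only [y₂]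
      field_simp
      ring
  obtain ⟨C, hC⟩ := isBigO_top.1 (((hk.pow 2).add_add (hm.pow 2)).add_add (hn.pow 2))
  refine ⟨|C| * 3 + 1, by positivity, fun k m n => ?_⟩
  have h := hC (k, m, n)
  simp only [G, Real.sq_sqrt (hM _)] at h
  have hMq := hM (k, m, n)
  rw [Real.norm_of_nonneg (by positivity), Real.norm_of_nonneg (by positivity)] at h
  rw [Real.norm_of_nonneg (by positivity), Real.norm_of_nonneg (by positivity)] at h
  change _ ≤ _ * M (k, m, n)
  nlinarith [le_abs_self C, mul_le_mul_of_nonneg_right (le_abs_self C) hMq]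

lemma HermiteBasis.phi0_point {N : ℕ} (hN : 0 < N) (b : HermiteBasis Λ) (X₀ : V) (τ z : ℍ)
    (q : ℤ × ℤ × ℤ) : phi0 N (b.point X₀ q) τ z =
      phiReal N τ z ((X₀.1 0 0 : ℚ) + (q.2.1 * b.δ + q.2.2 * b.μ))
        ((X₀.1 0 1 : ℚ) + (q.1 * b.β + q.2.1 * b.κ + q.2.2 * b.ν))
        ((X₀.1 1 0 : ℚ) + q.2.2 * b.γ) := by
  rw [phi0_eq_phiReal hN, point]
  simp only [V.add_apply, vec_apply_00, vec_apply_01, vec_apply_10]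
  push_cast
  rfl

lemma HermiteBasis.summable_phi0 {N : ℕ} (hN : 0 < N) (b : HermiteBasis Λ) (X₀ : V) (τ z : ℍ) :
    Summable fun q : ℤ × ℤ × ℤ => phi0 N (b.point X₀ q) τ z := by
  obtain ⟨W, hW, h⟩ := b.exists_sq_le_isoMaj z (X₀.1 0 0 : ℚ) (X₀.1 0 1 : ℚ) (X₀.1 1 0 : ℚ)
  have hN' : (0 : ℝ) < N := by exact_mod_cast hN
  have hv := τ.im_pos
  set C : ℝ := Real.pi * N * τ.im
  have hC : 0 < C := by positivity
  refine Summable.of_norm_bounded (((summable_exp_neg_sq_prod₃ (div_pos hC hW)).mul_left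
    (Real.exp C)).mul_left (Real.sqrt τ.im)) fun q => ?_
  rw [b.phi0_point hN, norm_phiReal]
  refine mul_le_mul_of_nonneg_left ?_ (Real.sqrt_nonneg _)
  rw [← Real.exp_add, Real.exp_le_exp]
  have h1 := h q.1 q.2.1 q.2.2
  set M := isoMaj z _ _ _
  have h4 : C / W * ((q.1 : ℝ) ^ 2 + (q.2.1 : ℝ) ^ 2 + (q.2.2 : ℝ) ^ 2) ≤ C * (M + 1) := by
    rw [div_mul_eq_mul_div, div_le_iff₀ hW]
    nlinarith
  linarith

end GaussianCoordinates
end RegTheta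

namespace RegTheta

/-! ### Partial Poisson summation along the isotropic line. -/

section PartialPoisson

variable {N : ℕ} {Λ : Submodule ℤ V}

/-- The real point of `paramDomain` given by `τ`. -/
def paramOf (τ : ℍ) : ℂ × ℂ := ((τ.re : ℂ), (τ.im : ℂ))

lemma paramOf_mem (τ : ℍ) : paramOf τ ∈ paramDomain := ofReal_mem_paramDomain τ.im_pos

lemma paramOf_add (τ : ℍ) : (paramOf τ).1 + Complex.I * (paramOf τ).2 = τ := by
  rw [paramOf, mul_comm]
  exact Complex.re_add_im _

/-- For fixed `(m, n)` the exponent is a quadratic polynomial in `k`, so one-dimensional Poisson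
summation applies; `√v / √a` gives the factor `y / (β √N)`. -/
lemma tsum_phi0_point (hN : 0 < N) (b : HermiteBasis Λ) (X₀ : V) (τ z : ℍ) (q : ℤ × ℤ) :
    ∑' k : ℤ, phi0 N (b.point X₀ (k, q)) τ z =
      (z.im / (b.β * Real.sqrt N) : ℝ) * ∑' j : ℤ, mixedTerm N b X₀ (paramOf τ) z (q, j) := by
  have hβ : (0 : ℝ) < b.β := by exact_mod_cast b.β_pos
  have hN' : (0 : ℝ) < N := by exact_mod_cast hN
  have hv := τ.im_pos
  have hy := z.im_pos
  set x₁ := b.diag X₀ q with hx₁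
  set x₂ := b.upper X₀ q with hx₂
  set x₃ := b.lower X₀ q with hx₃
  set t := x₂ + 2 * z.re * x₁ - z.re ^ 2 * x₃ with ht
  set ξ := x₁ - z.re * x₃ with hξ
  -- `-π a` and `2 π w` are the coefficients of `k²` and `k` in the exponent.
  set a : ℝ := N * τ.im * b.β ^ 2 / z.im ^ 2 with ha
  have ha0 : 0 < a := by positivity
  set w : ℂ := Complex.I * (N * τ.re * b.β * x₃ : ℝ) - (N * τ.im * b.β * t / z.im ^ 2 : ℝ) with hw
  have hβ' : ((b.β : ℝ) : ℂ) ≠ 0 := by exact_mod_cast hβ.ne'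
  have hβ'' : ((b.β : ℚ) : ℂ) ≠ 0 := by exact_mod_cast b.β_pos.ne'
  have hNc : (N : ℂ) ≠ 0 := by exact_mod_cast hN.ne'
  have hvc : (τ.im : ℂ) ≠ 0 := by exact_mod_cast hv.ne'
  have hyc : (z.im : ℂ) ≠ 0 := by exact_mod_cast hy.ne'
  set E : ℂ := 2 * Real.pi * Complex.I * N * τ.re * ((x₁ ^ 2 + x₂ * x₃ : ℝ) : ℂ) -
    Real.pi * N * τ.im * ((2 * ξ ^ 2 + x₃ ^ 2 * z.im ^ 2 + t ^ 2 / z.im ^ 2 : ℝ) : ℂ) with hE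
  have hleft : ∀ k : ℤ, phi0 N (b.point X₀ (k, q)) τ z = (Real.sqrt τ.im : ℂ) * Complex.exp E *
      Complex.exp (-Real.pi * (a : ℂ) * (k : ℂ) ^ 2 + 2 * Real.pi * w * k) := by
    intro k
    rw [b.phi0_point hN, phiReal, mul_assoc (Real.sqrt τ.im : ℂ), ← Complex.exp_add]
    congr 2
    have e1 : ((X₀.1 0 0 : ℚ) : ℝ) + (q.1 * b.δ + q.2 * b.μ) = x₁ := by
      rw [hx₁, HermiteBasis.diag]; push_cast; ring
    have e2 : ((X₀.1 0 1 : ℚ) : ℝ) + (k * b.β + q.1 * b.κ + q.2 * b.ν) = x₂ + k * b.β := by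
      rw [hx₂, HermiteBasis.upper]; push_cast; ring
    have e3 : ((X₀.1 1 0 : ℚ) : ℝ) + q.2 * b.γ = x₃ := by
      rw [hx₃, HermiteBasis.lower]; push_cast; ring
    simp only
    rw [e1, e2, e3, isoMaj, hE, ha, hw]
    have e4 : x₂ + k * b.β + 2 * z.re * x₁ - z.re ^ 2 * x₃ = t + k * b.β := by rw [ht]; ring
    rw [e4, ← hξ]
    push_cast
    field_simp
    ring
  have hright : ∀ j : ℤ, Complex.exp E * Complex.exp (-Real.pi / (a : ℂ) *
      ((j : ℂ) + Complex.I * w) ^ 2) = mixedTerm N b X₀ (paramOf τ) z (q, j) := by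
    intro j
    rw [mixedTerm, ← Complex.exp_add, ← Complex.exp_add, ← Complex.exp_add]
    congr 1
    simp only [paramOf, quadP]
    rw [← hx₁, ← hx₂, ← hx₃, ← hξ, ← ht, hE, ha, hw]
    -- Invariance of `Q` under the unipotent translation by `re z`.
    have e5 : x₁ ^ 2 + x₂ * x₃ = ξ ^ 2 + t * x₃ := by rw [hξ, ht]; ring
    rw [e5]
    have hI : Complex.I ^ 2 = -1 := Complex.I_sq
    push_cast
    have e6 : (j : ℂ) + Complex.I * (Complex.I * (N * τ.re * b.β * x₃) -
      N * τ.im * b.β * t / z.im ^ 2) = (j - N * τ.re * b.β * x₃) -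
        Complex.I * (N * τ.im * b.β * t / z.im ^ 2) := by
      linear_combination (N * τ.re * b.β * x₃ : ℂ) * hI
    rw [e6]
    field_simp
    ring_nf
    simp only [hI]
    ring
  simp only [hleft]
  rw [tsum_mul_left, Complex.tsum_exp_neg_quadratic (by simpa using ha0), ← mul_assoc]
  simp only [← hright]
  rw [tsum_mul_left, ← mul_assoc]
  congr 1
  have hsq : (a : ℂ) ^ (1 / 2 : ℂ) = (Real.sqrt a : ℂ) := by
    rw [Real.sqrt_eq_rpow, Complex.ofReal_cpow ha0.le]
    norm_num
  have hsqa : Real.sqrt a = Real.sqrt N * Real.sqrt τ.im * b.β / z.im := by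
    rw [ha, Real.sqrt_div (by positivity), Real.sqrt_mul (by positivity),
      Real.sqrt_mul (by positivity), Real.sqrt_sq hβ.le, Real.sqrt_sq hy.le]
  rw [hsq, hsqa]
  have h1 : (Real.sqrt N : ℂ) ≠ 0 := by
    exact_mod_cast (Real.sqrt_pos.2 hN').ne'
  have h2 : (Real.sqrt τ.im : ℂ) ≠ 0 := by
    exact_mod_cast (Real.sqrt_pos.2 hv).ne'
  push_cast
  field_simp

lemma mixedTerm_of_eq_zero (b : HermiteBasis Λ) (X₀ : V) (p : ℂ × ℂ) (z : ℍ) {q : ℤ × ℤ}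
    (hq : b.lower X₀ q = 0) : mixedTerm N b X₀ p z (q, 0) = mainTerm N b X₀ p q := by
  simp [mixedTerm, mainTerm, hq, quadP]

/-- For vanishing lower left entry the term of frequency `0` is independent of `z`; these terms form
the main part and everything else decays. -/
theorem tsum_mixedTerm (hN : 0 < N) (b : HermiteBasis Λ) (X₀ : V) {p : ℂ × ℂ}
    (hp : p ∈ paramDomain) {z : ℍ} (hz : 1 / 2 ≤ z.im) :
    ∑' q : ℤ × ℤ, ∑' j : ℤ, mixedTerm N b X₀ p z (q, j) =
      mainPart N b X₀ p + decayPart N b X₀ p z := by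
  classical
  obtain ⟨c, hc, u, hu, h⟩ := exists_mixedTerm_bound hN b X₀ hp |z.re|
  have hdec : Summable fun i : (ℤ × ℤ) × ℤ =>
      if b.lower X₀ i.1 = 0 ∧ i.2 = 0 then 0 else mixedTerm N b X₀ p z i := by
    refine Summable.of_norm_bounded (hu.abs.mul_left (Real.exp (-c * z.im ^ 2))) fun i => ?_
    split_ifs with hi
    · simp
      positivity
    · exact (h.self_of_nhds z le_rfl hz i hi).trans
        (mul_le_mul_of_nonneg_left (le_abs_self _) (Real.exp_pos _).le)
  obtain ⟨u', hu', h'⟩ := exists_mainTerm_bound hN b X₀ hp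
  have hmain : Summable fun q : ℤ × ℤ => if b.lower X₀ q = 0 then mainTerm N b X₀ p q else 0 := by
    refine Summable.of_norm_bounded hu'.abs fun q => ?_
    split_ifs with hq
    · exact (h'.self_of_nhds q hq).trans (le_abs_self _)
    · simp
  have hsplit : ∀ q : ℤ × ℤ, ∑' j : ℤ, mixedTerm N b X₀ p z (q, j) =
      (if b.lower X₀ q = 0 then mainTerm N b X₀ p q else 0) +
      ∑' j : ℤ, if b.lower X₀ q = 0 ∧ j = 0 then 0 else mixedTerm N b X₀ p z (q, j) := by
    intro q
    have h1 : (if b.lower X₀ q = 0 then mainTerm N b X₀ p q else 0) =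
        ∑' j : ℤ, if j = 0 then (if b.lower X₀ q = 0 then mainTerm N b X₀ p q else 0) else 0 :=
      (tsum_ite_eq (0 : ℤ) fun _ => if b.lower X₀ q = 0 then mainTerm N b X₀ p q else 0).symm
    rw [h1, ← Summable.tsum_add (hasSum_ite_eq 0 _).summable (hdec.prod_factor q)]
    refine tsum_congr fun j => ?_
    by_cases hj : j = 0
    · subst hj
      by_cases hq : b.lower X₀ q = 0
      · simp [hq, mixedTerm_of_eq_zero b X₀ p z hq]
      · simp [hq]
    · simp [hj]
  simp only [hsplit]
  rw [Summable.tsum_add hmain hdec.prod, mainPart, decayPart, hdec.tsum_prod]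

/-- The asymptotic expansion of the kernel at a cusp. Absolute convergence allows the summation
along the isotropic direction to be done first. -/
theorem theta_smul_eq (hN : 0 < N) {L : Submodule ℤ V} (hLd : L ≤ dual N L) {g : SL(2, ℤ)}
    (b : HermiteBasis (conjLattice g L)) (τ : ℍ) {z : ℍ} (hz : 1 / 2 ≤ z.im) (h : Disc N L) :
    theta N L τ (g • z) h = (z.im / (b.β * Real.sqrt N) : ℝ) *
      (mainPart N b (conj g⁻¹ (rep h)) (paramOf τ) +
        decayPart N b (conj g⁻¹ (rep h)) (paramOf τ) z) := by
  set X₀ := conj g⁻¹ (rep h)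
  have hs := b.summable_phi0 hN X₀ τ z
  have hs' : Summable fun i : (ℤ × ℤ) × ℤ => phi0 N (b.point X₀ (i.2, i.1)) τ z :=
    (Equiv.prodComm (ℤ × ℤ) ℤ).summable_iff.2 hs
  rw [theta_smul_eq_tsum b hLd, ← tsum_mixedTerm hN b X₀ (paramOf_mem τ) hz, ← tsum_mul_left,
    ← (Equiv.prodComm (ℤ × ℤ) ℤ).tsum_eq]
  refine (hs'.tsum_prod).trans (tsum_congr fun q => ?_)
  exact tsum_phi0_point hN b X₀ τ z q

/-- A vanishing lower left entry means orthogonality to `ℓ`, and on such vectors `Q` is `N` times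
the square of the diagonal entry. -/
theorem thetaTilde_eq_mainPart (hN : 0 < N) {L : Submodule ℤ V} (hLd : L ≤ dual N L)
    {g : SL(2, ℤ)} (b : HermiteBasis (conjLattice g L)) (τ : ℍ) (h : Disc N L) :
    thetaTilde L (g • ell0 N) τ h = mainPart N b (conj g⁻¹ (rep h)) (paramOf τ) := by
  classical
  rw [thetaTilde_eq_tsum hN hLd b, mainPart]
  refine tsum_congr fun q => ?_
  have h1 : b.lower (conj g⁻¹ (rep h)) q = 0 ↔ (conj g⁻¹ (rep h)).1 1 0 + q.2 * b.γ = 0 := by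
    rw [HermiteBasis.lower, Rat.cast_eq_zero]
  simp only [h1]
  refine ite_congr rfl (fun _ => ?_) fun _ => rfl
  rw [e, mainTerm, paramOf_add, HermiteBasis.diag, Complex.ofReal_ratCast]
  congr 1
  ring

end PartialPoisson
end RegTheta

namespace RegTheta

/-! ### Fourier transforms of complex Gaussians and branches of square roots. -/

section GaussianFourier

lemma integral_comp_affine {ι : Type*} [Fintype ι] [DecidableEq ι] {M : Matrix ι ι ℝ}
    (hM : M.det ≠ 0) (w₀ : ι → ℝ) (F : (ι → ℝ) → ℂ) :
    ∫ x, F (w₀ + M.mulVec x) = (|M.det|⁻¹ : ℝ) * ∫ w, F w := by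
  have hinj : MeasurableEmbedding (Matrix.toLin' M) := by
    have hker : LinearMap.ker (Matrix.toLin' M) = ⊥ := by
      rw [LinearMap.ker_eq_bot]
      exact Matrix.mulVec_injective_iff_isUnit.2 ((Matrix.isUnit_iff_isUnit_det M).2 hM.isUnit)
    exact ((Matrix.toLin' M).isClosedEmbedding_of_injective hker).measurableEmbedding
  have h1 := hinj.integral_map (μ := volume) fun w => F (w₀ + w)
  rw [Real.map_matrix_volume_pi_eq_smul_volume_pi hM, integral_smul_measure,
    integral_add_left_eq_self F w₀, ENNReal.toReal_ofReal (abs_nonneg _), abs_inv] at h1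
  simp only [Matrix.toLin'_apply] at h1
  rw [← h1, Complex.real_smul]

/-- The hypothesis says `m = Mᵀ η`: in the coordinates `w₀ + M x` the character has frequency `η`
and the integral splits into one-dimensional Gaussians. -/
lemma integral_gaussian_affine {ι : Type*} [Fintype ι] [DecidableEq ι] {B : ι → ℂ}
    (hB : ∀ i, 0 < (B i).re) {M : Matrix ι ι ℝ} (hM : M.det ≠ 0) (w₀ η m : ι → ℝ)
    (h : ∀ x : ι → ℝ, ∑ i, m i * x i = ∑ i, η i * (M.mulVec x) i) :
    ∫ x : ι → ℝ, Complex.exp (-(2 * Real.pi * Complex.I * ∑ i, (m i : ℂ) * x i)) *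
      Complex.exp (-∑ i, B i * (((w₀ + M.mulVec x) i : ℝ) : ℂ) ^ 2) =
    (|M.det|⁻¹ : ℝ) * (Complex.exp (2 * Real.pi * Complex.I * ∑ i, (η i : ℂ) * w₀ i) *
      ∏ i, (Real.pi / B i) ^ (1 / 2 : ℂ) *
        Complex.exp (-(Real.pi ^ 2 * (η i : ℂ) ^ 2 / B i))) := by
  have key := integral_comp_affine hM w₀ fun w => Complex.exp (2 * Real.pi * Complex.I *
    ∑ i, (η i : ℂ) * w₀ i) * Complex.exp (-∑ i, B i * (w i : ℂ) ^ 2 +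
      ∑ i, (-(2 * Real.pi * Complex.I * η i)) * w i)
  rw [integral_const_mul, integral_const_mul,
    GaussianFourier.integral_cexp_neg_sum_mul_add hB] at key
  have e1 : ∀ i, Complex.exp ((-(2 * Real.pi * Complex.I * η i)) ^ 2 / (4 * B i)) =
      Complex.exp (-(Real.pi ^ 2 * (η i : ℂ) ^ 2 / B i)) := fun i => by
    have hBi : B i ≠ 0 := fun h0 => by simpa [h0] using hB i
    congr 1
    field_simp
    rw [Complex.I_sq]
    ring
  simp only [e1] at key
  rw [← key, ← integral_const_mul]
  refine integral_congr_ae (ae_of_all _ fun x => ?_)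
  simp only
  rw [← Complex.exp_add, ← Complex.exp_add]
  congr 1
  have h2 : (∑ i, (m i : ℂ) * x i) = ∑ i, (η i : ℂ) * ((M.mulVec x) i : ℝ) := by
    exact_mod_cast h x
  have h3 : ∑ i, (-(2 * Real.pi * Complex.I * η i)) * (((w₀ + M.mulVec x) i : ℝ) : ℂ) =
      -(2 * Real.pi * Complex.I) * (∑ i, (η i : ℂ) * w₀ i +
        ∑ i, (η i : ℂ) * ((M.mulVec x) i : ℝ)) := by
    rw [← Finset.sum_add_distrib, Finset.mul_sum]
    refine Finset.sum_congr rfl fun i _ => ?_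
    rw [Pi.add_apply]
    push_cast
    ring
  rw [h2, h3]
  ring

lemma cpow_half_div {c : ℝ} (hc : 0 < c) {w : ℂ} (hw : 0 < w.re) :
    ((c : ℂ) / w) ^ (1 / 2 : ℂ) = (Real.sqrt c : ℂ) * (w ^ (1 / 2 : ℂ))⁻¹ := by
  have hw0 : w ≠ 0 := fun h => by simp [h] at hw
  have harg : w.arg ≠ Real.pi := by
    intro h
    have := (Complex.arg_eq_pi_iff.1 h).1
    linarith
  rw [div_eq_mul_inv, ← Complex.inv_cpow _ _ harg, Complex.cpow_def_of_ne_zero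
    (mul_ne_zero (by exact_mod_cast hc.ne') (inv_ne_zero hw0)), Complex.log_ofReal_mul hc
    (inv_ne_zero hw0), add_mul, Complex.exp_add, Complex.cpow_def_of_ne_zero (inv_ne_zero hw0),
    Real.sqrt_eq_rpow, Complex.ofReal_cpow hc.le, Complex.cpow_def_of_ne_zero
    (by exact_mod_cast hc.ne'), Complex.ofReal_log hc.le]
  norm_num

lemma cpow_half_mul_conj {w : ℂ} (hw : 0 < w.re) :
    w ^ (1 / 2 : ℂ) * ((starRingEnd ℂ) w) ^ (1 / 2 : ℂ) = (‖w‖ : ℂ) := by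
  have hw0 : w ≠ 0 := fun h => by simp [h] at hw
  have harg : w.arg ≠ Real.pi := by
    intro h
    have := (Complex.arg_eq_pi_iff.1 h).1
    linarith
  have h2 : (starRingEnd ℂ) (1 / 2 : ℂ) = 1 / 2 := by
    rw [map_div₀, map_one, map_ofNat]
  rw [Complex.conj_cpow _ _ harg, h2, Complex.mul_conj, Complex.normSq_eq_norm_sq,
    Complex.norm_cpow_of_ne_zero hw0]
  norm_num
  rw [← Complex.ofReal_pow, ← Real.rpow_natCast, ← Real.rpow_mul (norm_nonneg _)]
  norm_num

/-- The source of the eighth root of unity in `ρ_L(S)`. The principal branches are compatible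
because `arg τ` lies in `(0, π]` and `arg (-i) = -π/2`. -/
lemma cpow_half_neg_I_mul (τ : ℍ) :
    (-Complex.I * τ) ^ (1 / 2 : ℂ) = e (-1 / 8) * (τ : ℂ) ^ (1 / 2 : ℂ) := by
  have h0 : (-Complex.I) ≠ 0 := neg_ne_zero.2 Complex.I_ne_zero
  have hτ := τ.ne_zero
  have h1 : Complex.log (-Complex.I * τ) = Complex.log (-Complex.I) + Complex.log τ := by
    rw [Complex.log_mul_eq_add_log_iff h0 hτ, Complex.arg_neg_I]
    have h2 : 0 < Complex.arg τ := by
      have h3 := Complex.arg_nonneg_iff.2 τ.im_pos.le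
      refine lt_of_le_of_ne h3 fun h4 => ?_
      have := (Complex.arg_eq_zero_iff.1 h4.symm).2
      exact τ.im_pos.ne' this
    have h5 := Complex.arg_le_pi τ
    constructor <;> linarith [Real.pi_pos]
  rw [Complex.cpow_def_of_ne_zero (mul_ne_zero h0 hτ), h1, add_mul, Complex.exp_add,
    ← Complex.cpow_def_of_ne_zero hτ, Complex.log_neg_I, e]
  congr 2
  ring

end GaussianFourier
end RegTheta

namespace RegTheta

/-! ### The Fourier transform of `φ₀`. -/

section ThetaFourier

variable {N : ℕ} {Λ : Submodule ℤ V}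

/-- Coordinates in which the forms `(X, X)` and `(X, X)_z` are both diagonal. -/
def gaussCoord (z : ℍ) (x₁ x₂ x₃ : ℝ) : Fin 3 → ℝ :=
  ![x₁ - z.re * x₃, (x₂ + 2 * z.re * x₁ - z.re ^ 2 * x₃) / z.im + x₃ * z.im,
    (x₂ + 2 * z.re * x₁ - z.re ^ 2 * x₃) / z.im - x₃ * z.im]

/-- The coefficients of the exponent of `φ₀` in diagonal coordinates. -/
def gaussCoeff (N : ℕ) (w : ℂ) : Fin 3 → ℂ :=
  ![2 * Real.pi * N * w, Real.pi * N / 2 * w, Real.pi * N / 2 * (starRingEnd ℂ) w]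

lemma gaussCoeff_re_pos (hN : 0 < N) {w : ℂ} (hw : 0 < w.re) (i : Fin 3) :
    0 < (gaussCoeff N w i).re := by
  have hN' : (0 : ℝ) < N := by exact_mod_cast hN
  have h1 : gaussCoeff N w 0 = ((2 * Real.pi * N : ℝ) : ℂ) * w := by simp [gaussCoeff]
  have h2 : gaussCoeff N w 1 = ((Real.pi * N / 2 : ℝ) : ℂ) * w := by simp [gaussCoeff]
  have h3 : gaussCoeff N w 2 = ((Real.pi * N / 2 : ℝ) : ℂ) * (starRingEnd ℂ) w := by
    simp [gaussCoeff]
  have hp := Real.pi_pos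
  fin_cases i
  · change 0 < (gaussCoeff N w 0).re
    rw [h1, Complex.re_ofReal_mul]
    positivity
  · change 0 < (gaussCoeff N w 1).re
    rw [h2, Complex.re_ofReal_mul]
    positivity
  · change 0 < (gaussCoeff N w 2).re
    rw [h3, Complex.re_ofReal_mul, Complex.conj_re]
    positivity

/-- Signature `(2, 1)`: the two positive directions carry `w = -iτ`, the negative one its conjugate.
-/
lemma phiReal_eq_gauss (N : ℕ) (τ z : ℍ) (x₁ x₂ x₃ : ℝ) : phiReal N τ z x₁ x₂ x₃ =
    (Real.sqrt τ.im : ℂ) * Complex.exp (-∑ i, gaussCoeff N (-Complex.I * τ) i *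
      (gaussCoord z x₁ x₂ x₃ i : ℂ) ^ 2) := by
  have hy : (z.im : ℂ) ≠ 0 := by exact_mod_cast z.im_pos.ne'
  have hτ : (τ : ℂ) = τ.re + τ.im * Complex.I := (Complex.re_add_im _).symm
  rw [phiReal]
  congr 2
  rw [Fin.sum_univ_three, isoMaj]
  simp only [gaussCoeff, gaussCoord, Matrix.cons_val]
  rw [hτ]
  simp only [map_mul, map_add, map_neg, Complex.conj_I, Complex.conj_ofReal]
  push_cast
  field_simp
  ring_nf
  simp only [Complex.I_sq]
  ring

lemma gaussCoord_pairing (N : ℕ) (z : ℍ) (x₁ x₂ x₃ y₁ y₂ y₃ : ℝ) :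
    ∑ i, (![2 * N * gaussCoord z y₁ y₂ y₃ 0, N / 2 * gaussCoord z y₁ y₂ y₃ 1,
      -(N / 2 * gaussCoord z y₁ y₂ y₃ 2)] : Fin 3 → ℝ) i * gaussCoord z x₁ x₂ x₃ i =
      N * (2 * x₁ * y₁ + x₂ * y₃ + x₃ * y₂) := by
  have hy := z.im_pos.ne'
  rw [Fin.sum_univ_three]
  simp only [gaussCoord, Matrix.cons_val]
  field_simp
  ring

/-- The matrix of a Hermite basis in diagonal coordinates. -/
def HermiteBasis.gaussMatrix (b : HermiteBasis Λ) (z : ℍ) : Matrix (Fin 3) (Fin 3) ℝ :=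
  !![0, b.δ, b.μ - z.re * b.γ;
    b.β / z.im, (b.κ + 2 * z.re * b.δ) / z.im,
      (b.ν + 2 * z.re * b.μ - z.re ^ 2 * b.γ) / z.im + b.γ * z.im;
    b.β / z.im, (b.κ + 2 * z.re * b.δ) / z.im,
      (b.ν + 2 * z.re * b.μ - z.re ^ 2 * b.γ) / z.im - b.γ * z.im]

lemma HermiteBasis.det_gaussMatrix (b : HermiteBasis Λ) (z : ℍ) :
    (b.gaussMatrix z).det = 2 * (b.β * b.δ * b.γ) := by
  have hy := z.im_pos.ne'
  rw [gaussMatrix, Matrix.det_fin_three]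
  simp
  field_simp
  ring

lemma HermiteBasis.gaussCoord_add (b : HermiteBasis Λ) (z : ℍ) (x₁ x₂ x₃ : ℝ) (x : Fin 3 → ℝ) :
    gaussCoord z (x₁ + (x 1 * b.δ + x 2 * b.μ)) (x₂ + (x 0 * b.β + x 1 * b.κ + x 2 * b.ν))
      (x₃ + x 2 * b.γ) = gaussCoord z x₁ x₂ x₃ + (b.gaussMatrix z).mulVec x := by
  have hy := z.im_pos.ne'
  ext i
  fin_cases i <;>
  simp [gaussCoord, gaussMatrix, dotProduct, Fin.sum_univ_three] <;>
  field_simp <;> ring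

lemma coe_S_smul (τ : ℍ) : ((ModularGroup.S • τ : ℍ) : ℂ) = -(τ : ℂ)⁻¹ := by
  rw [UpperHalfPlane.modular_S_smul, UpperHalfPlane.coe_mk, inv_neg]

lemma im_S_smul (τ : ℍ) : (ModularGroup.S • τ : ℍ).im = τ.im / ‖(τ : ℂ)‖ ^ 2 := by
  rw [im_smul_SL]
  congr 3
  simp [jfac, ModularGroup.S]

lemma neg_I_mul_S_smul (τ : ℍ) :
    -Complex.I * ((ModularGroup.S • τ : ℍ) : ℂ) = (-Complex.I * (τ : ℂ))⁻¹ := by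
  rw [coe_S_smul, mul_inv, inv_neg, Complex.inv_I]
  ring

lemma neg_I_mul_re_pos (τ : ℍ) : 0 < (-Complex.I * (τ : ℂ)).re := by
  have := τ.im_pos
  simpa using this

/-- The Fourier transform of the restriction of `φ₀` to a lattice in `V(ℝ)`. -/
theorem HermiteBasis.fourier_phi0 (hN : 0 < N) (b : HermiteBasis Λ) (X₀ Y : V) (τ z : ℍ)
    {m : Fin 3 → ℝ} (hm0 : m 0 = form N (vec 0 b.β 0) Y) (hm1 : m 1 = form N (vec b.δ b.κ 0) Y)
    (hm2 : m 2 = form N (vec b.μ b.ν b.γ) Y) :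
    ∫ x : Fin 3 → ℝ, Complex.exp (-(2 * Real.pi * Complex.I * ∑ i, (m i : ℂ) * x i)) *
      phiReal N τ z ((X₀.1 0 0 : ℚ) + (x 1 * b.δ + x 2 * b.μ))
        ((X₀.1 0 1 : ℚ) + (x 0 * b.β + x 1 * b.κ + x 2 * b.ν)) ((X₀.1 1 0 : ℚ) + x 2 * b.γ) =
    ((N * (b.β * b.δ * b.γ) * Real.sqrt (2 * N) : ℝ) : ℂ)⁻¹ *
      ((-Complex.I * τ) ^ (1 / 2 : ℂ))⁻¹ * (e (form N X₀ Y : ℂ) *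
        phi0 N Y (ModularGroup.S • τ) z) := by
  have hβ : (0 : ℝ) < b.β := by exact_mod_cast b.β_pos
  have hδ : (0 : ℝ) < b.δ := by exact_mod_cast b.δ_pos
  have hγ : (0 : ℝ) < b.γ := by exact_mod_cast b.γ_pos
  have hN' : (0 : ℝ) < N := by exact_mod_cast hN
  have hv := τ.im_pos
  set w : ℂ := -Complex.I * τ with hw
  have hwre : 0 < w.re := neg_I_mul_re_pos τ
  have hw0 : w ≠ 0 := fun h => by simp [h] at hwre
  have hwc : (starRingEnd ℂ) w ≠ 0 := (map_ne_zero _).2 hw0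
  have hdet := b.det_gaussMatrix z
  have hdet0 : (b.gaussMatrix z).det ≠ 0 := by rw [hdet]; positivity
  set w₀ := gaussCoord z (X₀.1 0 0 : ℚ) (X₀.1 0 1 : ℚ) (X₀.1 1 0 : ℚ) with hw₀
  set c := gaussCoord z (Y.1 0 0 : ℚ) (Y.1 0 1 : ℚ) (Y.1 1 0 : ℚ) with hc
  set η : Fin 3 → ℝ := ![2 * N * c 0, N / 2 * c 1, -(N / 2 * c 2)] with hη
  have hpair : ∀ x : Fin 3 → ℝ, ∑ i, m i * x i = ∑ i, η i * ((b.gaussMatrix z).mulVec x) i := by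
    intro x
    have h1 := b.gaussCoord_add z 0 0 0 x
    have h0 : gaussCoord z 0 0 0 = 0 := by
      ext i
      fin_cases i <;> simp [gaussCoord]
    rw [h0] at h1
    simp only [zero_add] at h1
    rw [← h1, hη, hc, gaussCoord_pairing, Fin.sum_univ_three, hm0, hm1, hm2, form_apply,
      form_apply, form_apply]
    simp only [vec_apply_00, vec_apply_01, vec_apply_10]
    push_cast
    ring
  have key := integral_gaussian_affine (gaussCoeff_re_pos hN hwre) hdet0 w₀ η m hpair
  have e0 : (∑ i, (η i : ℂ) * w₀ i) = (form N X₀ Y : ℂ) := by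
    have : (∑ i, η i * w₀ i) = ((form N X₀ Y : ℚ) : ℝ) := by
      rw [hη, hc, hw₀, gaussCoord_pairing, form_apply]
      push_cast
      ring
    rw [← Complex.ofReal_ratCast, ← this]
    push_cast
    rfl
  rw [e0] at key
  -- Since `-i S τ = 1 / w`, inverting the Gaussian coefficients is the passage from `τ` to `S τ`.
  have hphi : phi0 N Y (ModularGroup.S • τ) z = (Real.sqrt τ.im / ‖w‖ : ℝ) *
      ∏ i, Complex.exp (-(Real.pi ^ 2 * (η i : ℂ) ^ 2 / gaussCoeff N w i)) := by
    have hnorm : ‖(τ : ℂ)‖ = ‖w‖ := by rw [hw]; simp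
    rw [phi0_eq_phiReal hN, phiReal_eq_gauss, neg_I_mul_S_smul, ← hw, im_S_smul, hnorm,
      Real.sqrt_div hv.le, Real.sqrt_sq (norm_nonneg _), ← Complex.exp_sum, ← hc]
    congr 2
    rw [Finset.sum_neg_distrib]
    congr 1
    rw [Fin.sum_univ_three, Fin.sum_univ_three]
    simp only [gaussCoeff, hη, Matrix.cons_val]
    have hπ : (Real.pi : ℂ) ≠ 0 := by exact_mod_cast Real.pi_ne_zero
    have hNc : (N : ℂ) ≠ 0 := by exact_mod_cast hN.ne'
    rw [map_inv₀]
    push_cast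
    field_simp
  -- The three directions contribute `w^{-1/2}`, `w^{-1/2}` and the conjugate of `w^{-1/2}`, that
  -- is, `w^{-1/2} / |w|`. The factor `1 / |w|` is absorbed by `√(im S τ) = √v / |w|`, which leaves
  -- weight `1/2`.
  have hprod : ∏ i, (Real.pi / gaussCoeff N w i : ℂ) ^ (1 / 2 : ℂ) =
      ((Real.sqrt (1 / (2 * N)) * (2 / N) / ‖w‖ : ℝ) : ℂ) * (w ^ (1 / 2 : ℂ))⁻¹ := by
    have hπ : (Real.pi : ℂ) ≠ 0 := by exact_mod_cast Real.pi_ne_zero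
    have hNc : (N : ℂ) ≠ 0 := by exact_mod_cast hN.ne'
    have b0 : (Real.pi / gaussCoeff N w 0 : ℂ) = ((1 / (2 * N) : ℝ) : ℂ) / w := by
      simp [gaussCoeff]
      field_simp
    have b1 : (Real.pi / gaussCoeff N w 1 : ℂ) = ((2 / N : ℝ) : ℂ) / w := by
      simp [gaussCoeff]
      field_simp
    have b2 : (Real.pi / gaussCoeff N w 2 : ℂ) = ((2 / N : ℝ) : ℂ) / (starRingEnd ℂ) w := by
      simp [gaussCoeff]
      field_simp
    rw [Fin.prod_univ_three, b0, b1, b2, cpow_half_div (by positivity) hwre,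
      cpow_half_div (by positivity) hwre, cpow_half_div (by positivity) (by simpa using hwre)]
    have h1 := cpow_half_mul_conj hwre
    have h2 : (Real.sqrt (2 / N) : ℂ) * Real.sqrt (2 / N) = ((2 / N : ℝ) : ℂ) := by
      exact_mod_cast Real.mul_self_sqrt (by positivity)
    rw [Complex.ofReal_div, ← h1, Complex.ofReal_mul, ← h2, div_eq_mul_inv, mul_inv]
    ring
  have hfun : ∀ x : Fin 3 → ℝ, phiReal N τ z ((X₀.1 0 0 : ℚ) + (x 1 * b.δ + x 2 * b.μ))
        ((X₀.1 0 1 : ℚ) + (x 0 * b.β + x 1 * b.κ + x 2 * b.ν)) ((X₀.1 1 0 : ℚ) + x 2 * b.γ) =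
      (Real.sqrt τ.im : ℂ) * Complex.exp (-∑ i, gaussCoeff N w i *
        (((w₀ + (b.gaussMatrix z).mulVec x) i : ℝ) : ℂ) ^ 2) := fun x => by
    rw [phiReal_eq_gauss, b.gaussCoord_add]
  simp only [hfun]
  simp only [mul_left_comm _ (Real.sqrt τ.im : ℂ)]
  rw [integral_const_mul, key, Finset.prod_mul_distrib, hprod, hphi, e, hdet,
    abs_of_pos (by positivity)]
  have hs : Real.sqrt (1 / (2 * N)) = (Real.sqrt (2 * N))⁻¹ := by rw [one_div, Real.sqrt_inv]
  rw [hs]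
  have hs0 : (Real.sqrt (2 * N) : ℂ) ≠ 0 := by
    exact_mod_cast (Real.sqrt_pos.2 (by positivity : (0 : ℝ) < 2 * N)).ne'
  have hn0 : ((‖w‖ : ℝ) : ℂ) ≠ 0 := by exact_mod_cast norm_ne_zero_iff.2 hw0
  have hNc : (N : ℂ) ≠ 0 := by exact_mod_cast hN.ne'
  have hβ' : ((b.β : ℚ) : ℂ) ≠ 0 := by exact_mod_cast b.β_pos.ne'
  have hδ' : ((b.δ : ℚ) : ℂ) ≠ 0 := by exact_mod_cast b.δ_pos.ne'
  have hγ' : ((b.γ : ℚ) : ℂ) ≠ 0 := by exact_mod_cast b.γ_pos.ne'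
  push_cast
  field_simp

end ThetaFourier
end RegTheta

namespace RegTheta

/-! ### The Weil transformation law of the theta kernel. -/

section ThetaTransformation

variable {N : ℕ} {Λ L : Submodule ℤ V}

/-- Triples of integers. -/
def finThreeEquiv : (Fin 3 → ℤ) ≃ ℤ × ℤ × ℤ where
  toFun f := (f 0, f 1, f 2)
  invFun q := ![q.1, q.2.1, q.2.2]
  left_inv f := by
    ext i
    fin_cases i <;> rfl
  right_inv _ := rfl

/-- The restriction of `φ₀` to a coset of a lattice, extended to real coordinates. -/
def HermiteBasis.gaussFun (N : ℕ) (b : HermiteBasis Λ) (X₀ : V) (τ z : ℍ) (x : Fin 3 → ℝ) : ℂ :=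
  phiReal N τ z ((X₀.1 0 0 : ℚ) + (x 1 * b.δ + x 2 * b.μ))
    ((X₀.1 0 1 : ℚ) + (x 0 * b.β + x 1 * b.κ + x 2 * b.ν)) ((X₀.1 1 0 : ℚ) + x 2 * b.γ)

lemma HermiteBasis.continuous_gaussFun (b : HermiteBasis Λ) (X₀ : V) (τ z : ℍ) :
    Continuous (b.gaussFun N X₀ τ z) := by
  unfold gaussFun phiReal isoMaj
  fun_prop

lemma HermiteBasis.exists_gaussFun_bound (hN : 0 < N) (b : HermiteBasis Λ) (X₀ : V) (τ z : ℍ) :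
    ∃ c C : ℝ, 0 < c ∧ 0 ≤ C ∧ ∀ x : Fin 3 → ℝ,
      ‖b.gaussFun N X₀ τ z x‖ ≤ C * Real.exp (-c * ∑ i, x i ^ 2) := by
  obtain ⟨W, hW, h⟩ := b.exists_sq_le_isoMaj z (X₀.1 0 0 : ℚ) (X₀.1 0 1 : ℚ) (X₀.1 1 0 : ℚ)
  have hN' : (0 : ℝ) < N := by exact_mod_cast hN
  have hv := τ.im_pos
  set C : ℝ := Real.pi * N * τ.im
  have hC : 0 < C := by positivity
  refine ⟨C / W, Real.sqrt τ.im * Real.exp C, by positivity, by positivity, fun x => ?_⟩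
  rw [gaussFun, norm_phiReal, mul_assoc (Real.sqrt τ.im)]
  refine mul_le_mul_of_nonneg_left ?_ (Real.sqrt_nonneg _)
  rw [← Real.exp_add, Real.exp_le_exp, Fin.sum_univ_three]
  have h1 := h (x 0) (x 1) (x 2)
  set M := isoMaj z _ _ _
  have h4 : C / W * (x 0 ^ 2 + x 1 ^ 2 + x 2 ^ 2) ≤ C * (M + 1) := by
    rw [div_mul_eq_mul_div, div_le_iff₀ hW]
    nlinarith
  linarith

lemma integrable_exp_neg_sum_sq {c : ℝ} (hc : 0 < c) :
    Integrable fun x : Fin 3 → ℝ => Real.exp (-c * ∑ i, x i ^ 2) := by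
  have h := (GaussianFourier.integrable_cexp_neg_sum_mul_add (ι := Fin 3) (b := fun _ => (c : ℂ))
    (fun _ => by simpa using hc) 0).norm
  refine h.congr (ae_of_all _ fun x => ?_)
  simp only [Complex.norm_exp]
  congr 1
  rw [← Finset.mul_sum]
  have : (c : ℂ) * ∑ i, (x i : ℂ) ^ 2 = ((c * ∑ i, x i ^ 2 : ℝ) : ℂ) := by push_cast; rfl
  rw [this, Complex.add_re, Complex.neg_re, Complex.ofReal_re]
  simp

lemma summable_exp_neg_sum_sq {c : ℝ} (hc : 0 < c) :
    Summable fun n : Fin 3 → ℤ => Real.exp (-c * ∑ i, (n i : ℝ) ^ 2) := by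
  rw [← finThreeEquiv.symm.summable_iff]
  refine (summable_exp_neg_sq_prod₃ hc).congr fun q => ?_
  rw [Function.comp_apply, Fin.sum_univ_three]
  rfl

/-- The vector of the dual lattice with given pairings with a Hermite basis. -/
def HermiteBasis.dualPoint (b : HermiteBasis Λ) (hN : 0 < N) (m : Fin 3 → ℤ) : V :=
  -- The dual of a triangular basis is triangular for the reversed order, hence the reversed
  -- indices.
  (b.dual hN).point 0 (m 2, m 1, m 0)

lemma HermiteBasis.form_dualPoint (b : HermiteBasis Λ) (hN : 0 < N) (m : Fin 3 → ℤ) :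
    (m 0 : ℚ) = form N (vec 0 b.β 0) (b.dualPoint hN m) ∧
    (m 1 : ℚ) = form N (vec b.δ b.κ 0) (b.dualPoint hN m) ∧
    (m 2 : ℚ) = form N (vec b.μ b.ν b.γ) (b.dualPoint hN m) := by
  have hβ := b.β_pos.ne'
  have hδ := b.δ_pos.ne'
  have hγ := b.γ_pos.ne'
  have hN' : (N : ℚ) ≠ 0 := by exact_mod_cast hN.ne'
  rw [form_apply, form_apply, form_apply, dualPoint, point, zero_add]
  simp only [vec_apply_00, vec_apply_01, vec_apply_10, HermiteBasis.dual]
  refine ⟨?_, ?_, ?_⟩ <;> field_simp <;> ring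

/-- The dual lattice in Hermite coordinates. -/
def HermiteBasis.dualEquiv (b : HermiteBasis Λ) (hN : 0 < N) :
    (Fin 3 → ℤ) ≃ RegTheta.dual N Λ := by
  refine Equiv.ofBijective (fun m => ⟨b.dualPoint hN m, ?_⟩) ⟨fun m m' h => ?_, fun X => ?_⟩
  · rw [dualPoint, point, zero_add]
    exact (b.dual hN).vec_mem _ _ _
  · have h1 : (b.dual hN).point 0 (m 2, m 1, m 0) = (b.dual hN).point 0 (m' 2, m' 1, m' 0) :=
      congrArg Subtype.val h
    obtain ⟨h2, h3, h4⟩ := (b.dual hN).vec_injective (add_left_cancel h1)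
    ext i
    fin_cases i
    · exact h4
    · exact h3
    · exact h2
  · obtain ⟨k, m, n, h⟩ := ((b.dual hN).mem_iff X).1 X.2
    refine ⟨![n, m, k], Subtype.ext ?_⟩
    change (b.dual hN).point 0 (k, m, n) = X
    rw [point, zero_add, h]

lemma HermiteBasis.coe_dualEquiv (b : HermiteBasis Λ) (hN : 0 < N) (m : Fin 3 → ℤ) :
    (b.dualEquiv hN m : V) = b.dualPoint hN m := rfl

lemma HermiteBasis.summable_phi0_dual (b : HermiteBasis Λ) (hN : 0 < N) (τ z : ℍ) :
    Summable fun Y : RegTheta.dual N Λ => phi0 N (Y : V) τ z := by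
  rw [← (b.dualEquiv hN).summable_iff]
  have h := (b.dual hN).summable_phi0 hN 0 τ z
  let E : (Fin 3 → ℤ) ≃ ℤ × ℤ × ℤ :=
    { toFun := fun f => (f 2, f 1, f 0)
      invFun := fun q => ![q.2.2, q.2.1, q.1]
      left_inv := fun f => by
        ext i
        fin_cases i <;> rfl
      right_inv := fun _ => rfl }
  exact (E.summable_iff.2 h).congr fun m => rfl

lemma norm_e_ratCast (q : ℚ) : ‖e (q : ℂ)‖ = 1 := by
  rw [e, Complex.norm_exp, ← Complex.ofReal_ratCast, Complex.re_mul_ofReal]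
  simp

/-- Poisson summation in three variables over a coset: the frequencies run over the dual lattice,
the shift by `X₀` becomes a character, and Gaussian bounds supply the hypotheses. -/
theorem HermiteBasis.tsum_phi0_eq (hN : 0 < N) (b : HermiteBasis Λ) (X₀ : V) (τ z : ℍ) :
    ∑' q : ℤ × ℤ × ℤ, phi0 N (b.point X₀ q) τ z =
      ((N * (b.β * b.δ * b.γ) * Real.sqrt (2 * N) : ℝ) : ℂ)⁻¹ *
      ((-Complex.I * τ) ^ (1 / 2 : ℂ))⁻¹ * ∑' Y : RegTheta.dual N Λ,
        e (form N X₀ (Y : V) : ℂ) * phi0 N (Y : V) (ModularGroup.S • τ) z := by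
  obtain ⟨c, C, hc, hC, hbound⟩ := b.exists_gaussFun_bound hN X₀ τ z
  have hcont := b.continuous_gaussFun (N := N) X₀ τ z
  have hFT : ∀ m : Fin 3 → ℤ, ∫ x : Fin 3 → ℝ, Complex.exp (-(2 * Real.pi * Complex.I *
      ∑ i, (m i : ℂ) * x i)) * b.gaussFun N X₀ τ z x =
      ((N * (b.β * b.δ * b.γ) * Real.sqrt (2 * N) : ℝ) : ℂ)⁻¹ *
      ((-Complex.I * τ) ^ (1 / 2 : ℂ))⁻¹ * (e (form N X₀ (b.dualEquiv hN m : V) : ℂ) *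
        phi0 N (b.dualEquiv hN m : V) (ModularGroup.S • τ) z) := by
    intro m
    obtain ⟨h0, h1, h2⟩ := b.form_dualPoint hN m
    have h := b.fourier_phi0 hN X₀ (b.dualEquiv hN m : V) τ z (m := fun i => (m i : ℝ))
      (by rw [b.coe_dualEquiv, ← h0]; push_cast; rfl)
      (by rw [b.coe_dualEquiv, ← h1]; push_cast; rfl)
      (by rw [b.coe_dualEquiv, ← h2]; push_cast; rfl)
    rw [← h]
    simp only [Complex.ofReal_intCast]
    rfl
  have hpois := tsum_eq_tsum_fourier_of_summable (f := b.gaussFun N X₀ τ z) hcont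
    (((integrable_exp_neg_sum_sq hc).const_mul C).mono' hcont.aestronglyMeasurable
      (ae_of_all _ hbound)) (fun R => by
      -- From `n² ≤ 2 (x + n)² + 2 R²` in each coordinate; the three copies of `c R²` give the
      -- constant.
      refine ⟨fun n => C * (Real.exp (3 * c * R ^ 2) * Real.exp (-(c / 2) * ∑ i, (n i : ℝ) ^ 2)),
        ((summable_exp_neg_sum_sq (half_pos hc)).mul_left _).mul_left _, fun n x hx => ?_⟩
      refine (hbound _).trans (mul_le_mul_of_nonneg_left ?_ hC)
      rw [← Real.exp_add, Real.exp_le_exp, Fin.sum_univ_three, Fin.sum_univ_three]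
      have h1 : ∀ i, (n i : ℝ) ^ 2 ≤ 2 * (x i + n i) ^ 2 + 2 * R ^ 2 := fun i => by
        have h2 : |x i| ≤ R := (norm_le_pi_norm x i).trans hx
        have h3 : x i ^ 2 ≤ R ^ 2 := sq_le_sq' (abs_le.1 h2).1 (abs_le.1 h2).2
        nlinarith [sq_nonneg (2 * x i + n i)]
      nlinarith [h1 0, h1 1, h1 2]) (by
      simp only [hFT]
      refine Summable.mul_left _ ?_
      have h := (b.dualEquiv hN).summable_iff.2
        (b.summable_phi0_dual hN (ModularGroup.S • τ) z).norm
      refine Summable.of_norm_bounded h fun m => ?_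
      rw [norm_mul, norm_e_ratCast, one_mul]
      rfl)
  simp only [hFT] at hpois
  rw [tsum_mul_left, (b.dualEquiv hN).tsum_eq fun Y : RegTheta.dual N Λ =>
    e (form N X₀ (Y : V) : ℂ) * phi0 N (Y : V) (ModularGroup.S • τ) z] at hpois
  rw [← hpois, ← finThreeEquiv.tsum_eq]
  refine tsum_congr fun n => ?_
  rw [b.phi0_point hN]
  rfl

lemma e_add_intCast (w : ℂ) (n : ℤ) : e (w + n) = e w := by
  rw [e, e, mul_add, Complex.exp_add, mul_comm (2 * Real.pi * Complex.I) (n : ℂ),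
    Complex.exp_int_mul_two_pi_mul_I, mul_one]

lemma phi0_neg (X : V) (τ z : ℍ) : phi0 N (-X) τ z = phi0 N X τ z := by
  have h : pairXz N (-X) z = -pairXz N X z := by
    rw [pairXz_eq, pairXz_eq]
    simp only [V.neg_apply]
    push_cast
    ring
  simp only [phi0, majorant, h, neg_sq, map_neg, LinearMap.neg_apply, neg_neg]

/-- The translation `u ↦ u + 1` multiplies each term by `e(Q(X))`, which depends only on the class
of `X`. -/
theorem theta_T_smul (hL : IsEvenLattice N L) (τ z : ℍ) :
    theta N L (ModularGroup.T • τ) z = weilT N L (theta N L τ z) := by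
  funext h
  rw [weilT, theta, theta, ← tsum_mul_left]
  refine tsum_congr fun X => ?_
  obtain ⟨n, hn⟩ := exists_quad_eq_add hL ((toDisc_eq_iff _ _).1 X.2)
  have h1 : (ModularGroup.T • τ).re = τ.re + 1 := by
    rw [UpperHalfPlane.modular_T_smul, UpperHalfPlane.vadd_re, add_comm]
  have h2 : (ModularGroup.T • τ).im = τ.im := by
    rw [UpperHalfPlane.modular_T_smul, UpperHalfPlane.vadd_im]
  have h3 : e (quad N (rep h) : ℂ) = e (quad N (X.1 : V) : ℂ) := by
    rw [hn]
    push_cast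
    rw [e_add_intCast]
  rw [h3, phi0, phi0, h1, h2, e, mul_left_comm, ← Complex.exp_add, form_self]
  congr 2
  push_cast
  ring

lemma tsum_dual_eq_sum (hN : 0 < N) (hL : IsEvenLattice N L) {F : dual N L → ℂ}
    (hF : Summable F) : ∑' Y, F Y =
      ∑ᶠ h : Disc N L, ∑' X : {X : dual N L // toDisc N L X = h}, F X.1 := by
  have := finite_disc hN hL
  have := Fintype.ofFinite (Disc N L)
  rw [finsum_eq_sum_of_fintype, ← (Equiv.sigmaFiberEquiv (toDisc N L)).tsum_eq]
  exact ((Equiv.sigmaFiberEquiv (toDisc N L)).summable_iff.2 hF).tsum_sigma.trans (tsum_fintype _)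

lemma conjLattice_one : conjLattice 1 L = L := by
  ext X
  rw [mem_conjLattice, conj_one, LinearMap.id_apply]

theorem theta_eq_tsum (b : HermiteBasis L) (hLd : L ≤ dual N L) (τ z : ℍ) (h : Disc N L) :
    theta N L τ z h = ∑' q : ℤ × ℤ × ℤ, phi0 N (b.point (rep h) q) τ z := by
  have key : ∀ (M : Submodule ℤ V) (b : HermiteBasis M), M = conjLattice 1 L →
      theta N L τ z h = ∑' q : ℤ × ℤ × ℤ, phi0 N (b.point (rep h) q) τ z := by
    intro M b hM
    subst hM
    have h1 := theta_smul_eq_tsum b hLd τ z h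
    rwa [one_smul, inv_one, conj_one, LinearMap.id_apply] at h1
  exact key L b conjLattice_one.symm

lemma S_smul_S_smul (τ : ℍ) : ModularGroup.S • ModularGroup.S • τ = τ := by
  apply UpperHalfPlane.ext
  rw [coe_S_smul, coe_S_smul, inv_neg, inv_inv, neg_neg]

/-- Poisson summation at `S τ`, whose dual side lives at `S S τ = τ`; the sum over `L'` is then
grouped by classes of `L'/L`. -/
theorem theta_S_smul (hN : 0 < N) (hL : IsEvenLattice N L) (τ z : ℍ) (h : Disc N L) :
    theta N L (ModularGroup.S • τ) z h =
      (τ : ℂ) ^ (1 / 2 : ℂ) * weilS N L (theta N L τ z) h := by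
  have hLd := le_dual hL
  obtain ⟨b⟩ := exists_hermiteBasis hL.isLattice.fg (exists_smul_mem_of_isLattice hL.isLattice)
  have hβ : (0 : ℝ) < b.β := by exact_mod_cast b.β_pos
  have hδ : (0 : ℝ) < b.δ := by exact_mod_cast b.δ_pos
  have hγ : (0 : ℝ) < b.γ := by exact_mod_cast b.γ_pos
  have hN' : (0 : ℝ) < N := by exact_mod_cast hN
  -- The covolume factor of Poisson summation is exactly the square root of the order of the
  -- discriminant group.
  have hcard : Real.sqrt (Nat.card (Disc N L)) = N * (b.β * b.δ * b.γ) * Real.sqrt (2 * N) := by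
    have h1 : (Nat.card (Disc N L) : ℝ) = 2 * N ^ 3 * ((b.β : ℝ) * b.δ * b.γ) ^ 2 := by
      exact_mod_cast b.card_disc hN hL
    rw [h1, show 2 * (N : ℝ) ^ 3 * ((b.β : ℝ) * b.δ * b.γ) ^ 2 =
      (N * (b.β * b.δ * b.γ)) ^ 2 * (2 * N) by ring, Real.sqrt_mul (by positivity),
      Real.sqrt_sq (by positivity)]
  have hw := neg_I_mul_re_pos τ
  have harg : (-Complex.I * (τ : ℂ)).arg ≠ Real.pi := by
    intro h
    have := (Complex.arg_eq_pi_iff.1 h).1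
    linarith
  rw [theta_eq_tsum b hLd, b.tsum_phi0_eq hN, S_smul_S_smul, neg_I_mul_S_smul,
    Complex.inv_cpow _ _ harg, inv_inv, cpow_half_neg_I_mul, weilS, hcard]
  have hsum : Summable fun Y : dual N L => e (-(form N (rep h) (Y : V) : ℂ)) *
      phi0 N (Y : V) τ z := by
    refine Summable.of_norm_bounded (b.summable_phi0_dual hN τ z).norm fun Y => ?_
    have := norm_e_ratCast (-(form N (rep h) (Y : V)))
    push_cast at this
    rw [norm_mul, this, one_mul]
  -- The symmetry `Y ↦ -Y` of `φ₀` turns the character into the one in `ρ_L(S)`.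
  have hneg : ∑' Y : dual N L, e (form N (rep h) (Y : V) : ℂ) * phi0 N (Y : V) τ z =
      ∑' Y : dual N L, e (-(form N (rep h) (Y : V) : ℂ)) * phi0 N (Y : V) τ z := by
    rw [← (Equiv.neg (dual N L)).tsum_eq]
    refine tsum_congr fun Y => ?_
    have h1 : ((Equiv.neg (dual N L) Y : dual N L) : V) = -(Y : V) := rfl
    rw [h1, phi0_neg, map_neg]
    push_cast
    rfl
  have hfib : ∀ h' : Disc N L, ∑' X : {X : dual N L // toDisc N L X = h'},
      e (-(form N (rep h) (X.1 : V) : ℂ)) * phi0 N (X.1 : V) τ z =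
      e (-(form N (rep h') (rep h) : ℂ)) * theta N L τ z h' := by
    intro h'
    rw [theta, ← tsum_mul_left]
    refine tsum_congr fun X => ?_
    obtain ⟨n, hn⟩ := exists_form_eq_add hLd ((toDisc_eq_iff _ _).1 X.2)
      (show rep h - rep h ∈ L by rw [sub_self]; exact L.zero_mem)
    rw [form_comm (rep h), hn]
    congr 1
    have := e_add_intCast (-(form N (rep h') (rep h) : ℂ)) (-n)
    push_cast at this ⊢
    rw [← this]
    congr 1
    ring
  rw [hneg, tsum_dual_eq_sum hN hL hsum]
  simp only [hfib]
  push_cast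
  ring

end ThetaTransformation
end RegTheta

namespace RegTheta

/-! ### The contribution of a cusp that is entire in `s`. -/

section CuspPart

variable {N : ℕ} {Λ : Submodule ℤ V}

lemma isCompact_strip (B A : ℝ) :
    IsCompact ((fun q : ℝ × ℝ => pt q.1 q.2) '' (Set.Icc (-B) B ×ˢ Set.Icc (1 / 2) A)) := by
  refine (isCompact_Icc.prod isCompact_Icc).image_of_continuousOn ?_
  intro q hq
  have hy : 0 < q.2 := lt_of_lt_of_le (by norm_num) hq.2.1
  have him : 0 < ((q.1 : ℂ) + q.2 * Complex.I).im := by simpa using hy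
  have h1 : ContinuousAt (ofComplex : ℂ → ℍ) ((q.1 : ℂ) + q.2 * Complex.I) := by
    have h := UpperHalfPlane.isOpenEmbedding_coe.isInducing.continuousAt_iff
      (f := (ofComplex : ℂ → ℍ)) (x := (q.1 : ℂ) + q.2 * Complex.I)
    rw [h]
    refine continuousAt_id.congr ?_
    filter_upwards [isOpen_im_pos.mem_nhds him] with w hw
    simp [ofComplex_apply_of_im_pos hw]
  have h2 : ContinuousAt (fun q : ℝ × ℝ => (q.1 : ℂ) + q.2 * Complex.I) q := by fun_prop
  exact (ContinuousAt.comp (f := fun q : ℝ × ℝ => (q.1 : ℂ) + q.2 * Complex.I) h1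
    h2).continuousWithinAt

lemma pt_re_im (z : ℍ) : pt z.re z.im = z := by
  rw [pt]
  have : ((z.re : ℂ) + z.im * Complex.I) = z := Complex.re_add_im _
  rw [this, ofComplex_apply]

/-- The growth condition holds only above some height; below it the strip is compact. -/
lemma exists_exp_bound {φ : ℍ → ℂ} (hφ : Continuous φ) {C : ℝ} (hC : 0 < C)
    (hg : φ =O[atImInfty] fun z : ℍ => Real.exp (C * z.im)) (B : ℝ) :
    ∃ K : ℝ, 0 ≤ K ∧ ∀ z : ℍ, |z.re| ≤ B → 1 / 2 ≤ z.im → ‖φ z‖ ≤ K * Real.exp (C * z.im) := by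
  obtain ⟨c, hc⟩ := hg.bound
  obtain ⟨A, hA⟩ := (atImInfty_mem _).1 hc
  obtain ⟨M, hM⟩ := (isCompact_strip B A).exists_bound_of_continuousOn hφ.continuousOn
  refine ⟨max |c| |M|, (abs_nonneg _).trans (le_max_left _ _), fun z hx hy => ?_⟩
  have hexp : 1 ≤ Real.exp (C * z.im) := Real.one_le_exp (by positivity)
  by_cases h : A ≤ z.im
  · have h1 := hA z h
    simp only [Set.mem_ofPred_eq, Real.norm_eq_abs, Real.abs_exp] at h1
    exact h1.trans (mul_le_mul_of_nonneg_right ((le_abs_self c).trans (le_max_left _ _))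
      (Real.exp_pos _).le)
  · have h1 := hM z ⟨(z.re, z.im), ⟨abs_le.1 hx, hy, (not_le.1 h).le⟩, pt_re_im z⟩
    refine h1.trans ((le_abs_self M).trans ((le_max_right |c| |M|).trans ?_))
    exact le_mul_of_one_le_right ((abs_nonneg _).trans (le_max_left _ _)) hexp

lemma norm_cpow_neg_le {y S : ℝ} (hy : 1 / 2 ≤ y) {s : ℂ} (hs : |s.re| ≤ S) :
    ‖(y : ℂ) ^ (-s)‖ ≤ Real.exp (S * (y + 1)) := by
  have hy0 : 0 < y := lt_of_lt_of_le (by norm_num) hy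
  rw [Complex.norm_cpow_eq_rpow_re_of_pos hy0, Real.rpow_def_of_pos hy0, Real.exp_le_exp]
  have h1 : |Real.log y| ≤ y + 1 := by
    have h2 := Real.log_le_sub_one_of_pos hy0
    have h3 := Real.one_sub_inv_le_log_of_pos hy0
    have h4 : y⁻¹ ≤ 2 := by
      rw [inv_le_comm₀ hy0 (by norm_num)]
      linarith
    rw [abs_le]
    constructor <;> linarith
  refine (le_abs_self _).trans ?_
  rw [abs_mul, mul_comm, Complex.neg_re, abs_neg]
  exact mul_le_mul hs h1 (abs_nonneg _) ((abs_nonneg _).trans hs)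

/-- The theta kernel along a cusp, with its main part removed in the cuspidal neighbourhood. -/
def cuspKernel (N : ℕ) (b : HermiteBasis Λ) (X₀ : V) (p : ℂ × ℂ) (z : ℍ) : ℂ :=
  ((z.im / (b.β * Real.sqrt N) : ℝ) : ℂ) *
    (decayPart N b X₀ p z + if z.im ≤ 1 then mainPart N b X₀ p else 0)

/-- Everything but the decaying part is at most exponential in `y`, and `a y - c y² ≤ a² / (4 c)`.
The main part is present only for `y ≤ 1`, where `exp (a y) ≤ exp a`. So the integrand is bounded by
a constant, locally uniformly in the parameters. -/
lemma exists_cuspKernel_bound (hN : 0 < N) (b : HermiteBasis Λ) (X₀ : V) {φ : ℍ → ℂ} {C B K₁ : ℝ}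
    (hK₁ : 0 ≤ K₁) (hC : 0 < C)
    (hφ : ∀ z : ℍ, |z.re| ≤ B → 1 / 2 ≤ z.im → ‖φ z‖ ≤ K₁ * Real.exp (C * z.im))
    {p : ℂ × ℂ} (hp : p ∈ paramDomain) {S : ℝ} (hS : 0 ≤ S) :
    ∃ K : ℝ, ∀ᶠ q in 𝓝 p, ∀ s : ℂ, |s.re| ≤ S → ∀ z : ℍ, |z.re| ≤ B → 1 / 2 ≤ z.im →
      ‖φ z * cuspKernel N b X₀ q z * (z.im : ℂ) ^ (-s)‖ ≤ K := by
  have hβ : (0 : ℝ) < b.β := by exact_mod_cast b.β_pos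
  have hN' : (0 : ℝ) < N := by exact_mod_cast hN
  obtain ⟨c, hc, K, hK, hdec⟩ := exists_decayPart_bound hN b X₀ hp B
  have hmain := ((differentiableOn_mainPart hN b X₀).continuousOn.continuousAt
    (isOpen_paramDomain.mem_nhds hp)).norm.eventually_lt_const (lt_add_one _)
  set KM : ℝ := ‖mainPart N b X₀ p‖ + 1
  have hKM : 0 ≤ KM := by positivity
  set D : ℝ := 1 / (b.β * Real.sqrt N) with hD
  have hD0 : 0 ≤ D := by positivity
  set a : ℝ := C + 1 + S with ha
  refine ⟨K₁ * (D * (K * Real.exp (a ^ 2 / (4 * c)) + KM * Real.exp a)) * Real.exp S, ?_⟩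
  filter_upwards [hdec, hmain] with q hq1 hq2 s hs z hx hy
  have hy0 := z.im_pos
  have h1 := hφ z hx hy
  have h2 := norm_cpow_neg_le hy hs
  have h3 : ‖cuspKernel N b X₀ q z‖ ≤ D * Real.exp z.im * (K * Real.exp (-c * z.im ^ 2) +
      if z.im ≤ 1 then KM else 0) := by
    rw [cuspKernel, norm_mul, Complex.norm_real, Real.norm_of_nonneg (by positivity)]
    refine mul_le_mul ?_ ((norm_add_le _ _).trans (add_le_add (hq1 z hx hy) ?_)) (norm_nonneg _)
      (by positivity)
    · rw [hD, div_mul_eq_mul_div, one_mul]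
      refine div_le_div_of_nonneg_right ?_ (by positivity)
      linarith [Real.add_one_le_exp z.im]
    · split_ifs
      · exact hq2.le
      · simp
  rw [norm_mul, norm_mul]
  refine (mul_le_mul (mul_le_mul h1 h3 (norm_nonneg _) (by positivity)) h2 (norm_nonneg _)
    (by positivity)).trans ?_
  have e1 : K₁ * Real.exp (C * z.im) * (D * Real.exp z.im * (K * Real.exp (-c * z.im ^ 2) +
      if z.im ≤ 1 then KM else 0)) * Real.exp (S * (z.im + 1)) =
      K₁ * (D * (K * Real.exp (a * z.im - c * z.im ^ 2) +
        (if z.im ≤ 1 then KM else 0) * Real.exp (a * z.im))) * Real.exp S := by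
    have r1 : Real.exp (a * z.im - c * z.im ^ 2) = Real.exp (C * z.im) * Real.exp z.im *
        Real.exp (S * z.im) * Real.exp (-c * z.im ^ 2) := by
      rw [← Real.exp_add, ← Real.exp_add, ← Real.exp_add, ha]
      congr 1
      ring
    have r2 : Real.exp (a * z.im) = Real.exp (C * z.im) * Real.exp z.im *
        Real.exp (S * z.im) := by
      rw [← Real.exp_add, ← Real.exp_add, ha]
      congr 1
      ring
    have r3 : Real.exp (S * (z.im + 1)) = Real.exp (S * z.im) * Real.exp S := by
      rw [← Real.exp_add]
      congr 1
      ring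
    rw [r1, r2, r3]
    ring
  rw [e1]
  have e2 : Real.exp (a * z.im - c * z.im ^ 2) ≤ Real.exp (a ^ 2 / (4 * c)) := by
    rw [Real.exp_le_exp, le_div_iff₀ (by positivity)]
    nlinarith [sq_nonneg (a - 2 * c * z.im)]
  have e3 : (if z.im ≤ 1 then KM else 0) * Real.exp (a * z.im) ≤ KM * Real.exp a := by
    split_ifs with h
    · refine mul_le_mul_of_nonneg_left (Real.exp_le_exp.2 ?_) hKM
      exact mul_le_of_le_one_right (by positivity) h
    · rw [zero_mul]
      positivity
  gcongr

lemma fullDomain_subset (a : ℕ) :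
    fullDomain a ⊆ {z : ℍ | |z.re| ≤ (a + 1 : ℝ) ∧ 1 / 2 ≤ z.im} := by
  intro z hz
  obtain ⟨⟨h1, h2⟩, h3⟩ := mem_fullDomain_bounds hz
  refine ⟨abs_le.2 ⟨?_, ?_⟩, h3⟩
  · have : (0 : ℝ) ≤ a := Nat.cast_nonneg a
    linarith
  · linarith

lemma aestronglyMeasurable_cuspKernel (hN : 0 < N) (b : HermiteBasis Λ) (X₀ : V)
    {p : ℂ × ℂ} (hp : p ∈ paramDomain) {φ : ℍ → ℂ} (hφ : Continuous φ) (a : ℕ) (s : ℂ) :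
    AEStronglyMeasurable (fun z : ℍ => φ z * cuspKernel N b X₀ p z * (z.im : ℂ) ^ (-s))
      (volume.restrict (fullDomain a)) := by
  have h1 : AEStronglyMeasurable (decayPart N b X₀ p) (volume.restrict (fullDomain a)) :=
    ((continuousOn_decayPart hN b X₀ hp _).mono (fullDomain_subset a)).aestronglyMeasurable
      (measurableSet_fullDomain a)
  have h2 : AEStronglyMeasurable (fun z : ℍ => if z.im ≤ 1 then mainPart N b X₀ p else 0)
      (volume.restrict (fullDomain a)) := by
    refine (Measurable.ite ?_ measurable_const measurable_const).aestronglyMeasurable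
    exact measurableSet_le UpperHalfPlane.continuous_im.measurable measurable_const
  have h3 : Continuous fun z : ℍ => ((z.im / (b.β * Real.sqrt N) : ℝ) : ℂ) :=
    Complex.continuous_ofReal.comp (UpperHalfPlane.continuous_im.div_const _)
  unfold cuspKernel
  exact (hφ.aestronglyMeasurable.mul (h3.aestronglyMeasurable.mul (h1.add h2))).mul
    (continuous_im_cpow (-s)).aestronglyMeasurable

/-- The contribution to the regularized integral that is entire in `s`. -/
def cuspPart (N : ℕ) (b : HermiteBasis Λ) (X₀ : V) (φ : ℍ → ℂ) (a : ℕ) (q : (ℂ × ℂ) × ℂ) : ℂ :=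
  ∫ z in fullDomain a, φ z * cuspKernel N b X₀ q.1 z * (z.im : ℂ) ^ (-q.2)

/-- A bounded integrand on a domain of finite volume, holomorphic in the parameters. Joint
holomorphy in `(u, v)` and `s` serves both the continuation in `s` and the smoothness in `τ`. -/
lemma differentiableOn_cuspPart (hN : 0 < N) (b : HermiteBasis Λ) (X₀ : V) {φ : ℍ → ℂ}
    (hφ : Continuous φ) {C : ℝ} (hC : 0 < C)
    (hg : φ =O[atImInfty] fun z : ℍ => Real.exp (C * z.im)) (a : ℕ) :
    DifferentiableOn ℂ (cuspPart N b X₀ φ a) (paramDomain ×ˢ Set.univ) := by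
  obtain ⟨K₁, hK₁, hb⟩ := exists_exp_bound hφ hC hg (a + 1)
  refine differentiableOn_integral_of_locally_dominated
    (isOpen_paramDomain.prod isOpen_univ) (fun q hq => ?_) ?_ fun q hq => ?_
  · exact aestronglyMeasurable_cuspKernel hN b X₀ hq.1 hφ a q.2
  · refine (ae_restrict_mem (measurableSet_fullDomain a)).mono fun z hz => ?_
    have hz2 := (fullDomain_subset a hz).2
    have hfst : DifferentiableOn ℂ (fun q : (ℂ × ℂ) × ℂ => q.1) (paramDomain ×ˢ Set.univ) :=
      differentiableOn_fst
    have hmaps : Set.MapsTo (fun q : (ℂ × ℂ) × ℂ => q.1) (paramDomain ×ˢ Set.univ) paramDomain :=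
      fun q hq => hq.1
    have h1 := (differentiableOn_decayPart hN b X₀ hz2).comp hfst hmaps
    have h2 := (differentiableOn_mainPart hN b X₀).comp hfst hmaps
    have h3 : DifferentiableOn ℂ (fun q : (ℂ × ℂ) × ℂ => (z.im : ℂ) ^ (-q.2))
        (paramDomain ×ˢ Set.univ) := by
      have : Differentiable ℂ (fun q : (ℂ × ℂ) × ℂ => (z.im : ℂ) ^ (-q.2)) :=
        differentiable_snd.neg.const_cpow (Or.inl (by exact_mod_cast z.im_pos.ne'))
      exact this.differentiableOn
    unfold cuspKernel
    refine DifferentiableOn.mul (DifferentiableOn.mul (differentiableOn_const _)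
      (DifferentiableOn.mul (differentiableOn_const _) (DifferentiableOn.add h1 ?_))) h3
    split_ifs
    · exact h2
    · exact differentiableOn_const _
  · obtain ⟨K, hK⟩ := exists_cuspKernel_bound hN b X₀ hK₁ hC hb hq.1
      (S := |q.2.re| + 1) (by positivity)
    have hs : ∀ᶠ s : ℂ in 𝓝 q.2, |s.re| ≤ |q.2.re| + 1 :=
      ((Complex.continuous_re.abs.tendsto q.2).eventually_lt_const (lt_add_one _)).mono
        fun s hs => hs.le
    refine ⟨fun _ => K, _, prod_mem_nhds hK hs, ?_, ?_⟩
    · have : IsFiniteMeasure (volume.restrict (fullDomain a)) :=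
        ⟨by rw [Measure.restrict_apply_univ]; exact volume_fullDomain_lt_top a⟩
      exact integrable_const K
    · refine (ae_restrict_mem (measurableSet_fullDomain a)).mono fun z hz r hr => ?_
      have := fullDomain_subset a hz
      exact hr.1 r.2 hr.2 z this.1 this.2

end CuspPart
end RegTheta

namespace RegTheta

/-! ### Locally uniform limits and tails. -/

section Convergence

/-- Rewrites locally uniform convergence as an ordinary limit along a product filter, so that the
usual limit rules apply to the error terms. -/
lemma tendstoLocallyUniformlyOn_iff_tendsto_sub {ι α : Type*} [TopologicalSpace α]
    {F : ι → α → ℂ} {f : α → ℂ} {l : Filter ι} {S : Set α} :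
    TendstoLocallyUniformlyOn F f l S ↔
      ∀ x ∈ S, Tendsto (fun y : ι × α => F y.1 y.2 - f y.2) (l ×ˢ 𝓝[S] x) (𝓝 0) := by
  rw [tendstoLocallyUniformlyOn_iff_forall_tendsto]
  refine forall₂_congr fun x hx => ?_
  rw [uniformity_eq_comap_nhds_zero, tendsto_comap_iff]
  rfl

variable {N : ℕ} {Λ : Submodule ℤ V}

lemma integrableOn_cuspKernel (hN : 0 < N) (b : HermiteBasis Λ) (X₀ : V) {φ : ℍ → ℂ}
    (hφ : Continuous φ) {C : ℝ} (hC : 0 < C)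
    (hg : φ =O[atImInfty] fun z : ℍ => Real.exp (C * z.im)) (a : ℕ)
    {p : ℂ × ℂ} (hp : p ∈ paramDomain) (s : ℂ) :
    IntegrableOn (fun z : ℍ => φ z * cuspKernel N b X₀ p z * (z.im : ℂ) ^ (-s))
      (fullDomain a) := by
  obtain ⟨K₁, hK₁, hb⟩ := exists_exp_bound hφ hC hg (a + 1)
  obtain ⟨K, hK⟩ := exists_cuspKernel_bound hN b X₀ hK₁ hC hb hp (abs_nonneg s.re)
  refine IntegrableOn.of_bound (volume_fullDomain_lt_top a)
    (aestronglyMeasurable_cuspKernel hN b X₀ hp hφ a s) K ?_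
  refine (ae_restrict_mem (measurableSet_fullDomain a)).mono fun z hz => ?_
  have := fullDomain_subset a hz
  exact hK.self_of_nhds s le_rfl z this.1 this.2

/-- The part of the entire contribution that comes from above height `T` tends to `0`. -/
lemma tendsto_tail_cuspKernel (hN : 0 < N) (b : HermiteBasis Λ) (X₀ : V) {φ : ℍ → ℂ}
    (hφ : Continuous φ) {C : ℝ} (hC : 0 < C)
    (hg : φ =O[atImInfty] fun z : ℍ => Real.exp (C * z.im)) (a : ℕ)
    {p : ℂ × ℂ} (hp : p ∈ paramDomain) (s₀ : ℂ) :
    Tendsto (fun y : ℝ × ℂ => ∫ z in fullDomain a ∩ {z | y.1 < z.im},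
      φ z * cuspKernel N b X₀ p z * (z.im : ℂ) ^ (-y.2)) (atTop ×ˢ 𝓝 s₀) (𝓝 0) := by
  obtain ⟨K₁, hK₁, hb⟩ := exists_exp_bound hφ hC hg (a + 1)
  obtain ⟨K, hK⟩ := exists_cuspKernel_bound hN b X₀ hK₁ hC hb hp
    (S := |s₀.re| + 1) (by positivity)
  have hlim := ((tendsto_volume_fullDomain_above a).const_mul K).comp
    (tendsto_fst (f := (atTop : Filter ℝ)) (g := 𝓝 s₀))
  rw [mul_zero] at hlim
  refine squeeze_zero_norm' ?_ hlim
  have hs : ∀ᶠ s : ℂ in 𝓝 s₀, |s.re| ≤ |s₀.re| + 1 :=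
    ((Complex.continuous_re.abs.tendsto s₀).eventually_lt_const (lt_add_one _)).mono
      fun s hs => hs.le
  filter_upwards [tendsto_snd.eventually hs] with y hy
  have hfin : volume (fullDomain a ∩ {z | y.1 < z.im}) < ⊤ :=
    (measure_mono Set.inter_subset_left).trans_lt (volume_fullDomain_lt_top a)
  refine norm_setIntegral_le_of_norm_le_const hfin fun z hz => ?_
  have := fullDomain_subset a hz.1
  exact hK.self_of_nhds y.2 hy z this.1 this.2

end Convergence

/-! ### The truncated integral and its limit. -/

section TruncIntegral

variable {N : ℕ} {L : Submodule ℤ V} {Γ : Subgroup SL(2, ℤ)} {f : ℍ → ℂ}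

lemma IsWeakMaassForm.continuous_comp_smul {lam : ℂ} (hf : IsWeakMaassForm Γ lam f)
    (g : SL(2, ℤ)) : Continuous fun z : ℍ => f (g • z) :=
  hf.smooth.continuous.comp (continuous_smul_SL g)

lemma integrableOn_strip {φ : ℍ → ℂ} (hφ : Continuous φ) (a : ℕ) (T : ℝ) :
    IntegrableOn φ (fullDomain a ∩ {z | z.im ∈ Set.Ioc 1 T}) := by
  obtain ⟨M, hM⟩ := (isCompact_strip (a + 1) T).exists_bound_of_continuousOn hφ.continuousOn
  have hm : MeasurableSet (fullDomain a ∩ {z | z.im ∈ Set.Ioc 1 T}) :=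
    (measurableSet_fullDomain a).inter
      (UpperHalfPlane.continuous_im.measurable measurableSet_Ioc)
  refine Measure.integrableOn_of_bounded (M := M) ?_ hφ.aestronglyMeasurable ?_
  · exact ((measure_mono Set.inter_subset_left).trans_lt (volume_fullDomain_lt_top a)).ne
  · refine (ae_restrict_mem hm).mono fun z hz => ?_
    have := fullDomain_subset a hz.1
    exact hM z ⟨(z.re, z.im), ⟨abs_le.1 this.1, this.2, hz.2.2⟩, pt_re_im z⟩

/-- On the truncated domain the integrand is the entire contribution plus the main term, the latter
only for `1 < y ≤ T`. -/
lemma truncDomain_integrand_eq (hN : 0 < N) (hLd : L ≤ RegTheta.dual N L) {g : SL(2, ℤ)}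
    (b : HermiteBasis (conjLattice g L)) (τ : ℍ) (h : Disc N L) (s : ℂ) (a : ℕ) {T : ℝ}
    {z : ℍ} (hz : z ∈ truncDomain a T) :
    f (g • z) * theta N L τ (g • z) h * (z.im : ℂ) ^ (-s) =
      f (g • z) * cuspKernel N b (conj g⁻¹ (rep h)) (paramOf τ) z * (z.im : ℂ) ^ (-s) +
      (fullDomain a ∩ {z | z.im ∈ Set.Ioc 1 T}).indicator (fun z =>
        mainPart N b (conj g⁻¹ (rep h)) (paramOf τ) / (b.β * Real.sqrt N : ℝ) *
          (f (g • z) * (z.im : ℂ) * (z.im : ℂ) ^ (-s))) z := by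
  rw [theta_smul_eq hN hLd b τ (mem_fullDomain_bounds hz.1).2 h, cuspKernel, Set.indicator]
  have hT : z.im ≤ T := hz.2
  by_cases h1 : z.im ≤ 1
  · have : z ∉ fullDomain a ∩ {z | z.im ∈ Set.Ioc 1 T} := fun h => absurd h.2.1 (not_lt.2 h1)
    rw [if_neg this, if_pos h1]
    ring
  · have : z ∈ fullDomain a ∩ {z | z.im ∈ Set.Ioc 1 T} := ⟨hz.1, not_le.1 h1, hT⟩
    rw [if_pos this, if_neg h1]
    push_cast
    ring

lemma integrableOn_truncDomain {lam : ℂ} (hN : 0 < N) (hLd : L ≤ RegTheta.dual N L)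
    (hf : IsWeakMaassForm Γ lam f) {g : SL(2, ℤ)}
    (b : HermiteBasis (conjLattice g L)) (τ : ℍ) (h : Disc N L) (s : ℂ) (a : ℕ) (T : ℝ) :
    IntegrableOn (fun z : ℍ => f (g • z) * theta N L τ (g • z) h * (z.im : ℂ) ^ (-s))
      (truncDomain a T) := by
  obtain ⟨C, hC, hg⟩ := hf.growth
  have hc := hf.continuous_comp_smul g
  have hm : MeasurableSet (fullDomain a ∩ {z | z.im ∈ Set.Ioc 1 T}) :=
    (measurableSet_fullDomain a).inter
      (UpperHalfPlane.continuous_im.measurable measurableSet_Ioc)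
  refine IntegrableOn.congr_fun (Integrable.add
    (((integrableOn_cuspKernel hN b (conj g⁻¹ (rep h)) hc hC (hg g) a (paramOf_mem τ) s).mono_set
      Set.inter_subset_left)) (Integrable.mono_measure ((integrable_indicator_iff hm).2
        (integrableOn_strip ?_ a T)) Measure.restrict_le_self))
    (fun z hz => (truncDomain_integrand_eq hN hLd b τ h s a hz).symm)
    (measurableSet_truncDomain a T)
  exact continuous_const.mul ((hc.mul (Complex.continuous_ofReal.comp
    UpperHalfPlane.continuous_im)).mul (continuous_im_cpow _))

/-- The contribution of a cusp to the regularized integral. -/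
def cuspValue (N : ℕ) (L : Submodule ℤ V) (f : ℍ → ℂ) (g : SL(2, ℤ)) (a : ℕ)
    (b : HermiteBasis (conjLattice g L)) (τ : ℍ) (h : Disc N L) (s : ℂ) : ℂ :=
  cuspPart N b (conj g⁻¹ (rep h)) (fun z => f (g • z)) a (paramOf τ, s)

/-- An exact formula at finite height: the full entire contribution, minus its tail above `T`, plus
the elementary integral of the main term. -/
lemma truncIntegral_eq {lam : ℂ} (hN : 0 < N) (hLd : L ≤ RegTheta.dual N L)
    (hΓ : CongruenceSubgroup.IsCongruenceSubgroup Γ)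
    (hf : IsWeakMaassForm Γ lam f) {g : SL(2, ℤ)}
    (b : HermiteBasis (conjLattice g L)) (τ : ℍ) (h : Disc N L) {s' A B : ℂ}
    (hAB : ∀ y : ℝ, 0 < y →
      fourierConst Γ g f y = A * (y : ℂ) ^ s' + B * (y : ℂ) ^ (1 - s'))
    {s : ℂ} (h1 : s ≠ s') (h2 : s ≠ 1 - s') {T : ℝ} (hT : 1 ≤ T) :
    truncIntegral N L Γ g f τ h T s =
      cuspValue N L f g (cuspWidth Γ g) b τ h s -
      (∫ z in fullDomain (cuspWidth Γ g) ∩ {z | T < z.im}, f (g • z) *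
        cuspKernel N b (conj g⁻¹ (rep h)) (paramOf τ) z * (z.im : ℂ) ^ (-s)) +
      mainPart N b (conj g⁻¹ (rep h)) (paramOf τ) / (b.β * Real.sqrt N : ℝ) *
        (cuspWidth Γ g * (A * ((1 - (T : ℂ) ^ (s' - s)) / (s - s')) +
          B * ((1 - (T : ℂ) ^ (1 - s' - s)) / (s + s' - 1)))) := by
  obtain ⟨C, hC, hg⟩ := hf.growth
  have hc := hf.continuous_comp_smul g
  set a := cuspWidth Γ g with ha
  have hm : MeasurableSet (fullDomain a ∩ {z | z.im ∈ Set.Ioc 1 T}) :=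
    (measurableSet_fullDomain a).inter
      (UpperHalfPlane.continuous_im.measurable measurableSet_Ioc)
  have hk := integrableOn_cuspKernel hN b (conj g⁻¹ (rep h)) hc hC (hg g) a (paramOf_mem τ) s
  rw [truncIntegral, ← ha, setIntegral_congr_fun (measurableSet_truncDomain a T)
    (fun z hz => truncDomain_integrand_eq hN hLd b τ h s a hz)]
  have hstrip : Integrable ((fullDomain a ∩ {z | z.im ∈ Set.Ioc 1 T}).indicator (fun z =>
      mainPart N b (conj g⁻¹ (rep h)) (paramOf τ) / (b.β * Real.sqrt N : ℝ) *
        (f (g • z) * (z.im : ℂ) * (z.im : ℂ) ^ (-s)))) :=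
    (integrable_indicator_iff hm).2 (integrableOn_strip (continuous_const.mul
      ((hc.mul (Complex.continuous_ofReal.comp
        UpperHalfPlane.continuous_im)).mul (continuous_im_cpow _))) a T)
  have hkT : IntegrableOn _ (truncDomain a T) := hk.mono_set Set.inter_subset_left
  rw [integral_add hkT
    (hstrip.mono_measure Measure.restrict_le_self)]
  rw [setIntegral_indicator hm]
  have hset : truncDomain a T ∩ (fullDomain a ∩ {z | z.im ∈ Set.Ioc 1 T}) =
      fullDomain a ∩ {z | z.im ∈ Set.Ioc 1 T} :=
    Set.inter_eq_right.2 fun z hz => ⟨hz.1, hz.2.2⟩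
  rw [hset, integral_const_mul, ha,
    setIntegral_mainTerm hΓ hf.smooth.continuous hf.invariant g hAB h1 h2 hT, ← ha]
  congr 1
  rw [eq_sub_iff_add_eq, ← setIntegral_union]
  · rw [cuspValue, cuspPart]
    congr 2
    ext z
    simp only [truncDomain_eq, Set.mem_union, Set.mem_inter_iff, Set.mem_ofPred_eq, ← and_or_left,
      le_or_gt, and_true]
  · refine Set.disjoint_left.2 fun z hz hz' => ?_
    exact absurd hz'.2 (not_lt.2 hz.2)
  · exact (measurableSet_fullDomain a).inter
      (UpperHalfPlane.continuous_im.measurable measurableSet_Ioi)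
  · exact hk.mono_set Set.inter_subset_left
  · exact hk.mono_set Set.inter_subset_left

lemma ne_of_max_lt_re {s s' : ℂ} (hs : max s'.re (1 - s'.re) < s.re) : s ≠ s' ∧ s ≠ 1 - s' := by
  constructor
  · rintro rfl
    exact absurd hs (not_lt.2 (le_max_left _ _))
  · rintro rfl
    simp at hs

/-- Convergence of the regularized integral at a cusp. -/
theorem tendstoLocallyUniformlyOn_truncIntegral {lam : ℂ} (hN : 0 < N)
    (hLd : L ≤ RegTheta.dual N L)
    (hΓ : CongruenceSubgroup.IsCongruenceSubgroup Γ)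
    (hf : IsWeakMaassForm Γ lam f) {g : SL(2, ℤ)}
    (b : HermiteBasis (conjLattice g L)) (τ : ℍ) (h : Disc N L) {s' A B : ℂ}
    (hAB : ∀ y : ℝ, 0 < y →
      fourierConst Γ g f y = A * (y : ℂ) ^ s' + B * (y : ℂ) ^ (1 - s')) :
    TendstoLocallyUniformlyOn (fun (T : ℝ) (s : ℂ) => truncIntegral N L Γ g f τ h T s)
      (fun s => cuspValue N L f g (cuspWidth Γ g) b τ h s +
        1 / (Real.sqrt N : ℂ) * ((cuspEps L Γ g : ℂ) * thetaTilde L (g • ell0 N) τ h *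
          (A / (s - s') + B / (s + s' - 1)))) atTop
      {s : ℂ | max s'.re (1 - s'.re) < s.re} := by
  obtain ⟨C, hC, hg⟩ := hf.growth
  have hc := hf.continuous_comp_smul g
  rw [tendstoLocallyUniformlyOn_iff_tendsto_sub]
  intro s₀ hs₀
  obtain ⟨hn1, hn2⟩ := ne_of_max_lt_re hs₀
  set M := mainPart N b (conj g⁻¹ (rep h)) (paramOf τ) with hM
  set Ω : Set ℂ := {s : ℂ | max s'.re (1 - s'.re) < s.re} with hΩ
  have htail := (tendsto_tail_cuspKernel hN b (conj g⁻¹ (rep h)) hc hC (hg g) (cuspWidth Γ g)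
    (paramOf_mem τ) s₀).mono_left (Filter.prod_mono_right atTop
      (nhdsWithin_le_nhds (a := s₀) (s := Ω)))
  have hp1 := tendstoLocallyUniformlyOn_iff_tendsto_sub.1 (tendstoLocallyUniformlyOn_cpow s'
    (le_max_left s'.re (1 - s'.re))) s₀ hs₀
  have hp2 := tendstoLocallyUniformlyOn_iff_tendsto_sub.1 (tendstoLocallyUniformlyOn_cpow (1 - s')
    (x₀ := max s'.re (1 - s'.re)) (by simp)) s₀ hs₀
  simp only [sub_zero] at hp1 hp2
  have hsnd : Tendsto (fun y : ℝ × ℂ => y.2) (atTop ×ˢ 𝓝[Ω] s₀) (𝓝 s₀) :=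
    tendsto_snd.mono_right nhdsWithin_le_nhds
  have hd2 : s₀ + s' - 1 ≠ 0 := fun h => hn2 (by linear_combination h)
  have q1 := hp1.mul ((hsnd.sub_const s').inv₀ (sub_ne_zero.2 hn1))
  have q2 := hp2.mul (((hsnd.add_const s').sub_const 1).inv₀ hd2)
  -- The error consists of the tail and of the two powers of `T`, the latter divided by factors that
  -- do not vanish at `s₀`.
  have hall := htail.neg.sub (((q1.const_mul A).add (q2.const_mul B)).const_mul
    (M / (b.β * Real.sqrt N : ℝ) * cuspWidth Γ g))
  simp only [zero_mul, mul_zero, add_zero, sub_zero, neg_zero] at hall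
  refine hall.congr' ?_
  have hΩmem : ∀ᶠ y : ℝ × ℂ in atTop ×ˢ 𝓝[Ω] s₀, y.2 ∈ Ω :=
    tendsto_snd.eventually self_mem_nhdsWithin
  filter_upwards [tendsto_fst.eventually (eventually_ge_atTop (1 : ℝ)), hΩmem] with y hT hy
  obtain ⟨m1, m2⟩ := ne_of_max_lt_re hy
  rw [truncIntegral_eq hN hLd hΓ hf b τ h hAB m1 m2 hT, thetaTilde_eq_mainPart hN hLd b τ h, ← hM,
    cuspEps, b.cuspBeta_eq]
  push_cast
  have hβ : ((b.β : ℝ) : ℂ) ≠ 0 := by exact_mod_cast b.β_pos.ne'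
  simp only [div_eq_mul_inv, mul_inv]
  ring

theorem cuspIntegral_eq {lam : ℂ} (hN : 0 < N) (hLd : L ≤ RegTheta.dual N L)
    (hΓ : CongruenceSubgroup.IsCongruenceSubgroup Γ)
    (hf : IsWeakMaassForm Γ lam f) {g : SL(2, ℤ)}
    (b : HermiteBasis (conjLattice g L)) (τ : ℍ) (h : Disc N L) {s' A B : ℂ}
    (hAB : ∀ y : ℝ, 0 < y →
      fourierConst Γ g f y = A * (y : ℂ) ^ s' + B * (y : ℂ) ^ (1 - s'))
    {s : ℂ} (hs : max s'.re (1 - s'.re) < s.re) :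
    cuspIntegral N L Γ g f τ h s = cuspValue N L f g (cuspWidth Γ g) b τ h s +
        1 / (Real.sqrt N : ℂ) * ((cuspEps L Γ g : ℂ) * thetaTilde L (g • ell0 N) τ h *
          (A / (s - s') + B / (s + s' - 1))) :=
  ((tendstoLocallyUniformlyOn_truncIntegral hN hLd hΓ hf b τ h hAB).tendsto_at hs).limUnder_eq

end TruncIntegral
end RegTheta

namespace RegTheta

/-! ### Smoothness in `τ` and reduction to the generators of `Mp₂(ℤ)`. -/

section Automorphy

variable {N : ℕ} {L : Submodule ℤ V}

/-- Complex smoothness in `(u, v)` restricts to real smoothness in `τ` along the real-linear map `τ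
↦ (re τ, im τ)`. -/
lemma smoothOnH_of_differentiableOn {G : ℂ × ℂ → ℂ} (hG : DifferentiableOn ℂ G paramDomain) :
    SmoothOnH fun τ => G (paramOf τ) := by
  have h1 : ContDiffOn ℝ ∞ G paramDomain :=
    (contDiffOn_of_differentiableOn isOpen_paramDomain hG).restrict_scalars ℝ
  have h2 : ContDiff ℝ ∞ fun z : ℂ => ((z.re : ℂ), (z.im : ℂ)) :=
    (Complex.ofRealCLM.contDiff.comp Complex.reCLM.contDiff).prodMk
      (Complex.ofRealCLM.contDiff.comp Complex.imCLM.contDiff)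
  have hcoe : ∀ z : ℂ, 0 < z.im → paramOf (ofComplex z) = ((z.re : ℂ), (z.im : ℂ)) := by
    intro z hz
    simp only [paramOf, ofComplex_apply_of_im_pos hz]
    rfl
  refine (h1.comp h2.contDiffOn (s := {z : ℂ | 0 < z.im}) fun z hz => ?_).congr fun z hz => ?_
  · rw [← hcoe z hz]
    exact paramOf_mem _
  · change G (paramOf (ofComplex z)) = _
    rw [hcoe z hz]
    rfl

/-- It suffices to check the transformation law on the generators of `Mp₂(ℤ)`. -/
theorem isAutomorphicForm_of_generators {F : ℍ → Disc N L → ℂ}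
    (hF : ∀ h, SmoothOnH fun τ => F τ h)
    (hT : ∀ τ, F (ModularGroup.T • τ) = weilT N L (F τ))
    (hS : ∀ τ : ℍ, F (ModularGroup.S • τ) = (τ : ℂ) ^ (1 / 2 : ℂ) • (weilS N L (F τ))) :
    IsAutomorphicForm N L 1 F := by
  refine ⟨hF, fun g R hgR => ?_⟩
  -- Homogeneity of the operators is carried through the induction, because in a product the inner
  -- automorphy factor has to be pulled out of the outer operator.
  suffices h : ∀ x ∈ weilGraph N L,
      (∀ τ : ℍ, F (x.1.mat • τ) = x.1.root τ • (x.2 (F τ) : Disc N L → ℂ)) ∧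
      ∀ (k : ℂ) (G : Disc N L → ℂ), x.2 (k • G) = k • (x.2 G : Disc N L → ℂ) by
    intro τ
    rw [zpow_one]
    exact (h _ hgR).1 τ
  intro x hx
  induction hx using Submonoid.closure_induction with
  | mem x hx =>
    rcases hx with rfl | rfl
    · refine ⟨fun τ => ?_, fun k G => ?_⟩
      · change F (ModularGroup.T • τ) = (1 : ℂ) • _
        rw [hT, one_smul]
      · funext h
        simp only [weilT, Pi.smul_apply, smul_eq_mul]
        ring
    · refine ⟨fun τ => hS τ, fun k G => ?_⟩
      funext h
      simp only [weilS, Pi.smul_apply, smul_eq_mul]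
      rw [mul_left_comm, ← smul_eq_mul k (∑ᶠ _, _), smul_finsum]
      simp only [smul_eq_mul]
      congr 1
      exact finsum_congr fun h' => by ring
  | one =>
    refine ⟨fun τ => ?_, fun k G => rfl⟩
    change F ((1 : SL(2, ℤ)) • τ) = (1 : ℂ) • F τ
    rw [one_smul, one_smul]
  | mul x y _ _ hx hy =>
    refine ⟨fun τ => ?_, fun k G => ?_⟩
    · change F ((x.1.mat * y.1.mat) • τ) = (x.1.root (y.1.mat • τ) * y.1.root τ) •
        (x.2 (y.2 (F τ)) : Disc N L → ℂ)
      rw [mul_smul, hx.1, hy.1, hx.2, smul_smul]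
    · change x.2 (y.2 (k • G)) = k • (x.2 (y.2 G) : Disc N L → ℂ)
      rw [hy.2, hx.2]

lemma exists_matrix_weilT [Fintype (Disc N L)] :
    ∃ r : Disc N L → Disc N L → ℂ, ∀ F h, weilT N L F h = ∑ h', r h h' * F h' := by
  classical
  exact ⟨fun h h' => if h' = h then e (quad N (rep h) : ℂ) else 0, fun F h => by simp [weilT]⟩

lemma exists_matrix_weilS [Fintype (Disc N L)] (k : ℂ) :
    ∃ r : Disc N L → Disc N L → ℂ, ∀ F h, k * weilS N L F h = ∑ h', r h h' * F h' := by
  refine ⟨fun h h' => k * (e (-1 / 8) / (Real.sqrt (Nat.card (Disc N L)) : ℂ) *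
    e (-(form N (rep h') (rep h) : ℂ))), fun F h => ?_⟩
  rw [weilS, finsum_eq_sum_of_fintype, Finset.mul_sum, Finset.mul_sum]
  exact Finset.sum_congr rfl fun h' _ => by ring

/-- The integral is linear in the kernel; integrability over the truncated domain is what allows the
finite sum to be exchanged with it. -/
lemma truncIntegral_eq_sum [Fintype (Disc N L)] {Γ : Subgroup SL(2, ℤ)} {f : ℍ → ℂ} {lam : ℂ}
    (hN : 0 < N) (hLd : L ≤ RegTheta.dual N L)
    (hf : IsWeakMaassForm Γ lam f) {g : SL(2, ℤ)} (b : HermiteBasis (conjLattice g L))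
    {τ τ' : ℍ} {r : Disc N L → Disc N L → ℂ}
    (hθ : ∀ z h, theta N L τ' z h = ∑ h', r h h' * theta N L τ z h') (h : Disc N L) (T : ℝ)
    (s : ℂ) :
    truncIntegral N L Γ g f τ' h T s = ∑ h', r h h' * truncIntegral N L Γ g f τ h' T s := by
  simp only [truncIntegral, ← integral_const_mul]
  rw [← integral_finsetSum _ fun h' _ =>
    (integrableOn_truncDomain hN hLd hf b τ h' s (cuspWidth Γ g) T).const_mul (r h h')]
  refine setIntegral_congr_fun (measurableSet_truncDomain _ T) fun z _ => ?_
  simp only [hθ, Finset.mul_sum, Finset.sum_mul]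
  exact Finset.sum_congr rfl fun h' _ => by ring

end Automorphy

/-! ### The regularized lift as an explicit meromorphic function. -/

section RegLift

variable {N : ℕ} {L : Submodule ℤ V} {Γ : Subgroup SL(2, ℤ)} {f : ℍ → ℂ}
  [Fintype (Cusps N Γ)] {σ : Cusps N Γ → SL(2, ℤ)}

/-- The part of the regularized integral that is entire in `s`. -/
def entirePart (f : ℍ → ℂ) (b : ∀ c : Cusps N Γ, HermiteBasis (conjLattice (σ c) L))
    (h : Disc N L) (p : ℂ × ℂ) (s : ℂ) : ℂ :=
  ∑ c, cuspPart N (b c) (conj (σ c)⁻¹ (rep h)) (fun z => f (σ c • z)) (cuspWidth Γ (σ c)) (p, s)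

/-- The coefficient of a polar term of the regularized integral. -/
def polarCoeff (b : ∀ c : Cusps N Γ, HermiteBasis (conjLattice (σ c) L)) (A : Cusps N Γ → ℂ)
    (h : Disc N L) (p : ℂ × ℂ) : ℂ :=
  1 / (Real.sqrt N : ℂ) * ∑ c, (cuspEps L Γ (σ c) : ℂ) *
    mainPart N (b c) (conj (σ c)⁻¹ (rep h)) p * A c

variable {lam s' : ℂ} {A B : Cusps N Γ → ℂ}

lemma differentiable_entirePart (hN : 0 < N) (hf : IsWeakMaassForm Γ lam f)
    (b : ∀ c : Cusps N Γ, HermiteBasis (conjLattice (σ c) L)) (h : Disc N L)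
    {p : ℂ × ℂ} (hp : p ∈ paramDomain) : Differentiable ℂ (entirePart f b h p) := by
  obtain ⟨C, hC, hg⟩ := hf.growth
  unfold entirePart
  refine Differentiable.fun_sum fun c _ => ?_
  rw [← differentiableOn_univ]
  exact (differentiableOn_cuspPart hN (b c) _ (hf.continuous_comp_smul (σ c)) hC (hg _) _).comp
    (f := fun s : ℂ => (p, s)) ((differentiable_const p).prodMk differentiable_id).differentiableOn
    fun s _ => ⟨hp, Set.mem_univ _⟩

lemma differentiableOn_entirePart (hN : 0 < N) (hf : IsWeakMaassForm Γ lam f)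
    (b : ∀ c : Cusps N Γ, HermiteBasis (conjLattice (σ c) L)) (h : Disc N L) (s : ℂ) :
    DifferentiableOn ℂ (fun p => entirePart f b h p s) paramDomain := by
  obtain ⟨C, hC, hg⟩ := hf.growth
  unfold entirePart
  refine DifferentiableOn.fun_sum fun c _ => ?_
  exact (differentiableOn_cuspPart hN (b c) _ (hf.continuous_comp_smul (σ c)) hC (hg _) _).comp
    (f := fun p : ℂ × ℂ => (p, s)) (differentiable_id.prodMk (differentiable_const s)).differentiableOn
    fun p hp => ⟨hp, Set.mem_univ _⟩

lemma differentiableOn_polarCoeff (hN : 0 < N)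
    (b : ∀ c : Cusps N Γ, HermiteBasis (conjLattice (σ c) L)) (A : Cusps N Γ → ℂ)
    (h : Disc N L) : DifferentiableOn ℂ (polarCoeff b A h) paramDomain := by
  unfold polarCoeff
  refine DifferentiableOn.const_mul (DifferentiableOn.fun_sum fun c _ => ?_) _
  exact ((differentiableOn_mainPart hN (b c) _).const_mul _).mul_const _

/-- The meromorphic function of `s` that continues the regularized integral. -/
def regPolar (f : ℍ → ℂ) (b : ∀ c : Cusps N Γ, HermiteBasis (conjLattice (σ c) L)) (s' : ℂ)
    (A B : Cusps N Γ → ℂ) (h : Disc N L) (p : ℂ × ℂ) : ℂ → ℂ :=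
  polar s' (entirePart f b h p) (polarCoeff b A h p) (polarCoeff b B h p)

lemma smoothOnH_regPolar (hN : 0 < N) (hf : IsWeakMaassForm Γ lam f)
    (b : ∀ c : Cusps N Γ, HermiteBasis (conjLattice (σ c) L)) (s' : ℂ)
    (A B : Cusps N Γ → ℂ) (h : Disc N L) (s : ℂ) :
    SmoothOnH fun τ => regPolar f b s' A B h (paramOf τ) s := by
  refine smoothOnH_of_differentiableOn (G := fun p => regPolar f b s' A B h p s) ?_
  unfold regPolar polar
  simp only [div_eq_mul_inv]
  exact ((differentiableOn_entirePart hN hf b h s).add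
    ((differentiableOn_polarCoeff hN b A h).mul_const _)).add
    ((differentiableOn_polarCoeff hN b B h).mul_const _)

/-- The sum over the cusps of the limits: entire parts add to `entirePart`, polar terms to the two
coefficients at the common poles. -/
theorem regIntegral_eq (hN : 0 < N) (hLd : L ≤ RegTheta.dual N L)
    (hΓ : CongruenceSubgroup.IsCongruenceSubgroup Γ) (hf : IsWeakMaassForm Γ lam f)
    (b : ∀ c : Cusps N Γ, HermiteBasis (conjLattice (σ c) L))
    (hAB : ∀ c, ∀ y : ℝ, 0 < y →
      fourierConst Γ (σ c) f y = A c * (y : ℂ) ^ s' + B c * (y : ℂ) ^ (1 - s'))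
    (τ : ℍ) (h : Disc N L) {s : ℂ} (hs : max s'.re (1 - s'.re) < s.re) :
    regIntegral N L Γ σ f s τ h = regPolar f b s' A B h (paramOf τ) s := by
  rw [regIntegral, finsum_eq_sum_of_fintype, regPolar, polar, entirePart, polarCoeff, polarCoeff,
    mul_div_assoc, mul_div_assoc, Finset.sum_div, Finset.sum_div, Finset.mul_sum, Finset.mul_sum,
    ← Finset.sum_add_distrib, ← Finset.sum_add_distrib]
  refine Finset.sum_congr rfl fun c _ => ?_
  rw [cuspIntegral_eq hN hLd hΓ hf (b c) τ h (hAB c) hs, cuspValue,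
    thetaTilde_eq_mainPart hN hLd (b c) τ h]
  ring

theorem polarCoeff_add_polarCoeff (hN : 0 < N) (hLd : L ≤ RegTheta.dual N L)
    (b : ∀ c : Cusps N Γ, HermiteBasis (conjLattice (σ c) L)) (A B : Cusps N Γ → ℂ)
    (τ : ℍ) (h : Disc N L) (s : ℂ) :
    polarCoeff b A h (paramOf τ) / (s - s') + polarCoeff b B h (paramOf τ) / (s + s' - 1) =
      1 / (Real.sqrt N : ℂ) *
        ∑ᶠ c : Cusps N Γ, (cuspEps L Γ (σ c) : ℂ) * thetaTilde L (σ c • ell0 N) τ h *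
          (A c / (s - s') + B c / (s + s' - 1)) := by
  rw [finsum_eq_sum_of_fintype, polarCoeff, polarCoeff,
    mul_div_assoc, mul_div_assoc, Finset.sum_div, Finset.sum_div, ← mul_add,
    ← Finset.sum_add_distrib]
  congr 1
  refine Finset.sum_congr rfl fun c _ => ?_
  rw [thetaTilde_eq_mainPart hN hLd (b c) τ h]
  ring

/-- The continuation is `regPolar` near `0` off the point, and the value of `regPolar` at `0` is its
constant term even when `0` is a pole. Hence no case distinction on `s'` is needed. -/
theorem regLift_eq (hN : 0 < N) (hLd : L ≤ RegTheta.dual N L)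
    (hΓ : CongruenceSubgroup.IsCongruenceSubgroup Γ) (hf : IsWeakMaassForm Γ lam f)
    (b : ∀ c : Cusps N Γ, HermiteBasis (conjLattice (σ c) L))
    (hAB : ∀ c, ∀ y : ℝ, 0 < y →
      fourierConst Γ (σ c) f y = A c * (y : ℂ) ^ s' + B c * (y : ℂ) ^ (1 - s'))
    (τ : ℍ) (h : Disc N L) :
    regLift N L Γ σ f τ h = regPolar f b s' A B h (paramOf τ) 0 := by
  have hd := differentiable_entirePart hN hf b h (paramOf_mem τ)
  refine IsConstTerm.constTerm_eq ((isConstTerm_polar hd s' _ _ 0).congr ?_)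
  exact ((meroCont_spec hd fun s hs => regIntegral_eq hN hLd hΓ hf b hAB τ h hs).2 0).symm

variable [Fintype (Disc N L)]

/-- The linear relation holds at every truncation height, hence for the limits. -/
theorem regIntegral_eq_sum (hN : 0 < N) (hLd : L ≤ RegTheta.dual N L)
    (hΓ : CongruenceSubgroup.IsCongruenceSubgroup Γ) (hf : IsWeakMaassForm Γ lam f)
    (b : ∀ c : Cusps N Γ, HermiteBasis (conjLattice (σ c) L))
    (hAB : ∀ c, ∀ y : ℝ, 0 < y →
      fourierConst Γ (σ c) f y = A c * (y : ℂ) ^ s' + B c * (y : ℂ) ^ (1 - s'))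
    {τ τ' : ℍ} {r : Disc N L → Disc N L → ℂ}
    (hθ : ∀ z h, theta N L τ' z h = ∑ h', r h h' * theta N L τ z h') (h : Disc N L)
    {s : ℂ} (hs : max s'.re (1 - s'.re) < s.re) :
    regIntegral N L Γ σ f s τ' h = ∑ h', r h h' * regIntegral N L Γ σ f s τ h' := by
  simp only [regIntegral, finsum_eq_sum_of_fintype, Finset.mul_sum]
  rw [Finset.sum_comm]
  refine Finset.sum_congr rfl fun c _ => ?_
  have hlim : ∀ (τ : ℍ) (h : Disc N L), Tendsto (fun T => truncIntegral N L Γ (σ c) f τ h T s)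
      atTop (𝓝 (cuspIntegral N L Γ (σ c) f τ h s)) := fun τ h => by
    rw [cuspIntegral_eq hN hLd hΓ hf (b c) τ h (hAB c) hs]
    exact (tendstoLocallyUniformlyOn_truncIntegral hN hLd hΓ hf (b c) τ h (hAB c)).tendsto_at hs
  refine tendsto_nhds_unique (hlim τ' h) ?_
  simp only [truncIntegral_eq_sum hN hLd hf (b c) hθ]
  exact tendsto_finsetSum _ fun h' _ => (hlim τ h').const_mul _

/-- A combination of functions of type `polar` with the same poles is again of this type. It
represents the integral at `τ'` on the half plane, so uniqueness of the continuation carries the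
relation to the constant term at `0`. -/
theorem regLift_eq_sum (hN : 0 < N) (hLd : L ≤ RegTheta.dual N L)
    (hΓ : CongruenceSubgroup.IsCongruenceSubgroup Γ) (hf : IsWeakMaassForm Γ lam f)
    (b : ∀ c : Cusps N Γ, HermiteBasis (conjLattice (σ c) L))
    (hAB : ∀ c, ∀ y : ℝ, 0 < y →
      fourierConst Γ (σ c) f y = A c * (y : ℂ) ^ s' + B c * (y : ℂ) ^ (1 - s'))
    {τ τ' : ℍ} {r : Disc N L → Disc N L → ℂ}
    (hθ : ∀ z h, theta N L τ' z h = ∑ h', r h h' * theta N L τ z h') (h : Disc N L) :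
    regLift N L Γ σ f τ' h = ∑ h', r h h' * regLift N L Γ σ f τ h' := by
  have hsum : ∀ s, ∑ h', r h h' * regPolar f b s' A B h' (paramOf τ) s =
      polar s' (fun s => ∑ h', r h h' * entirePart f b h' (paramOf τ) s)
        (∑ h', r h h' * polarCoeff b A h' (paramOf τ))
        (∑ h', r h h' * polarCoeff b B h' (paramOf τ)) s := fun s => by
    rw [polar, Finset.sum_div, Finset.sum_div, ← Finset.sum_add_distrib,
      ← Finset.sum_add_distrib]
    refine Finset.sum_congr rfl fun h' _ => ?_
    rw [regPolar, polar]
    ring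
  have hd : Differentiable ℂ fun s => ∑ h', r h h' * entirePart f b h' (paramOf τ) s :=
    Differentiable.fun_sum fun h' _ =>
      (differentiable_entirePart hN hf b h' (paramOf_mem τ)).const_mul _
  simp only [regLift_eq hN hLd hΓ hf b hAB τ, hsum]
  refine IsConstTerm.constTerm_eq ((isConstTerm_polar hd s' _ _ 0).congr ?_)
  refine ((meroCont_spec hd fun s hs => ?_).2 0).symm
  rw [regIntegral_eq_sum hN hLd hΓ hf b hAB hθ h hs, ← hsum]
  exact Finset.sum_congr rfl fun h' _ => by rw [regIntegral_eq hN hLd hΓ hf b hAB τ h' hs]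

/-- A function of `τ` that transforms like the theta function is an automorphic form. -/
theorem isAutomorphicForm_of_theta (hN : 0 < N) (hL : IsEvenLattice N L) {F : ℍ → Disc N L → ℂ}
    (hF : ∀ h, SmoothOnH fun τ => F τ h)
    (hr : ∀ (τ τ' : ℍ) (r : Disc N L → Disc N L → ℂ),
      (∀ z h, theta N L τ' z h = ∑ h', r h h' * theta N L τ z h') →
      ∀ h, F τ' h = ∑ h', r h h' * F τ h') : IsAutomorphicForm N L 1 F := by
  refine isAutomorphicForm_of_generators hF (fun τ => ?_) fun τ => ?_
  · obtain ⟨r, h1⟩ := exists_matrix_weilT (N := N) (L := L)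
    funext h
    rw [h1]
    refine hr _ _ r (fun z h => ?_) h
    rw [theta_T_smul hL, h1]
  · obtain ⟨r, h1⟩ := exists_matrix_weilS (N := N) (L := L) ((τ : ℂ) ^ (1 / 2 : ℂ))
    funext h
    rw [Pi.smul_apply, smul_eq_mul, h1]
    refine hr _ _ r (fun z h => ?_) h
    rw [theta_S_smul hN hL, h1]

end RegLift
end RegTheta

end

theorem mainTheorem7 (N : ℕ) (hN : 0 < N) (L : Submodule ℤ V) (hL : IsEvenLattice N L)
    (Γ : Subgroup SL(2, ℤ)) (hΓ : IsAdmissible N L Γ)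
    (σ : Cusps N Γ → SL(2, ℤ)) (hσ : ∀ c, toCusp Γ (σ c • ell0 N) = c)
    (s' : ℂ) (f : ℍ → ℂ) (hf : IsWeakMaassForm Γ (s' * (1 - s')) f) :
    (s' ≠ 1 / 2 → ∃ A B : Cusps N Γ → ℂ, ∀ c, ∀ y : ℝ, 0 < y →
      fourierConst Γ (σ c) f y = A c * (y : ℂ) ^ s' + B c * (y : ℂ) ^ (1 - s')) ∧
    ∀ A B : Cusps N Γ → ℂ,
      (∀ c, ∀ y : ℝ, 0 < y →
        fourierConst Γ (σ c) f y = A c * (y : ℂ) ^ s' + B c * (y : ℂ) ^ (1 - s')) →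
      -- locally uniform convergence in a right half plane
      (∀ (c : Cusps N Γ) (τ : ℍ) (h : Disc N L),
        TendstoLocallyUniformlyOn
          (fun (T : ℝ) (s : ℂ) => truncIntegral N L Γ (σ c) f τ h T s)
          (fun s : ℂ => cuspIntegral N L Γ (σ c) f τ h s) atTop
          {s : ℂ | max s'.re (1 - s'.re) < s.re}) ∧
      (∀ s : ℂ, max s'.re (1 - s'.re) < s.re →
        IsAutomorphicForm N L 1 (fun τ => regIntegral N L Γ σ f s τ)) ∧
      -- meromorphic continuation with at most simple poles at `s'` and `1 - s'`
      (∀ (τ : ℍ) (h : Disc N L),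
        MeromorphicOn (regCont N L Γ σ f τ h) Set.univ ∧
        (∀ s : ℂ, max s'.re (1 - s'.re) < s.re →
          regCont N L Γ σ f τ h s = regIntegral N L Γ σ f s τ h) ∧
        (∀ s : ℂ, s ≠ s' → s ≠ 1 - s' → AnalyticAt ℂ (regCont N L Γ σ f τ h) s) ∧
        (-1 : ℤ) ≤ meromorphicOrderAt (regCont N L Γ σ f τ h) s' ∧
        (-1 : ℤ) ≤ meromorphicOrderAt (regCont N L Γ σ f τ h) (1 - s')) ∧
      -- the singular part
      (∀ (τ : ℍ) (h : Disc N L), ∃ H : ℂ → ℂ, Differentiable ℂ H ∧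
        ∀ s : ℂ, s ≠ s' → s ≠ 1 - s' →
          regCont N L Γ σ f τ h s - 1 / (Real.sqrt N : ℂ) *
            ∑ᶠ c : Cusps N Γ, (cuspEps L Γ (σ c) : ℂ) * thetaTilde L (σ c • ell0 N) τ h *
              (A c / (s - s') + B c / (s + s' - 1)) = H s) ∧
      -- the regularized theta lift
      IsAutomorphicForm N L 1 (regLift N L Γ σ f) := by
  have hLd := le_dual hL
  have hcong := hΓ.congruence
  refine ⟨fun hs' => ?_, fun A B hAB => ?_⟩
  · choose A B h using fun c => exists_fourierConst_eq hcong hs' hf (σ c)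
    exact ⟨A, B, h⟩
  have := finite_cusps hcong hσ
  have := finite_disc hN hL
  let _ : Fintype (Cusps N Γ) := Fintype.ofFinite _
  let _ : Fintype (Disc N L) := Fintype.ofFinite _
  have b : ∀ c : Cusps N Γ, HermiteBasis (conjLattice (σ c) L) := fun c =>
    (nonempty_hermiteBasis_conjLattice hL.isLattice (σ c)).some
  have hd : ∀ τ h, Differentiable ℂ (entirePart f b h (paramOf τ)) := fun τ h =>
    differentiable_entirePart hN hf b h (paramOf_mem τ)
  have hspec : ∀ τ h, MeromorphicNFOn (regCont N L Γ σ f τ h) Set.univ ∧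
      ∀ s, regCont N L Γ σ f τ h =ᶠ[𝓝[≠] s] regPolar f b s' A B h (paramOf τ) := fun τ h =>
    meroCont_spec (hd τ h) fun s hs => regIntegral_eq hN hLd hcong hf b hAB τ h hs
  -- The continuation is in normal form, so away from the two poles it equals `regPolar` at the
  -- point itself, not just around it.
  have hnhds : ∀ τ h s, s ≠ s' → s ≠ 1 - s' →
      regCont N L Γ σ f τ h =ᶠ[𝓝 s] regPolar f b s' A B h (paramOf τ) := fun τ h s h1 h2 =>
    eventuallyEq_of_nhdsNE_of_polar (hd τ h) (hspec τ h).1 ((hspec τ h).2 s) h1 h2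
  refine ⟨fun c τ h => ?_, fun s hs => ?_, fun τ h => ⟨(hspec τ h).1.meromorphicOn,
    fun s hs => ?_, fun s h1 h2 => ?_, ?_, ?_⟩, fun τ h => ⟨_, hd τ h, fun s h1 h2 => ?_⟩, ?_⟩
  · exact (tendstoLocallyUniformlyOn_truncIntegral hN hLd hcong hf (b c) τ h (hAB c)).congr_right
      fun s hs => (cuspIntegral_eq hN hLd hcong hf (b c) τ h (hAB c) hs).symm
  · refine isAutomorphicForm_of_theta hN hL (fun h => ?_) fun τ τ' r hr h =>
      regIntegral_eq_sum hN hLd hcong hf b hAB hr h hs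
    simp only [regIntegral_eq hN hLd hcong hf b hAB _ h hs]
    exact smoothOnH_regPolar hN hf b s' A B h s
  · obtain ⟨h1, h2⟩ := ne_of_max_lt_re hs
    rw [(hnhds τ h s h1 h2).eq_of_nhds, regIntegral_eq hN hLd hcong hf b hAB τ h hs]
  · exact (analyticAt_polar (hd τ h) _ _ h1 h2).congr (hnhds τ h s h1 h2).symm
  · rw [meromorphicOrderAt_congr ((hspec τ h).2 s')]
    exact neg_one_le_meromorphicOrderAt_polar (hd τ h) s' _ _ s'
  · rw [meromorphicOrderAt_congr ((hspec τ h).2 (1 - s'))]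
    exact neg_one_le_meromorphicOrderAt_polar (hd τ h) s' _ _ (1 - s')
  · rw [(hnhds τ h s h1 h2).eq_of_nhds, ← polarCoeff_add_polarCoeff hN hLd b A B τ h s, regPolar,
      polar]
    ring
  · refine isAutomorphicForm_of_theta hN hL (fun h => ?_) fun τ τ' r hr h =>
      regLift_eq_sum hN hLd hcong hf b hAB hr h
    simp only [regLift_eq hN hLd hcong hf b hAB _ h]
    exact smoothOnH_regPolar hN hf b s' A B h 0
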